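/- **Setting.** Let $a,b\in(0,+\infty]$ and let $f\colon[0,a)\to[0,b)$ be continuous, continuously differentiable on $(0,a)$, with $f(0)=0$, $f'>0$ on $(0,a)$ and $f(s)\to b$ as $s\to a^-$. For $v\in\mathbb R^3$, $|v|<a$, put $\varphi(v)=f(|v|)\,v/|v|$ if $v\ne 0$ and $\varphi(0)=0$; put $G(s)=\int_0^s f^{-1}(\xi)\,d\xi$ for $s\in[0,b)$. Let $V\colon(0,+\infty)\to\mathbb R$ be of class $C^2$. For $|\varepsilon|<\varepsilon_0$ let $U_\varepsilon\colon\mathbb R^3\setminus\{0\}\to\mathbb R$ and $A_\varepsilon\colon\mathbb R^3\setminus\{0\}\to\mathbb R^3$ be of class $C^2$, with all their $x$-derivatives of order $\le 2$ depending continuously on $(\varepsilon,x)$ (as is the case when they depend smoothly on $\varepsilon$), and with $U_0\equiv0$, $A_0\equiv 0$. Consider the autonomous equation $$\frac{d}{dt}\varphi(\dot x)=V'(|x|)\frac{x}{|x|}+\nabla U_\varepsilon(x)+\dot x\wedge \operatorname{curl}A_\varepsilon(x),\qquad x\in\mathbb R^3\setminus\{0\},\qquad (1_\varepsilon)$$ and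 its energy $\mathcal E_\varepsilon(x,v)=G(|\varphi(v)|)-V(|x|)-U_\varepsilon(x)$. A solution is rectilinear if $x(t)/|x(t)|$ is constant. Let $h\in\mathbb R$ and let $\mathcal M$ be a non-empty compact manifold (without boundary, of some dimension $m$) of non-constant, non-rectilinear periodic solutions of the unperturbed equation $(1_0)$, all of energy $\mathcal E_0(x,\dot x)\equiv h$; here $x\in\mathcal M$ is identified with its initial condition $(x(0),\varphi(\dot x(0)))$, and being a manifold means that the set of these points is a $C^1$-embedded submanifold of $\mathbb R^6$. Let $\mathcal M\ni x\mapsto T(x)\in(0,+\infty)$ be a $C^1$ choice of a (not necessarily minimal) period of $x$. Let $\mathcal H_0(x,p)=G(|p|)-V(|x|)$ and $J=\begin{pmatrix}0&-I_3\\ I_3&0\end{pmatrix}$. Assume that $\mathcal M$ is non-degenerate for the fixed-energy problem: for every $x\in\mathcal M$, with $z(t)=(x(t),\varphi(\dot x(t)))$, the linear space of the $T(x)$-periodic functions $w\colon\mathbb R\to\mathbb R^6$ such that $$Jw'=\nabla^2\mathcal H_0(z(t))\,w+\gamma\,\nabla\mathcal H_0(z(t))\ \text{ for some }\gamma\in\mathbb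 R,\qquad \langle\nabla\mathcal H_0(z(t)),w(t)\rangle\equiv0,$$ has dimension $m=\dim\mathcal M$. **Theorem 5.2.** For every $\sigma>0$ there is $\varepsilon^*\in(0,\varepsilon_0]$ such that for every $\varepsilon\in(-\varepsilon^*,\varepsilon^*)$ there are $T>0$, a $T$-periodic solution $x$ of $(1_\varepsilon)$ with $\mathcal E_\varepsilon(x(t),\dot x(t))=h$ for all $t$, and $x^*\in\mathcal M$ such that $|T-T(x^*)|<\sigma$ and $|x(t)-x^*(t)|<\sigma$ for every $t\in[0,T]$. -/

import Mathlib

open scoped Manifold ContDiff Topology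

noncomputable section

namespace CentralForce

/-- The Euclidean space `ℝ³`. -/
abbrev R3 : Type := EuclideanSpace ℝ (Fin 3)

/-- The phase space `ℝ⁶ = ℝ³ × ℝ³` of pairs `(x, p)`, with its Euclidean structure. -/
abbrev Phase : Type := WithLp 2 (R3 × R3)

/-! ### The nonlinear differential operator -/

/-- The interval `[0, a)` for an extended real number `a`. -/
def speeds (a : EReal) : Set ℝ := {s | 0 ≤ s ∧ (s : EReal) < a}

/-- The hypotheses on `f : [0, a) → [0, b)` with `a, b ∈ (0, +∞]` (only the values of `f` on `[0, a)`
matter). They make `f` an increasing bijection from `[0, a)` onto `[0, b)`, and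
`v ↦ f(|v|) v / |v|` a homeomorphism from the ball `B_a(0)` onto the ball `B_b(0)`. -/
structure IsProfile (a b : EReal) (f : ℝ → ℝ) : Prop where
  a_pos : 0 < a
  b_pos : 0 < b
  mapsTo : Set.MapsTo f (speeds a) (speeds b)
  continuousOn : ContinuousOn f (speeds a)
  contDiffOn : ContDiffOn ℝ 1 f {s : ℝ | 0 < s ∧ (s : EReal) < a}
  map_zero : f 0 = 0
  deriv_pos : ∀ s : ℝ, 0 < s → (s : EReal) < a → 0 < deriv f s
  tendsto : Filter.Tendsto (fun s : ℝ => (f s : EReal))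
    (Filter.comap (fun s : ℝ => (s : EReal)) (𝓝[<] a)) (𝓝 b)

/-- `φ(v) = f(|v|) v / |v|` for `v ≠ 0`, and `φ(0) = 0`. -/
def phi (f : ℝ → ℝ) (v : R3) : R3 := (f ‖v‖ / ‖v‖) • v

/-- The inverse `f⁻¹ : [0, b) → [0, a)`. -/
def profileInv (a : EReal) (f : ℝ → ℝ) : ℝ → ℝ := Function.invFunOn f (speeds a)

/-- `G(s) = ∫₀ˢ f⁻¹(ξ) dξ` for `s ∈ [0, b)`. -/
def bigG (a : EReal) (f : ℝ → ℝ) (s : ℝ) : ℝ := ∫ ξ in (0 : ℝ)..s, profileInv a f ξ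

/-! ### Electromagnetic perturbations and the equation of motion -/

/-- The vector product in `ℝ³`. -/
def wedge (v w : R3) : R3 := WithLp.toLp 2 (crossProduct v.ofLp w.ofLp)

/-- The partial derivative `∂A_i / ∂x_j` at `x`. -/
def partialDeriv (A : R3 → R3) (j i : Fin 3) (x : R3) : ℝ :=
  fderiv ℝ A x (EuclideanSpace.single j 1) i

/-- The curl of a vector field on `ℝ³`. -/
def curl (A : R3 → R3) (x : R3) : R3 :=
  !₂[partialDeriv A 1 2 x - partialDeriv A 2 1 x,
     partialDeriv A 2 0 x - partialDeriv A 0 2 x,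
     partialDeriv A 0 1 x - partialDeriv A 1 0 x]

/-- A family `g_ε`, `|ε| < ε₀`, of functions of class `C²` on `ℝ³ \ {0}`, all of whose derivatives
up to order two are jointly continuous in `(ε, x)`. -/
structure IsC2Family {F : Type*} [NormedAddCommGroup F] [NormedSpace ℝ F]
    (ε₀ : ℝ) (g : ℝ → R3 → F) : Prop where
  contDiffOn : ∀ ε ∈ Set.Ioo (-ε₀) ε₀, ContDiffOn ℝ 2 (g ε) {x : R3 | x ≠ 0}
  continuousOn : ∀ k : ℕ, k ≤ 2 →
    ContinuousOn (fun q : ℝ × R3 => iteratedFDeriv ℝ k (g q.1) q.2)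
      (Set.Ioo (-ε₀) ε₀ ×ˢ {x : R3 | x ≠ 0})

/-- `x : ℝ → ℝ³ \ {0}` is a (classical, global) solution of the autonomous equation
`d/dt φ(x') = V'(|x|) x / |x| + ∇U(x) + x' ∧ curl A(x)`. -/
def IsSolution (a : EReal) (f V : ℝ → ℝ) (U : R3 → ℝ) (A : R3 → R3) (x : ℝ → R3) : Prop :=
  ∀ t : ℝ, x t ≠ 0 ∧ DifferentiableAt ℝ x t ∧ (‖deriv x t‖ : EReal) < a ∧
    HasDerivAt (fun s => phi f (deriv x s))
      ((deriv V ‖x t‖ / ‖x t‖) • x t + gradient U (x t) + wedge (deriv x t) (curl A (x t))) t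

/-- The energy `G(|φ(v)|) - V(|x|) - U(x)`. -/
def energy (a : EReal) (f V : ℝ → ℝ) (U : R3 → ℝ) (x v : R3) : ℝ :=
  bigG a f ‖phi f v‖ - V ‖x‖ - U x

/-- A motion is rectilinear if `x(t) / |x(t)|` is constant. -/
def IsRectilinear (x : ℝ → R3) : Prop := ∃ c : R3, ∀ t : ℝ, (‖x t‖)⁻¹ • x t = c

/-- A motion is constant. -/
def IsConstant (x : ℝ → R3) : Prop := ∃ c : R3, ∀ t : ℝ, x t = c

/-! ### The unperturbed Hamiltonian system and non-degeneracy at fixed energy -/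

/-- The Hamiltonian `H₀(x, p) = G(|p|) - V(|x|)`. -/
def hamiltonian (a : EReal) (f V : ℝ → ℝ) (z : Phase) : ℝ := bigG a f ‖z.snd‖ - V ‖z.fst‖

/-- The curve `z(t) = (x(t), φ(x'(t)))` in phase space. -/
def phaseCurve (f : ℝ → ℝ) (x : ℝ → R3) (t : ℝ) : Phase :=
  WithLp.toLp 2 (x t, phi f (deriv x t))

/-- The standard symplectic matrix, `J (x, p) = (-p, x)`. Hamilton's equations read
`J z' = ∇H(z)`. -/
def symplJ (z : Phase) : Phase := WithLp.toLp 2 (-z.snd, z.fst)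

/-- The linear space of the `T`-periodic solutions `w` of
`J w' = ∇²H(z(t)) w + γ ∇H(z(t))` for some `γ ∈ ℝ`, `⟨∇H(z(t)), w(t)⟩ ≡ 0`. -/
def fixedEnergyKernel (H : Phase → ℝ) (z : ℝ → Phase) (T : ℝ) : Submodule ℝ (ℝ → Phase) where
  carrier := {w | Function.Periodic w T ∧ Differentiable ℝ w ∧
    (∃ γ : ℝ, ∀ t : ℝ, symplJ (deriv w t) =
      fderiv ℝ (gradient H) (z t) (w t) + γ • gradient H (z t)) ∧
    ∀ t : ℝ, inner ℝ (gradient H (z t)) (w t) = 0}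
  zero_mem' := by
    refine ⟨fun t => rfl, differentiable_const 0, ⟨0, fun t => ?_⟩, fun t => ?_⟩
    · have h : deriv (0 : ℝ → Phase) t = 0 := deriv_const t 0
      rw [h]
      simp [symplJ]
    · simp
  add_mem' := by
    rintro v w ⟨hv1, hv2, ⟨γ, hv3⟩, hv4⟩ ⟨hw1, hw2, ⟨δ, hw3⟩, hw4⟩
    refine ⟨hv1.add hw1, hv2.add hw2, ⟨γ + δ, fun t => ?_⟩, fun t => ?_⟩
    · have hJ : ∀ y y' : Phase, symplJ (y + y') = symplJ y + symplJ y' := by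
        intro y y'
        simp only [symplJ, WithLp.add_fst, WithLp.add_snd, neg_add, ← WithLp.toLp_add,
          Prod.mk_add_mk]
      rw [deriv_add (hv2 t) (hw2 t), hJ, hv3 t, hw3 t, Pi.add_apply, map_add, add_smul]
      abel
    · rw [Pi.add_apply, inner_add_right, hv4 t, hw4 t, add_zero]
  smul_mem' := by
    rintro c w ⟨hw1, hw2, ⟨δ, hw3⟩, hw4⟩
    refine ⟨fun t => ?_, hw2.const_smul c, ⟨c * δ, fun t => ?_⟩, fun t => ?_⟩
    · simp only [Pi.smul_apply, hw1 t]
    · have hJ : ∀ y : Phase, symplJ (c • y) = c • symplJ y := by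
        intro y
        simp only [symplJ, WithLp.smul_fst, WithLp.smul_snd, ← WithLp.toLp_smul, Prod.smul_mk,
          smul_neg]
      rw [deriv_const_smul c (hw2 t), hJ, hw3 t, Pi.smul_apply, map_smul, smul_add, mul_smul]
    · rw [Pi.smul_apply, inner_smul_right, hw4 t, mul_zero]

/-- A compact `m`-dimensional manifold (without boundary) of non-constant, non-rectilinear periodic
solutions of `d/dt φ(x') = V'(|x|) x / |x|` of energy `h`. The point `q` of the manifold is the
solution `X q`; the manifold is embedded (with class `C¹`) in phase space through the initial
conditions, and `τ q` is a `C¹` choice of a (not necessarily minimal) period of `X q`. -/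
structure IsPeriodicManifold (a : EReal) (f V : ℝ → ℝ) (h : ℝ) (m : ℕ)
    (M : Type*) [TopologicalSpace M] [ChartedSpace (EuclideanSpace ℝ (Fin m)) M]
    (X : M → ℝ → R3) (τ : M → ℝ) : Prop where
  compactSpace : CompactSpace M
  isManifold : IsManifold (𝓡 m) 1 M
  isSolution : ∀ q, IsSolution a f V (fun _ => 0) (fun _ => 0) (X q)
  not_constant : ∀ q, ¬ IsConstant (X q)
  not_rectilinear : ∀ q, ¬ IsRectilinear (X q)
  energy_eq : ∀ q t, energy a f V (fun _ => 0) (X q t) (deriv (X q) t) = h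
  isEmbedding : Manifold.IsSmoothEmbedding (𝓡 m) 𝓘(ℝ, Phase) 1 (fun q => phaseCurve f (X q) 0)
  period_pos : ∀ q, 0 < τ q
  periodic : ∀ q, Function.Periodic (X q) (τ q)
  contMDiff_period : ContMDiff (𝓡 m) 𝓘(ℝ, ℝ) 1 τ

/-- Non-degeneracy for the fixed-energy problem: along each solution of the manifold, the space
of periodic solutions of the linearized fixed-energy problem has the dimension of the manifold. -/
def IsNondegenerate (a : EReal) (f V : ℝ → ℝ) (m : ℕ) {M : Type*}
    (X : M → ℝ → R3) (τ : M → ℝ) : Prop :=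
  ∀ q, Module.finrank ℝ
    (fixedEnergyKernel (hamiltonian a f V) (phaseCurve f (X q)) (τ q)) = m

end CentralForce

end

/-!
In terms of the canonical momentum `P = φ(ẋ) + A(x)`, the perturbed equation is the Hamiltonian
system of `G(|P - A(x)|) - V(|x|) - U(x)` (`isSolution_of_hasDerivAt`), so the claim is that a
compact manifold of periodic orbits of an autonomous Hamiltonian system, non-degenerate at fixed
energy, persists under small perturbations of the Hamiltonian.

The function `G(|k|)` need not be of class `C²` at `k = 0`, but the unperturbed orbits stay away
from there: their angular momentum is conserved, and it does not vanish because the orbits are not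
rectilinear (`phi_deriv_ne_zero`). By continuous dependence on the initial values the orbits fill a
compact subset of the region where the Hamiltonian is `C²` (`exists_isCompact_orbits`), and outside
of a neighbourhood of this set a cutoff makes the Hamiltonian zero
(`IsC2FamilyOn.isHamiltonianFamily_cutoff`). The flow `φ_t` is then defined globally, is `C¹` in the
initial value, and comes with an action (`exists_hamiltonianFlow`).

The unknowns are the initial value `z` and the period `T`, and the equations are `φ_T z = z` and
`H z = h`. They are variational: by the first variation formula (`hasFDerivAt_act_uncurry`) and the
conservation of energy, the derivative of the action of the orbit, closed up by a segment, plus `h T`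
is `⟨F, L ·⟩`, where `F = (-J (φ_T z - z), h - H z)` and the linear map `L` is the identity on the
kernel of `F'` at the unperturbed solutions. The problem is thereby one of finite dimension: if `F`
vanishes on a compact manifold `K`, if the kernel of `F'` along `K` is the tangent space of `K` and
is orthogonal to the range of `F'`, then every perturbation of `F` with the same variational
structure has a zero near `K` (`eventually_exists_zero_near_manifold`). This is a
Lyapunov–Schmidt reduction. Since `K` is only `C¹`, the projections `P` onto the kernels are merely
continuous along `K`; they are replaced by a `C¹` family of idempotents `Pr` close to them
(`exists_contDiff_idempotent_approx`). The derivative of the reduced equation `F - Pr F = 0` has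
full rank, so that near `K` its unperturbed solutions are exactly the points of `K`, and its
perturbed solutions form a non-empty compact set in a neighbourhood of `K`. A maximum of the
potential on this set solves `F = 0`, by Lagrange multipliers (`local_reduction`).

The hypothesis on the kernel of `F'` follows from the non-degeneracy condition: an element `(ζ, s)`
of the kernel gives the `T`-periodic solution `φ'_t ζ + (s / T) t z'(t)` of the linearized equation
with a multiplier (`finrank_ker_fixedEnergyLinearization_le`), and the orthogonality to the range
holds because the flow is symplectic. `eventually_exists_periodic_orbit` collects these facts for a
general Hamiltonian system.
-/

open scoped Manifold ContDiff Topology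

noncomputable section

namespace CentralForce

/-! ### Global flows of vector fields -/

section ODE

open Set Filter MeasureTheory
open scoped NNReal BoundedContinuousFunction

variable {S : Type*} [NormedAddCommGroup S] [NormedSpace ℝ S]

theorem abs_integral_exp_mul_abs_le {k : ℝ} (hk : 0 < k) (t : ℝ) :
    |∫ s in (0 : ℝ)..t, Real.exp (k * |s|)| ≤ Real.exp (k * |t|) / k := by
  have key : ∀ t : ℝ, 0 ≤ t →
      |∫ s in (0 : ℝ)..t, Real.exp (k * |s|)| ≤ Real.exp (k * |t|) / k := by
    intro t ht
    have h1 : ∫ s in (0 : ℝ)..t, Real.exp (k * |s|) = (Real.exp (k * t) - 1) / k := by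
      have : ∫ s in (0 : ℝ)..t, Real.exp (k * |s|) = ∫ s in (0 : ℝ)..t, Real.exp (k * s) := by
        refine intervalIntegral.integral_congr fun s hs => ?_
        rw [uIcc_of_le ht] at hs
        simp only [abs_of_nonneg hs.1]
      rw [this, intervalIntegral.integral_comp_mul_left (fun s => Real.exp s) hk.ne', integral_exp]
      simp [div_eq_inv_mul]
    rw [h1, abs_of_nonneg (by
      have := Real.one_le_exp (mul_nonneg hk.le ht)
      exact div_nonneg (by linarith) hk.le), abs_of_nonneg ht]
    gcongr
    linarith
  rcases le_total 0 t with ht | ht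
  · exact key t ht
  · have h2 := key (-t) (by linarith)
    have h3 : ∫ s in (0 : ℝ)..(-t), Real.exp (k * |s|) = -∫ s in (0 : ℝ)..t, Real.exp (k * |s|) := by
      have := intervalIntegral.integral_comp_neg (a := 0) (b := t) (fun s => Real.exp (k * |s|))
      simp only [abs_neg, neg_zero] at this
      rw [this, intervalIntegral.integral_symm]
    rwa [h3, abs_neg, abs_neg] at h2

/-- Global existence for a time-dependent vector field that is continuous, uniformly Lipschitz in
the state, and bounded along the zero section. The solution is the fixed point of the Picard
operator on functions of exponential growth: written as `x t = exp (k |t|) u t` with `u` bounded and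
`k` larger than the Lipschitz constant, this operator is a contraction on the whole real line. -/
theorem exists_global_solution [CompleteSpace S] {v : ℝ → S → S} {K : ℝ≥0} {C : ℝ}
    (hv : Continuous (Function.uncurry v)) (hK : ∀ t, LipschitzWith K (v t))
    (hC : ∀ t, ‖v t 0‖ ≤ C) (x₀ : S) :
    ∃ x : ℝ → S, x 0 = x₀ ∧ ∀ t, HasDerivAt x (v t (x t)) t := by
  set k : ℝ := 2 * (K + 1) with hkdef
  have hk : 0 < k := by positivity
  have hC0 : 0 ≤ C := (norm_nonneg _).trans (hC 0)
  set e : ℝ → ℝ := fun t => Real.exp (k * |t|) with he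
  have hec : Continuous e := by fun_prop
  have hepos : ∀ t, 0 < e t := fun t => Real.exp_pos _
  have he1 : ∀ t, 1 ≤ e t := fun t => Real.one_le_exp (by positivity)
  have hvb : ∀ t y, ‖v t y‖ ≤ C + K * ‖y‖ := by
    intro t y
    have h1 := (hK t).dist_le_mul y 0
    rw [dist_eq_norm, dist_zero_right] at h1
    calc ‖v t y‖ = ‖v t 0 + (v t y - v t 0)‖ := by congr 1; abel
      _ ≤ ‖v t 0‖ + ‖v t y - v t 0‖ := norm_add_le _ _
      _ ≤ C + K * ‖y‖ := add_le_add (hC t) h1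
  have hint : ∀ (g : ℝ → S) (M : ℝ), (∀ s, ‖g s‖ ≤ M * e s) → ∀ t,
      ‖∫ s in (0 : ℝ)..t, g s‖ ≤ M * (e t / k) := by
    intro g M hg t
    have h1 : ‖∫ s in (0 : ℝ)..t, g s‖ ≤ |∫ s in (0 : ℝ)..t, M * e s| :=
      intervalIntegral.norm_integral_le_abs_of_norm_le
        (Eventually.of_forall fun s => hg s)
        ((hec.const_mul M).intervalIntegrable _ _)
    have hM : 0 ≤ M := nonneg_of_mul_nonneg_left ((norm_nonneg _).trans (hg 0)) (hepos 0)
    rw [intervalIntegral.integral_const_mul, abs_mul, abs_of_nonneg hM] at h1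
    exact h1.trans (mul_le_mul_of_nonneg_left (abs_integral_exp_mul_abs_le hk t) hM)
  have hcomp : ∀ u : ℝ →ᵇ S, Continuous fun s => v s (e s • u s) := fun u =>
    hv.comp (continuous_id.prodMk (hec.smul u.continuous))
  have hprim : ∀ u : ℝ →ᵇ S, Continuous fun t => ∫ s in (0 : ℝ)..t, v s (e s • u s) := fun u =>
    intervalIntegral.continuous_primitive (fun a b => (hcomp u).intervalIntegrable a b) 0
  have hbd : ∀ (u : ℝ →ᵇ S) t, ‖(e t)⁻¹ • (x₀ + ∫ s in (0 : ℝ)..t, v s (e s • u s))‖ ≤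
      ‖x₀‖ + (C + K * ‖u‖) / k := by
    intro u t
    have h1 : ‖∫ s in (0 : ℝ)..t, v s (e s • u s)‖ ≤ (C + K * ‖u‖) * (e t / k) := by
      refine hint _ _ (fun s => (hvb s _).trans ?_) t
      rw [norm_smul, Real.norm_of_nonneg (hepos s).le]
      have h2 := u.norm_coe_le_norm s
      have h3 : (K : ℝ) * (e s * ‖u s‖) ≤ K * (e s * ‖u‖) := by gcongr
      nlinarith [he1 s]
    rw [norm_smul, norm_inv, Real.norm_of_nonneg (hepos t).le, inv_mul_le_iff₀ (hepos t)]
    calc ‖x₀ + ∫ s in (0 : ℝ)..t, v s (e s • u s)‖ ≤ ‖x₀‖ + (C + K * ‖u‖) * (e t / k) :=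
          (norm_add_le _ _).trans (add_le_add_right h1 _)
      _ ≤ e t * ‖x₀‖ + (C + K * ‖u‖) * (e t / k) := by
          gcongr
          exact le_mul_of_one_le_left (norm_nonneg _) (he1 t)
      _ = e t * (‖x₀‖ + (C + K * ‖u‖) / k) := by ring
  let N : (ℝ →ᵇ S) → (ℝ →ᵇ S) := fun u =>
    BoundedContinuousFunction.ofNormedAddCommGroup
      (fun t => (e t)⁻¹ • (x₀ + ∫ s in (0 : ℝ)..t, v s (e s • u s)))
      ((hec.inv₀ fun t => (hepos t).ne').smul (continuous_const.add (hprim u)))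
      _ (hbd u)
  have hNapp : ∀ u t, N u t = (e t)⁻¹ • (x₀ + ∫ s in (0 : ℝ)..t, v s (e s • u s)) :=
    fun u t => rfl
  have hN : ContractingWith (1 / 2) N := by
    refine ⟨by rw [← NNReal.coe_lt_coe]; norm_num, LipschitzWith.of_dist_le_mul fun u w => ?_⟩
    refine (BoundedContinuousFunction.dist_le (by positivity)).2 fun t => ?_
    rw [hNapp, hNapp, dist_eq_norm, ← smul_sub, add_sub_add_left_eq_sub,
      ← intervalIntegral.integral_sub ((hcomp u).intervalIntegrable _ _)
        ((hcomp w).intervalIntegrable _ _), norm_smul, norm_inv,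
      Real.norm_of_nonneg (hepos t).le, inv_mul_le_iff₀ (hepos t)]
    refine (hint _ (K * dist u w) (fun s => ?_) t).trans ?_
    · have h1 := (hK s).dist_le_mul (e s • u s) (e s • w s)
      rw [dist_eq_norm, dist_eq_norm, ← smul_sub, norm_smul, Real.norm_of_nonneg (hepos s).le,
        ← dist_eq_norm (u s)] at h1
      calc _ ≤ _ := h1
        _ ≤ K * (e s * dist u w) := by
          gcongr
          exact BoundedContinuousFunction.dist_coe_le_dist s
        _ = _ := by ring
    · have h2 : (K : ℝ) / k ≤ 1 / 2 := by
        rw [div_le_iff₀ hk, hkdef]; linarith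
      have h3 : 0 ≤ e t * dist u w := mul_nonneg (hepos t).le dist_nonneg
      calc K * dist u w * (e t / k) = K / k * (e t * dist u w) := by ring
        _ ≤ 1 / 2 * (e t * dist u w) := mul_le_mul_of_nonneg_right h2 h3
        _ = _ := by push_cast; ring
  obtain ⟨u, hu⟩ : ∃ u, N u = u := ⟨_, hN.fixedPoint_isFixedPt⟩
  have hx : ∀ t, e t • u t = x₀ + ∫ s in (0 : ℝ)..t, v s (e s • u s) := by
    intro t
    conv_lhs => rw [← hu, hNapp, smul_inv_smul₀ (hepos t).ne']
  refine ⟨fun t => e t • u t, by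
    simpa only [intervalIntegral.integral_same, add_zero] using hx 0, fun t => ?_⟩
  have h1 : HasDerivAt (fun t => x₀ + ∫ s in (0 : ℝ)..t, v s (e s • u s)) (v t (e t • u t)) t :=
    (intervalIntegral.integral_hasDerivAt_right ((hcomp u).intervalIntegrable _ _)
      ((hcomp u).stronglyMeasurableAtFilter _ _) (hcomp u).continuousAt).const_add _
  exact h1.congr_of_eventuallyEq (Eventually.of_forall hx)

/-- Grönwall's inequality on both sides of the initial time. -/
theorem norm_le_gronwallBound_abs {u u' : ℝ → S} {K ε δ N : ℝ}
    (hu : ∀ t, HasDerivAt u (u' t) t) (h0 : ‖u 0‖ ≤ δ)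
    (hb : ∀ t, |t| ≤ N → ‖u' t‖ ≤ K * ‖u t‖ + ε) :
    ∀ t, |t| ≤ N → ‖u t‖ ≤ gronwallBound δ K ε |t| := by
  intro t ht
  rcases le_total 0 t with h | h
  · have := norm_le_gronwallBound_of_norm_deriv_right_le (f := u) (f' := u') (a := 0) (b := N)
      (K := K) (ε := ε) (δ := δ)
      (fun s _ => (hu s).continuousAt.continuousWithinAt) (fun s _ => (hu s).hasDerivWithinAt) h0
      (fun s hs => hb s (by rw [abs_of_nonneg hs.1]; exact hs.2.le)) t
      ⟨h, by rwa [abs_of_nonneg h] at ht⟩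
    rw [abs_of_nonneg h]
    rwa [sub_zero] at this
  · have hd : ∀ s, HasDerivAt (fun s => u (-s)) (-u' (-s)) s := fun s => by
      simpa using! (hu (-s)).scomp s (hasDerivAt_neg s)
    have := norm_le_gronwallBound_of_norm_deriv_right_le (f := fun s => u (-s))
      (f' := fun s => -u' (-s)) (a := 0) (b := N)
      (K := K) (ε := ε) (δ := δ)
      (fun s _ => (hd s).continuousAt.continuousWithinAt) (fun s _ => (hd s).hasDerivWithinAt)
      (by simpa using h0)
      (fun s hs => by
        rw [norm_neg]
        exact hb _ (by rw [abs_neg, abs_of_nonneg hs.1]; exact hs.2.le)) (-t)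
      ⟨by linarith, by rwa [abs_of_nonpos h] at ht⟩
    simpa [abs_of_nonpos h] using this

/-- Continuous dependence on parameters: solutions of `x' = v λ t x`, with `v` jointly continuous
and uniformly Lipschitz in `x`, depend jointly continuously on `(λ, t)` as soon as their initial
values depend continuously on `λ`. -/
theorem continuous_solution {Λ : Type*} [TopologicalSpace Λ] {v : Λ → ℝ → S → S} {K : ℝ≥0}
    (hv : Continuous fun p : Λ × ℝ × S => v p.1 p.2.1 p.2.2)
    (hK : ∀ l t, LipschitzWith K (v l t)) {x : Λ → ℝ → S}
    (hx : ∀ l t, HasDerivAt (x l) (v l t (x l t)) t) (h0 : Continuous fun l => x l 0) :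
    Continuous fun p : Λ × ℝ => x p.1 p.2 := by
  rw [continuous_iff_continuousAt]
  rintro ⟨l₀, t₀⟩
  have hxc : ∀ l, Continuous (x l) := fun l =>
    continuous_iff_continuousAt.2 fun t => (hx l t).continuousAt
  set N : ℝ := |t₀| + 1
  -- the bound given by Grönwall's inequality tends to `0` with the initial error and the defect
  have hG : Tendsto (fun η : ℝ => gronwallBound η K η N) (𝓝 0) (𝓝 0) := by
    have h1 : ∀ η : ℝ, gronwallBound η K η N = η * gronwallBound 1 K 1 N := by
      intro η
      by_cases hK0 : (K : ℝ) = 0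
      · simp only [hK0, gronwallBound_K0]; ring
      · simp only [gronwallBound_of_K_ne_0 hK0]; ring
    have : Tendsto (fun η : ℝ => η * gronwallBound 1 K 1 N) (𝓝 0) (𝓝 (0 * gronwallBound 1 K 1 N)) :=
      tendsto_id.mul_const _
    rw [zero_mul] at this
    exact this.congr fun η => (h1 η).symm
  rw [Metric.continuousAt_iff']
  intro r hr
  obtain ⟨η, hη, hη0⟩ : ∃ η : ℝ, gronwallBound η K η N < r / 2 ∧ 0 < η := by
    have h1 := (hG.eventually (gt_mem_nhds (half_pos hr))).filter_mono
      (nhdsWithin_le_nhds (s := Ioi 0))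
    obtain ⟨η, h2, h3⟩ := (h1.and self_mem_nhdsWithin).exists
    exact ⟨η, h2, h3⟩
  have hdef : ∀ᶠ l in 𝓝 l₀, ∀ t ∈ Icc (-N) N, dist (v l t (x l₀ t)) (v l₀ t (x l₀ t)) < η := by
    refine isCompact_Icc.eventually_forall_of_forall_eventually fun t _ => ?_
    have hc : Continuous fun q : Λ × ℝ => dist (v q.1 q.2 (x l₀ q.2)) (v l₀ q.2 (x l₀ q.2)) := by
      refine Continuous.dist ?_ ?_
      · exact hv.comp (continuous_fst.prodMk (continuous_snd.prodMk ((hxc l₀).comp continuous_snd)))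
      · exact hv.comp (continuous_const.prodMk
          (continuous_snd.prodMk ((hxc l₀).comp continuous_snd)))
    exact hc.continuousAt.eventually (gt_mem_nhds (by simpa using hη0))
  have hini : ∀ᶠ l in 𝓝 l₀, dist (x l 0) (x l₀ 0) < η :=
    h0.continuousAt.eventually (Metric.ball_mem_nhds _ hη0)
  have ht : ∀ᶠ t in 𝓝 t₀, |t| < N ∧ dist (x l₀ t) (x l₀ t₀) < r / 2 := by
    refine (continuous_abs.continuousAt.eventually (gt_mem_nhds (by simp [N]))).and ?_
    exact (hxc l₀).continuousAt.eventually (Metric.ball_mem_nhds _ (half_pos hr))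
  rw [nhds_prod_eq]
  filter_upwards [(hdef.and hini).prod_mk ht] with ⟨l, t⟩ ⟨⟨h1, h2⟩, h3, h4⟩
  have key := norm_le_gronwallBound_abs (u := fun t => x l t - x l₀ t) (K := K) (ε := η) (δ := η)
    (N := N) (fun t => (hx l t).sub (hx l₀ t)) (by rw [← dist_eq_norm]; exact h2.le)
    (fun t ht => by
      rw [← dist_eq_norm, ← dist_eq_norm]
      calc dist (v l t (x l t)) (v l₀ t (x l₀ t)) ≤
          dist (v l t (x l t)) (v l t (x l₀ t)) + dist (v l t (x l₀ t)) (v l₀ t (x l₀ t)) :=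
            dist_triangle _ _ _
        _ ≤ _ := add_le_add ((hK l t).dist_le_mul _ _) (h1 t (abs_le.1 ht)).le) t h3.le
  have hmono : gronwallBound η K η |t| ≤ gronwallBound η K η N :=
    gronwallBound_mono hη0.le hη0.le K.2 h3.le
  rw [← dist_eq_norm] at key
  calc dist (x l t) (x l₀ t₀) ≤ dist (x l t) (x l₀ t) + dist (x l₀ t) (x l₀ t₀) :=
        dist_triangle _ _ _
    _ < r := by linarith

/-- The flow of a family of `C¹` vector fields with bounded derivative. It is defined for all
times, and its derivative `Φ'` with respect to the initial value is jointly continuous and solves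
the variational equation. -/
theorem exists_flow {Λ : Type*} [TopologicalSpace Λ] [CompleteSpace S] {Y : Λ → S → S}
    {Y' : Λ → S → S →L[ℝ] S} {K : ℝ≥0} (hY : ∀ l y, HasFDerivAt (Y l) (Y' l y) y)
    (hYc : Continuous fun p : Λ × S => Y p.1 p.2)
    (hY'c : Continuous fun p : Λ × S => Y' p.1 p.2)
    (hK : ∀ l y, ‖Y' l y‖ ≤ K) :
    ∃ (Φ : Λ → ℝ → S → S) (Φ' : Λ → ℝ → S → S →L[ℝ] S),
      (∀ l y, Φ l 0 y = y) ∧ (∀ l y t, HasDerivAt (fun t => Φ l t y) (Y l (Φ l t y)) t) ∧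
      (∀ l y, Φ' l 0 y = ContinuousLinearMap.id ℝ S) ∧
      (∀ l y t, HasDerivAt (fun t => Φ' l t y) ((Y' l (Φ l t y)).comp (Φ' l t y)) t) ∧
      (∀ l t y, HasFDerivAt (Φ l t) (Φ' l t y) y) ∧
      (Continuous fun p : Λ × ℝ × S => Φ p.1 p.2.1 p.2.2) ∧
      (Continuous fun p : Λ × ℝ × S => Φ' p.1 p.2.1 p.2.2) := by
  have hLip : ∀ l, LipschitzWith K (Y l) := fun l =>
    lipschitzWith_of_nnnorm_fderiv_le (fun y => (hY l y).differentiableAt) fun y => by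
      rw [(hY l y).fderiv]; exact hK l y
  have hYl : ∀ l, Continuous (Y l) := fun l => hYc.comp (Continuous.prodMk_right l)
  choose Φ hΦ0 hΦ using fun (l : Λ) (y : S) =>
    exists_global_solution (v := fun _ => Y l) ((hYl l).comp continuous_snd) (fun _ => hLip l)
      (fun _ => le_rfl) y
  have hΦc : Continuous fun p : (Λ × S) × ℝ => Φ p.1.1 p.1.2 p.2 :=
    continuous_solution (v := fun (q : Λ × S) _ y => Y q.1 y) (x := fun q => Φ q.1 q.2)
      (hYc.comp ((continuous_fst.comp continuous_fst).prodMk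
        (continuous_snd.comp continuous_snd))) (fun q _ => hLip q.1)
      (fun q t => hΦ q.1 q.2 t) (by simpa only [hΦ0] using continuous_snd)
  have hac : Continuous fun p : (Λ × S) × ℝ => Y' p.1.1 (Φ p.1.1 p.1.2 p.2) :=
    hY'c.comp ((continuous_fst.comp continuous_fst).prodMk hΦc)
  have hcompLip : ∀ (q : Λ × S) (t : ℝ), LipschitzWith K
      fun W : S →L[ℝ] S => (Y' q.1 (Φ q.1 q.2 t)).comp W := fun q t =>
    LipschitzWith.of_dist_le_mul fun W₁ W₂ => by
      rw [dist_eq_norm, dist_eq_norm, ← ContinuousLinearMap.comp_sub]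
      exact (ContinuousLinearMap.opNorm_comp_le _ _).trans (by gcongr; exact hK _ _)
  choose W hW0 hW using fun (q : Λ × S) =>
    exists_global_solution (v := fun t (W : S →L[ℝ] S) => (Y' q.1 (Φ q.1 q.2 t)).comp W)
      (K := K) (C := 0)
      ((hac.comp (continuous_const.prodMk continuous_fst)).clm_comp continuous_snd)
      (hcompLip q) (fun _ => by simp) (ContinuousLinearMap.id ℝ S)
  have hWc : Continuous fun p : (Λ × S) × ℝ => W p.1 p.2 :=
    continuous_solution
      (v := fun (q : Λ × S) t (W : S →L[ℝ] S) => (Y' q.1 (Φ q.1 q.2 t)).comp W)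
      ((hac.comp (continuous_fst.prodMk (continuous_fst.comp continuous_snd))).clm_comp
        (continuous_snd.comp continuous_snd)) hcompLip (fun q t => hW q t)
      (by simpa only [hW0] using continuous_const)
  refine ⟨fun l t y => Φ l y t, fun l t y => W (l, y) t, hΦ0, hΦ, fun l y => hW0 _,
    fun l y t => hW _ t, fun l t y => ?_, ?_, ?_⟩
  · -- Grönwall for the remainder `Φ (y + h) - Φ y - W h`
    rw [hasFDerivAt_iff_isLittleO_nhds_zero]
    set N : ℝ := |t|
    have hΦdist : ∀ (h : S) (s : ℝ), |s| ≤ N →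
        ‖Φ l (y + h) s - Φ l y s‖ ≤ ‖h‖ * Real.exp (K * N) := by
      intro h s hs
      have := norm_le_gronwallBound_abs (u := fun s => Φ l (y + h) s - Φ l y s) (K := K) (ε := 0)
        (δ := ‖h‖) (N := N) (fun s => (hΦ l (y + h) s).sub (hΦ l y s))
        (by simp [hΦ0]) (fun s _ => by
          rw [add_zero, ← dist_eq_norm, ← dist_eq_norm]
          exact (hLip l).dist_le_mul _ _) s hs
      rw [gronwallBound_ε0] at this
      exact this.trans (by gcongr)
    set M : ℝ := Real.exp (K * N) with hM
    set B : ℝ := gronwallBound 0 K 1 N with hB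
    have hBη : ∀ η : ℝ, gronwallBound 0 K η N = η * B := by
      intro η
      by_cases hK0 : (K : ℝ) = 0
      · simp only [hB, hK0, gronwallBound_K0]; ring
      · simp only [hB, gronwallBound_of_K_ne_0 hK0]; ring
    have hB0 : 0 ≤ B := by
      have := gronwallBound_mono (δ := 0) (K := (K : ℝ)) (ε := 1) le_rfl zero_le_one K.2
        (abs_nonneg t)
      rwa [gronwallBound_x0] at this
    rw [Asymptotics.isLittleO_iff]
    intro c hc
    obtain ⟨η, hη, hηc⟩ : ∃ η : ℝ, 0 < η ∧ η * M * B ≤ c := by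
      refine ⟨c / (M * B + 1), by positivity, ?_⟩
      rw [mul_assoc, div_mul_eq_mul_div, div_le_iff₀ (by positivity)]
      nlinarith
    have hcpt : IsCompact ((fun s => Φ l y s) '' Icc (-N) N) :=
      isCompact_Icc.image (continuous_iff_continuousAt.2 fun s => (hΦ l y s).continuousAt)
    have hY'l : Continuous (Y' l) := hY'c.comp (Continuous.prodMk_right l)
    obtain ⟨ρ, hρ, hρY⟩ : ∃ ρ > 0, ∀ z ∈ (fun s => Φ l y s) '' Icc (-N) N, ∀ z', ‖z' - z‖ < ρ →
        ‖Y' l z' - Y' l z‖ ≤ η := by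
      have h1 := hcpt.uniformContinuousAt_of_continuousAt (Y' l)
        (fun z _ => hY'l.continuousAt) (Metric.dist_mem_uniformity hη)
      obtain ⟨ρ, hρ, h2⟩ := Metric.mem_uniformity_dist.1 h1
      refine ⟨ρ, hρ, fun z hz z' hz' => ?_⟩
      have := @h2 z z' (by rwa [dist_comm, dist_eq_norm]) hz
      rw [← dist_eq_norm, dist_comm]
      exact le_of_lt this
    have hsmall : ∀ᶠ h : S in 𝓝 0, ‖h‖ * M < ρ := by
      have : Tendsto (fun h : S => ‖h‖ * M) (𝓝 0) (𝓝 (‖(0 : S)‖ * M)) :=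
        (continuous_norm.mul continuous_const).tendsto 0
      rw [norm_zero, zero_mul] at this
      exact this.eventually (gt_mem_nhds hρ)
    filter_upwards [hsmall] with h hh
    have hd : ∀ s, HasDerivAt (fun s => Φ l (y + h) s - Φ l y s - W (l, y) s h)
        (Y l (Φ l (y + h) s) - Y l (Φ l y s) - Y' l (Φ l y s) (W (l, y) s h)) s := fun s =>
      ((hΦ l (y + h) s).sub (hΦ l y s)).sub
        ((hW (l, y) s).clm_apply (hasDerivAt_const s h) |>.congr_deriv (by simp))
    have key := norm_le_gronwallBound_abs (K := K) (ε := η * (‖h‖ * M)) (δ := 0) (N := N) hd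
      (by simp [hΦ0, hW0]) (fun s hs => ?_) t le_rfl
    · rw [hBη] at key
      calc _ ≤ _ := key
        _ = η * M * B * ‖h‖ := by ring
        _ ≤ c * ‖h‖ := by gcongr
    · have h1 : ‖Φ l (y + h) s - Φ l y s‖ ≤ ‖h‖ * M := hΦdist h s hs
      have h2 : ‖Y l (Φ l (y + h) s) - Y l (Φ l y s) -
          Y' l (Φ l y s) (Φ l (y + h) s - Φ l y s)‖ ≤ η * ‖Φ l (y + h) s - Φ l y s‖ := by
        refine (convex_ball (Φ l y s) ρ).norm_image_sub_le_of_norm_hasFDerivWithin_le'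
          (fun z _ => (hY l z).hasFDerivWithinAt) (fun z hz => ?_) (Metric.mem_ball_self hρ) ?_
        · refine hρY _ ⟨s, abs_le.1 hs, rfl⟩ _ ?_
          rwa [← dist_eq_norm]
        · rw [Metric.mem_ball, dist_eq_norm]
          exact h1.trans_lt hh
      have h3 : Y l (Φ l (y + h) s) - Y l (Φ l y s) - Y' l (Φ l y s) (W (l, y) s h) =
          Y' l (Φ l y s) (Φ l (y + h) s - Φ l y s - W (l, y) s h) +
          (Y l (Φ l (y + h) s) - Y l (Φ l y s) - Y' l (Φ l y s) (Φ l (y + h) s - Φ l y s)) := by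
        simp only [map_sub]; abel
      rw [h3]
      refine (norm_add_le _ _).trans (add_le_add ?_ (h2.trans (by gcongr)))
      exact (ContinuousLinearMap.le_opNorm _ _).trans (by gcongr; exact hK _ _)
  · exact hΦc.comp ((continuous_fst.prodMk (continuous_snd.comp continuous_snd)).prodMk
      (continuous_fst.comp continuous_snd))
  · exact hWc.comp ((continuous_fst.prodMk (continuous_snd.comp continuous_snd)).prodMk
      (continuous_fst.comp continuous_snd))

end ODE

/-! ### Families of idempotents and projections onto kernels -/

section Projections

open Set Filter

/-- There is a `C¹` retraction of a neighbourhood of the set of idempotents of a Banach algebra onto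
that set: `R ↦ (1 + sign (2 R - 1)) / 2`, where `sign X = X (X²)^(-1/2)` and the square root
near `1` is given by the inverse function theorem. -/
theorem exists_idempotent_retraction (𝔸 : Type*) [NormedRing 𝔸] [NormedAlgebra ℝ 𝔸]
    [CompleteSpace 𝔸] :
    ∃ ρ : 𝔸 → 𝔸, ∀ P : 𝔸, P * P = P →
      ρ P = P ∧ ContDiffAt ℝ 1 ρ P ∧ ∀ᶠ R in 𝓝 P, ρ R * ρ R = ρ R := by
  let sq : 𝔸 → 𝔸 := fun x => x * x
  let two : 𝔸 ≃L[ℝ] 𝔸 := ContinuousLinearEquiv.smulLeft (Units.mk0 (2 : ℝ) two_ne_zero)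
  have hsqC : ContDiffAt ℝ 1 sq 1 := contDiffAt_id.mul contDiffAt_id
  have hsq : HasFDerivAt sq (two : 𝔸 →L[ℝ] 𝔸) 1 := by
    have h := (hasFDerivAt_id (𝕜 := ℝ) (1 : 𝔸)).mul' (hasFDerivAt_id (𝕜 := ℝ) (1 : 𝔸))
    refine h.congr_fderiv ?_
    ext x
    simp [two, two_smul]
  have hsqs : HasStrictFDerivAt sq (two : 𝔸 →L[ℝ] 𝔸) 1 := hsqC.hasStrictFDerivAt' hsq one_ne_zero
  let r : 𝔸 → 𝔸 := hsqs.localInverse sq two 1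
  have hsq1 : sq 1 = 1 := one_mul 1
  have hr1 : r 1 = 1 := by
    have := hsqs.localInverse_apply_image
    rwa [hsq1] at this
  have hrC : ContDiffAt ℝ 1 r 1 := by
    have := hsqC.to_localInverse hsq one_ne_zero
    rwa [hsq1] at this
  have hrsq : ∀ᶠ Z in 𝓝 (1 : 𝔸), r Z * r Z = Z := by
    have := hsqs.eventually_right_inverse
    rwa [hsq1] at this
  have hinj : ∀ᶠ x in 𝓝 (1 : 𝔸), r (x * x) = x := hsqs.eventually_left_inverse
  let X : 𝔸 → 𝔸 := fun R => (2 : ℝ) • R - 1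
  have hXC : ∀ R, ContDiffAt ℝ 1 X R := fun R => (contDiffAt_id.const_smul 2).sub contDiffAt_const
  refine ⟨fun R => (2 : ℝ)⁻¹ • (1 + X R * Ring.inverse (r (X R * X R))), fun P hP => ?_⟩
  have hXP : X P * X P = 1 := by
    simp only [X, sub_mul, mul_sub, smul_mul_assoc, mul_smul_comm, hP, mul_one, one_mul]
    simp only [two_smul]
    abel
  have hXPu : IsUnit (X P) := ⟨⟨X P, X P, hXP, hXP⟩, rfl⟩
  have hXPinv : Ring.inverse (X P) = X P :=
    Ring.inverse_unit (⟨X P, X P, hXP, hXP⟩ : 𝔸ˣ)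
  have hZC : ContDiffAt ℝ 1 (fun R => X R * X R) P := (hXC P).mul (hXC P)
  have hrZC : ContDiffAt ℝ 1 (fun R => r (X R * X R)) P :=
    ContDiffAt.comp P (g := r) (by rwa [hXP]) hZC
  have hrP : r (X P * X P) = 1 := by rw [hXP, hr1]
  have hinvC : ContDiffAt ℝ 1 (fun R => Ring.inverse (r (X R * X R))) P :=
    ContDiffAt.comp P (g := Ring.inverse)
      (by simpa only [hrP] using! contDiffAt_ringInverse ℝ (1 : 𝔸ˣ)) hrZC
  refine ⟨?_, ?_, ?_⟩
  · simp only [hrP, Ring.inverse_one, mul_one, X]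
    rw [add_sub_cancel, smul_smul]; norm_num
  · exact ((contDiffAt_const.add ((hXC P).mul hinvC)).const_smul _)
  · have hZt : Tendsto (fun R => X R * X R) (𝓝 P) (𝓝 1) := by
      simpa only [hXP] using hZC.continuousAt.tendsto
    have hrt : Tendsto (fun R => r (X R * X R)) (𝓝 P) (𝓝 1) := by
      simpa only [hrP] using hrZC.continuousAt.tendsto
    have hXinv : ContinuousAt (fun R => Ring.inverse (X R)) P :=
      ContinuousAt.comp (g := Ring.inverse) (f := X) (NormedRing.inverse_continuousAt hXPu.unit)
        (hXC P).continuousAt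
    have hconj : Tendsto (fun R => X R * r (X R * X R) * Ring.inverse (X R)) (𝓝 P) (𝓝 1) := by
      have h2 : Tendsto (fun R => X R * r (X R * X R) * Ring.inverse (X R)) (𝓝 P)
          (𝓝 (X P * r (X P * X P) * Ring.inverse (X P))) :=
        (((hXC P).continuousAt.mul hrZC.continuousAt).mul hXinv).tendsto
      rwa [hrP, mul_one, hXPinv, hXP] at h2
    have hunit : ∀ᶠ R in 𝓝 P, IsUnit (X R) :=
      (hXC P).continuousAt.eventually (Units.isOpen.mem_nhds hXPu)
    have hrunit : ∀ᶠ R in 𝓝 P, IsUnit (r (X R * X R)) :=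
      hrt.eventually (Units.isOpen.mem_nhds isUnit_one)
    filter_upwards [hZt.eventually hrsq, hrt.eventually hinj, hconj.eventually hinj, hunit,
      hrunit] with R h1 h2 h3 h4 h5
    -- `X` commutes with the square root of `X²`: conjugation by `X` gives another square root
    set x := X R
    set s := r (x * x)
    have hx1 : Ring.inverse x * x = 1 := Ring.inverse_mul_cancel x h4
    have hx2 : x * Ring.inverse x = 1 := Ring.mul_inverse_cancel x h4
    have hs1 : Ring.inverse s * s = 1 := Ring.inverse_mul_cancel s h5
    have hs2 : s * Ring.inverse s = 1 := Ring.mul_inverse_cancel s h5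
    have hcs : x * s * Ring.inverse x = s := by
      have h6 : x * s * Ring.inverse x * (x * s * Ring.inverse x) = x * x := by
        calc _ = x * s * (Ring.inverse x * x) * s * Ring.inverse x := by noncomm_ring
          _ = x * (s * s) * Ring.inverse x := by rw [hx1]; noncomm_ring
          _ = x * x * (x * Ring.inverse x) := by rw [h1]; noncomm_ring
          _ = x * x := by rw [hx2, mul_one]
      rw [h6] at h3
      exact h3.symm
    have hcomm : x * s = s * x := by
      calc x * s = x * s * (Ring.inverse x * x) := by rw [hx1, mul_one]
        _ = (x * s * Ring.inverse x) * x := by noncomm_ring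
        _ = s * x := by rw [hcs]
    have hcomm' : Ring.inverse s * x = x * Ring.inverse s := by
      calc Ring.inverse s * x = Ring.inverse s * (x * s) * Ring.inverse s := by
            rw [mul_assoc, mul_assoc, hs2, mul_one]
        _ = (Ring.inverse s * s) * x * Ring.inverse s := by rw [hcomm]; noncomm_ring
        _ = _ := by rw [hs1, one_mul]
    have hsign : x * Ring.inverse s * (x * Ring.inverse s) = 1 := by
      calc _ = x * (Ring.inverse s * x) * Ring.inverse s := by noncomm_ring
        _ = (s * s) * Ring.inverse s * Ring.inverse s := by rw [hcomm', h1]; noncomm_ring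
        _ = s * (s * Ring.inverse s) * Ring.inverse s := by noncomm_ring
        _ = 1 := by rw [hs2, mul_one, hs2]
    change (2 : ℝ)⁻¹ • (1 + x * Ring.inverse s) * (2 : ℝ)⁻¹ • (1 + x * Ring.inverse s) =
      (2 : ℝ)⁻¹ • (1 + x * Ring.inverse s)
    generalize x * Ring.inverse s = y at hsign
    rw [smul_mul_smul_comm, add_mul, mul_add, mul_add, hsign, one_mul, mul_one, one_mul]
    rw [show 1 + y + (y + 1) = (2 : ℝ) • (1 + y) by rw [two_smul]; abel, smul_smul]
    norm_num

variable {Y : Type*} [NormedAddCommGroup Y] [InnerProductSpace ℝ Y] [FiniteDimensional ℝ Y]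

/-- The orthogonal projection onto the kernel of a continuous family of linear maps is continuous
where the dimension of the kernel is constant. -/
theorem continuousOn_starProjection_ker {X Z : Type*} [TopologicalSpace X]
    [NormedAddCommGroup Z] [NormedSpace ℝ Z] {A : X → Y →L[ℝ] Z} {K : Set X} {m : ℕ}
    (hA : ContinuousOn A K)
    (hm : ∀ q ∈ K, Module.finrank ℝ (LinearMap.ker (A q).toLinearMap) = m) :
    ContinuousOn (fun q => (LinearMap.ker (A q).toLinearMap).starProjection) K := by
  intro q₀ hq₀
  set T₀ := LinearMap.ker (A q₀).toLinearMap with hT₀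
  obtain ⟨c, hc, hcA⟩ : ∃ c : ℝ, 0 < c ∧ ∀ v ∈ T₀ᗮ, ‖v‖ ≤ c * ‖A q₀ v‖ := by
    have hker : LinearMap.ker ((A q₀).toLinearMap.comp T₀ᗮ.subtype) = ⊥ := by
      rw [LinearMap.ker_eq_bot']
      intro v hv
      have h1 : (v : Y) ∈ T₀ := hv
      have h2 := T₀.inner_right_of_mem_orthogonal h1 v.2
      exact Subtype.ext (inner_self_eq_zero.1 h2)
    obtain ⟨C, hC, hCA⟩ := LinearMap.exists_antilipschitzWith _ hker
    refine ⟨C, hC, fun v hv => ?_⟩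
    have := hCA.le_mul_dist ⟨v, hv⟩ 0
    simpa using this
  have hAt : Tendsto (fun q => c * ‖A q - A q₀‖) (𝓝[K] q₀) (𝓝 0) := by
    have h1 : Tendsto (fun q => A q - A q₀) (𝓝[K] q₀) (𝓝 0) := by
      simpa using (hA q₀ hq₀).tendsto.sub_const (A q₀)
    simpa using (h1.norm.const_mul c)
  have hmain : ∀ᶠ q in 𝓝[K] q₀,
      ‖(LinearMap.ker (A q).toLinearMap).starProjection - T₀.starProjection‖ ≤
        3 * (c * ‖A q - A q₀‖) := by
    filter_upwards [hAt.eventually (gt_mem_nhds (show (0 : ℝ) < 1 / 2 by norm_num)),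
      self_mem_nhdsWithin] with q hθ hqK
    set θ := c * ‖A q - A q₀‖
    have hθ0 : 0 ≤ θ := by positivity
    set T := LinearMap.ker (A q).toLinearMap
    have h1 : ∀ k ∈ T, ‖k - T₀.starProjection k‖ ≤ θ * ‖k‖ := by
      intro k hk
      have h2 : A q₀ (k - T₀.starProjection k) = (A q₀ - A q) k := by
        have h3 : A q₀ (T₀.starProjection k) = 0 := T₀.starProjection_apply_mem k
        have h4 : A q k = 0 := hk
        rw [map_sub, h3, sub_apply, h4]
      calc _ ≤ c * ‖A q₀ (k - T₀.starProjection k)‖ :=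
            hcA _ (T₀.sub_starProjection_mem_orthogonal k)
        _ ≤ c * (‖A q - A q₀‖ * ‖k‖) := by
            rw [h2, norm_sub_rev (A q)]
            gcongr
            exact ContinuousLinearMap.le_opNorm _ _
        _ = θ * ‖k‖ := by ring
    -- by equality of dimensions, `T` projects onto `T₀`
    have h2 : ∀ k₀ ∈ T₀, ∃ k ∈ T, T₀.starProjection k = k₀ := by
      let π : T →ₗ[ℝ] T₀ := T₀.orthogonalProjectionOnto.toLinearMap.comp T.subtype
      have hπ : Function.Injective π := by
        rw [injective_iff_map_eq_zero]
        intro k hk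
        have h3 : T₀.starProjection (k : Y) = 0 := by
          have := congrArg (Subtype.val) hk
          exact this
        have h4 := h1 k k.2
        rw [h3, sub_zero] at h4
        have h5 : ‖(k : Y)‖ = 0 := by nlinarith [norm_nonneg (k : Y)]
        exact Subtype.ext (norm_eq_zero.1 h5)
      have hsurj : Function.Surjective π :=
        (LinearMap.injective_iff_surjective_of_finrank_eq_finrank
          ((hm q hqK).trans (hm q₀ hq₀).symm)).1 hπ
      intro k₀ hk₀
      obtain ⟨k, hk⟩ := hsurj ⟨k₀, hk₀⟩
      exact ⟨k, k.2, congrArg Subtype.val hk⟩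
    have h3 : ∀ k₀ ∈ T₀, ‖k₀ - T.starProjection k₀‖ ≤ 2 * θ * ‖k₀‖ := by
      intro k₀ hk₀
      obtain ⟨k, hk, rfl⟩ := h2 k₀ hk₀
      set k₀ := T₀.starProjection k
      have h4 := h1 k hk
      have h5 : ‖k‖ ≤ 2 * ‖k₀‖ := by
        have := norm_sub_norm_le k k₀
        nlinarith [norm_nonneg k]
      have h6 : ‖k₀ - T.starProjection k₀‖ ≤ ‖k₀ - k‖ := by
        rw [T.starProjection_minimal]
        exact ciInf_le ⟨0, by rintro _ ⟨w, rfl⟩; positivity⟩ (⟨k, hk⟩ : T)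
      rw [norm_sub_rev] at h4
      calc _ ≤ _ := h6
        _ ≤ θ * ‖k‖ := h4
        _ ≤ θ * (2 * ‖k₀‖) := by gcongr
        _ = _ := by ring
    refine ContinuousLinearMap.opNorm_le_bound _ (by positivity) fun x => ?_
    set y := x - T.starProjection x
    set k₀ := T₀.starProjection y
    have h4 : ‖k₀‖ ≤ 2 * θ * ‖x‖ := by
      have e1 : inner ℝ k₀ k₀ = inner ℝ (k₀ - T.starProjection k₀) x := by
        have a1 : inner ℝ k₀ k₀ = inner ℝ k₀ y := by
          have := T₀.inner_right_of_mem_orthogonal (T₀.starProjection_apply_mem y)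
            (T₀.sub_starProjection_mem_orthogonal y)
          rw [inner_sub_right] at this
          linarith
        rw [a1, inner_sub_right, inner_sub_left, T.inner_starProjection_left_eq_right k₀ x]
      have e2 := real_inner_le_norm (k₀ - T.starProjection k₀) x
      rw [← e1, real_inner_self_eq_norm_sq] at e2
      have e3 := h3 k₀ (T₀.starProjection_apply_mem y)
      by_contra hcon
      push Not at hcon
      have : 0 < ‖k₀‖ := lt_of_le_of_lt (by positivity) hcon
      nlinarith [norm_nonneg x, mul_le_mul_of_nonneg_right e3 (norm_nonneg x)]
    have h5 := h1 (T.starProjection x) (T.starProjection_apply_mem x)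
    have h6 : ‖T.starProjection x‖ ≤ ‖x‖ := T.norm_starProjection_apply_le x
    have h7 : (T.starProjection - T₀.starProjection) x =
        (T.starProjection x - T₀.starProjection (T.starProjection x)) - k₀ := by
      simp only [k₀, y, map_sub, sub_apply]
      abel
    rw [h7]
    refine (norm_sub_le _ _).trans ?_
    nlinarith [mul_le_mul_of_nonneg_left h6 hθ0]
  rw [ContinuousWithinAt, tendsto_iff_norm_sub_tendsto_zero]
  refine squeeze_zero' (Eventually.of_forall fun _ => norm_nonneg _) hmain ?_
  simpa using hAt.const_mul 3

/-- A continuous family of idempotents on a compact set `K` is uniformly close to the restriction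
of a `C¹` family of idempotents defined on a neighbourhood of `K`. -/
theorem exists_contDiff_idempotent_approx {𝔸 : Type*} [NormedRing 𝔸] [NormedAlgebra ℝ 𝔸]
    [CompleteSpace 𝔸] {K : Set Y} (hK : IsCompact K) {P : Y → 𝔸} (hP : ContinuousOn P K)
    (hPP : ∀ q ∈ K, P q * P q = P q) {δ : ℝ} (hδ : 0 < δ) :
    ∃ Q : Y → 𝔸, (∀ q ∈ K, ‖Q q - P q‖ < δ ∧ ContDiffAt ℝ 1 Q q ∧
      ∀ᶠ y in 𝓝 q, Q y * Q y = Q y) := by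
  obtain ⟨ρ, hρ⟩ := exists_idempotent_retraction 𝔸
  have hcpt : IsCompact (P '' K) := hK.image_of_continuousOn hP
  obtain ⟨η, hη, hηρ⟩ : ∃ η > 0, ∀ p ∈ P '' K, ∀ R, dist R p < η →
      ContDiffAt ℝ 1 ρ R ∧ ρ R * ρ R = ρ R ∧ dist (ρ R) p < δ := by
    have h1 : ∀ p ∈ P '' K, ∀ᶠ R in 𝓝 p,
        ContDiffAt ℝ 1 ρ R ∧ (∀ᶠ R' in 𝓝 R, ρ R' * ρ R' = ρ R') ∧ dist (ρ R) R < δ / 2 := by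
      rintro p ⟨q, hq, rfl⟩
      obtain ⟨e1, e2, e3⟩ := hρ (P q) (hPP q hq)
      refine (e2.eventually (by simp)).and (e3.eventually_nhds.and ?_)
      have : ContinuousAt (fun R => dist (ρ R) R) (P q) := e2.continuousAt.dist continuousAt_id
      exact this.eventually (gt_mem_nhds (by simpa [e1] using half_pos hδ))
    have h2 : ∀ᶠ R in 𝓝ˢ (P '' K), ContDiffAt ℝ 1 ρ R ∧ (∀ᶠ R' in 𝓝 R, ρ R' * ρ R' = ρ R') ∧
        dist (ρ R) R < δ / 2 := eventually_nhdsSet_iff_forall.2 h1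
    obtain ⟨η, hη, hsub⟩ := hcpt.exists_thickening_subset_open isOpen_interior
      (subset_interior_iff_mem_nhdsSet.2 h2)
    refine ⟨min η (δ / 2), by positivity, fun p hp R hR => ?_⟩
    have h3 := interior_subset (hsub (Metric.mem_thickening_iff.2 ⟨p, hp,
      hR.trans_le (min_le_left _ _)⟩))
    refine ⟨h3.1, h3.2.1.self_of_nhds, ?_⟩
    have := dist_triangle (ρ R) R p
    have h5 := hR.trans_le (min_le_right _ _)
    have h6 : dist (ρ R) R < δ / 2 := h3.2.2
    linarith
  obtain ⟨R, hR⟩ : ∃ R : C^(1 : ℕ∞)⟮𝓘(ℝ, Y), Y; 𝓘(ℝ, 𝔸), 𝔸⟯,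
      ∀ y, R y ∈ {a : 𝔸 | y ∈ K → dist a (P y) < η} := by
    refine exists_contMDiffMap_forall_mem_convex_of_local_const 𝓘(ℝ, Y)
      (t := fun y => {a : 𝔸 | y ∈ K → dist a (P y) < η}) (fun y => ?_) fun y => ?_
    · exact (convex_ball (P y) η).setOfPred_const_imp
    · by_cases hy : y ∈ K
      · refine ⟨P y, ?_⟩
        have := (hP y hy).eventually (Metric.ball_mem_nhds _ hη)
        rw [eventually_nhdsWithin_iff] at this
        filter_upwards [this] with z hz hzK
        rw [dist_comm]
        exact hz hzK
      · refine ⟨0, ?_⟩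
        filter_upwards [hK.isClosed.isOpen_compl.mem_nhds hy] with z hz hzK
        exact absurd hzK hz
  have hRC : ContDiff ℝ 1 R := R.contMDiff.contDiff
  refine ⟨fun y => ρ (R y), fun q hq => ?_⟩
  obtain ⟨h1, h2, h3⟩ := hηρ (P q) ⟨q, hq, rfl⟩ (R q) (hR q hq)
  refine ⟨by rwa [← dist_eq_norm], h1.comp q hRC.contDiffAt, ?_⟩
  have h4 : ∀ᶠ y in 𝓝 q, dist (R y) (P q) < η :=
    (hRC.continuous.continuousAt.dist continuousAt_const).eventually (gt_mem_nhds (hR q hq))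
  filter_upwards [h4] with y hy
  exact (hηρ (P q) ⟨q, hq, rfl⟩ (R y) hy).2.1

end Projections

/-! ### Equations with surjective derivative -/

section LocalSolvability

open Set Filter

variable {Y Z : Type*} [NormedAddCommGroup Y] [NormedSpace ℝ Y] [CompleteSpace Y]
  [NormedAddCommGroup Z] [NormedSpace ℝ Z] [CompleteSpace Z]

/-- Linear maps close to a surjective one are surjective, with a uniformly bounded right inverse. -/
theorem exists_preimage_norm_le_of_near {C₀ : Y →L[ℝ] Z} (hC₀ : Function.Surjective C₀) :
    ∃ κ > 0, ∃ s > 0, ∀ C : Y →L[ℝ] Z, ‖C - C₀‖ ≤ κ → ∀ z, ∃ x, C x = z ∧ ‖x‖ ≤ s * ‖z‖ := by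
  obtain ⟨N, hN⟩ := C₀.exists_nonlinearRightInverse_of_surjective (LinearMap.range_eq_top.2 hC₀)
  refine ⟨(N.nnnorm : ℝ)⁻¹ / 2, by positivity, 2 * N.nnnorm, by positivity, fun C hC z => ?_⟩
  have hap : ApproximatesLinearOn C C₀ univ (N.nnnorm⁻¹ / 2) :=
    ApproximatesLinearOn.approximatesLinearOn_iff_lipschitzOnWith.2 <|
      LipschitzOnWith.of_dist_le_mul fun x _ y _ => by
      rw [dist_eq_norm, dist_eq_norm]
      have : (⇑C - ⇑C₀) x - (⇑C - ⇑C₀) y = (C - C₀) (x - y) := by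
        simp; abel
      rw [this]
      exact ((C - C₀).le_opNorm _).trans (by push_cast; gcongr)
  have h1 := hap.surjOn_closedBall_of_nonlinearRightInverse N (b := 0)
    (ε := 2 * N.nnnorm * ‖z‖) (by positivity) (subset_univ _)
  obtain ⟨x, hx, rfl⟩ := h1 (show z ∈ _ by
    rw [map_zero, mem_closedBall_zero_iff]
    push_cast
    have : ((N.nnnorm : ℝ)⁻¹ - (N.nnnorm : ℝ)⁻¹ / 2) * (2 * N.nnnorm * ‖z‖) = ‖z‖ := by
      have : (N.nnnorm : ℝ) ≠ 0 := ne_of_gt hN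
      field_simp
      ring
    exact this.ge)
  exact ⟨x, rfl, mem_closedBall_zero_iff.1 hx⟩

/-- Solvability is stable under perturbation at a zero where the derivative is surjective. -/
theorem eventually_exists_zero {Λ : Type*} [TopologicalSpace Λ] {l₀ : Λ} {q : Y} {c : Λ → Y → Z}
    {C : Λ → Y → Y →L[ℝ] Z}
    (hc : ∀ᶠ p : Λ × Y in 𝓝 (l₀, q), HasFDerivAt (c p.1) (C p.1 p.2) p.2)
    (hC : ContinuousAt (fun p : Λ × Y => C p.1 p.2) (l₀, q))
    (hcc : ContinuousAt (fun l => c l q) l₀) (h0 : c l₀ q = 0)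
    (hsurj : Function.Surjective (C l₀ q)) {V : Set Y} (hV : V ∈ 𝓝 q) :
    ∀ᶠ l in 𝓝 l₀, ∃ y ∈ V, c l y = 0 := by
  obtain ⟨N, hN⟩ := (C l₀ q).exists_nonlinearRightInverse_of_surjective
    (LinearMap.range_eq_top.2 hsurj)
  have hNinv : (0 : ℝ) < (N.nnnorm : ℝ)⁻¹ / 2 := by positivity
  have h1 : ∀ᶠ p : Λ × Y in 𝓝 (l₀, q), HasFDerivAt (c p.1) (C p.1 p.2) p.2 ∧
      dist (C p.1 p.2) (C l₀ q) < (N.nnnorm : ℝ)⁻¹ / 2 :=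
    hc.and (hC.eventually (Metric.ball_mem_nhds _ hNinv))
  rw [nhds_prod_eq, Filter.eventually_prod_iff] at h1
  obtain ⟨p₁, hp₁, p₂, hp₂, hpp⟩ := h1
  obtain ⟨r, hr, hball⟩ := Metric.nhds_basis_closedBall.mem_iff.1 (inter_mem hV hp₂)
  have hev : ∀ᶠ l in 𝓝 l₀, dist (c l q) 0 < (N.nnnorm : ℝ)⁻¹ / 2 * r :=
    (h0 ▸ hcc.tendsto : Tendsto (fun l => c l q) (𝓝 l₀) (𝓝 0)).eventually
      (Metric.ball_mem_nhds _ (by positivity))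
  filter_upwards [hp₁, hev] with l hl1 hl2
  have hap : ApproximatesLinearOn (c l) (C l₀ q) (Metric.closedBall q r) (N.nnnorm⁻¹ / 2) := by
    intro x hx y hy
    refine (convex_closedBall q r).norm_image_sub_le_of_norm_hasFDerivWithin_le'
      (f' := fun y => C l y) (fun z hz => (hpp hl1 (hball hz).2).1.hasFDerivWithinAt)
      (fun z hz => ?_) hy hx
    have := (hpp hl1 (hball hz).2).2
    rw [dist_eq_norm] at this
    push_cast
    exact this.le
  obtain ⟨y, hy, hy0⟩ := hap.surjOn_closedBall_of_nonlinearRightInverse N hr.le subset_rfl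
    (show (0 : Z) ∈ _ by
      rw [Metric.mem_closedBall, dist_comm]
      push_cast
      refine hl2.le.trans (le_of_eq ?_)
      ring)
  exact ⟨y, (hball hy).1, hy0⟩

/-- Near a zero `q` with surjective derivative, the zero set of `c` is swept out by any
immersed piece of it whose dimension is at least that of the kernel of the derivative. -/
theorem eventually_zero_mem_image [FiniteDimensional ℝ Y] {m : ℕ} {c : Y → Z} {C : Y →L[ℝ] Z}
    {q : Y} (hc : HasStrictFDerivAt c C q) (hsurj : Function.Surjective C)
    (hdim : Module.finrank ℝ C.ker ≤ m) {ι : EuclideanSpace ℝ (Fin m) → Y}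
    {ι' : EuclideanSpace ℝ (Fin m) →L[ℝ] Y} {u₀ : EuclideanSpace ℝ (Fin m)}
    (hι : HasStrictFDerivAt ι ι' u₀) (hinj : Function.Injective ι') (hu₀ : ι u₀ = q)
    (hcι : ∀ᶠ u in 𝓝 u₀, c (ι u) = 0) {p : Y → Prop} (hp : ∀ᶠ u in 𝓝 u₀, p (ι u)) :
    ∀ᶠ y in 𝓝 q, c y = 0 → p y := by
  have hrange : C.range = ⊤ := LinearMap.range_eq_top.2 hsurj
  have hker : C.ker.ClosedComplemented := Submodule.ClosedComplemented.of_finiteDimensional _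
  have hinjΘ := hc.eq_implicitFunctionOfComplemented hrange hker
  set π : Y →L[ℝ] C.ker := Classical.choose hker with hπ
  have hπk : ∀ x : C.ker, π x = x := Classical.choose_spec hker
  simp only [HasStrictFDerivAt.implicitToOpenPartialHomeomorphOfComplemented_apply, ← hπ] at hinjΘ
  have hιker : ∀ u, C (ι' u) = 0 := by
    have h1 : HasFDerivAt (fun u => c (ι u)) (C.comp ι') u₀ := by
      have := hc.hasFDerivAt
      rw [← hu₀] at this
      exact this.comp u₀ hι.hasFDerivAt
    have h2 : HasFDerivAt (fun u => c (ι u)) (0 : EuclideanSpace ℝ (Fin m) →L[ℝ] Z) u₀ :=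
      (hasFDerivAt_const (0 : Z) u₀).congr_of_eventuallyEq hcι
    intro u
    exact congrArg (fun L => L u) (h1.unique h2)
  have hg : HasStrictFDerivAt (fun u => π (ι u - q)) (π.comp ι') u₀ :=
    π.hasStrictFDerivAt.comp u₀ (hι.sub_const q)
  have hgi : Function.Injective (π.comp ι') := by
    intro u v huv
    have h1 : π (ι' u) = π (ι' v) := huv
    rw [hπk ⟨ι' u, hιker u⟩, hπk ⟨ι' v, hιker v⟩] at h1
    exact hinj (congrArg Subtype.val h1)
  have hgs : (π.comp ι').range = ⊤ := by
    have h1 : Module.finrank ℝ (EuclideanSpace ℝ (Fin m)) = Module.finrank ℝ C.ker :=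
      le_antisymm (LinearMap.finrank_le_finrank_of_injective
        (f := (π.comp ι').toLinearMap) hgi) (by simpa using hdim)
    exact LinearMap.range_eq_top.2 ((LinearMap.injective_iff_surjective_of_finrank_eq_finrank
      (f := (π.comp ι').toLinearMap) h1).1 hgi)
  have hmap := hg.map_nhds_eq_of_surj hgs
  have hgood : ∀ᶠ u in 𝓝 u₀, p (ι u) ∧ c (ι u) = 0 ∧
      hc.implicitFunctionOfComplemented c C hrange hker (c (ι u)) (π (ι u - q)) = ι u :=
    hp.and (hcι.and ((hu₀ ▸ hι.continuousAt.tendsto : Tendsto ι (𝓝 u₀) (𝓝 q)).eventually hinjΘ))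
  have himg : (fun u => π (ι u - q)) '' {u | p (ι u) ∧ c (ι u) = 0 ∧
      hc.implicitFunctionOfComplemented c C hrange hker (c (ι u)) (π (ι u - q)) = ι u} ∈
      𝓝 (π (q - q)) := by
    have := image_mem_map (m := fun u => π (ι u - q)) hgood
    rwa [hmap, hu₀] at this
  have hπc : ContinuousAt (fun y => π (y - q)) q := by fun_prop
  filter_upwards [hinjΘ, hπc.eventually himg] with y hy1 hy2 hcy
  obtain ⟨u, ⟨h1, h2, h3⟩, h4⟩ := hy2
  have h4' : π (ι u - q) = π (y - q) := h4
  rw [h4', h2, ← hcy, hy1] at h3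
  rw [h3]
  exact h1

end LocalSolvability

/-! ### Lyapunov–Schmidt reduction for equations with a potential -/

section Reduction

open Set Filter

variable {Y : Type*} [NormedAddCommGroup Y] [InnerProductSpace ℝ Y] [FiniteDimensional ℝ Y]

/-- An idempotent `Pr` close to the orthogonal projection onto `T` has a kernel that meets `T` only
in `0`, so that the equation `w - Pr w = 0` may be projected along `T` without losing information. -/
theorem sub_apply_eq_zero_of_mem {T : Submodule ℝ Y} {Pr : Y →L[ℝ] Y} (hPr : Pr * Pr = Pr)
    (hn : ‖Pr - T.starProjection‖ < 1 / 4) {w : Y} (hw : w - Pr w ∈ T) : w - Pr w = 0 := by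
  set u := w - Pr w
  have h1 : Pr u = 0 := by
    have : Pr (Pr w) = Pr w := congrArg (fun L => L w) hPr
    simp [u, this]
  have h2 : T.starProjection u = u := Submodule.starProjection_eq_self_iff.2 hw
  have h3 := (Pr - T.starProjection).le_opNorm u
  rw [sub_apply, h1, h2, zero_sub, norm_neg] at h3
  have : ‖u‖ = 0 := by nlinarith [norm_nonneg u]
  exact norm_eq_zero.1 this

variable {Λ : Type*} [TopologicalSpace Λ]

/-- The local content of the Lyapunov–Schmidt reduction at a point `q` of the critical manifold. Here
`Pr` is a `C¹` family of idempotents, `Pr q` being close to the orthogonal projection onto the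
kernel of `F' l₀ q`, and the reduced equation is `F - Pr F = 0`. Near `(l₀, q)`: a constrained local
maximum of the potential `α` on the solution set of the reduced equation solves the full equation;
at `l₀` the reduced equation has no solutions off `K`; and it remains solvable for `l` near `l₀`. -/
theorem local_reduction {l₀ : Λ} {m : ℕ} {K : Set Y} {F : Λ → Y → Y} {F' : Λ → Y → Y →L[ℝ] Y}
    (hF : ∀ l y, HasFDerivAt (F l) (F' l y) y)
    (hFc : Continuous fun p : Λ × Y => F p.1 p.2) (hF'c : Continuous fun p : Λ × Y => F' p.1 p.2)
    {α : Λ → Y → ℝ} {L : Λ → Y → Y →L[ℝ] Y}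
    (hα : ∀ l y, HasFDerivAt (α l) ((innerSL ℝ (F l y)).comp (L l y)) y)
    (hLc : Continuous fun p : Λ × Y => L p.1 p.2) {q : Y} (hF0 : F l₀ q = 0)
    (hFK : ∀ y ∈ K, F l₀ y = 0)
    (hL : ∀ τ, F' l₀ q τ = 0 → L l₀ q τ = τ)
    (hperp : ∀ v τ, F' l₀ q τ = 0 → inner ℝ (F' l₀ q v) τ = 0)
    (hdim : Module.finrank ℝ (F' l₀ q).ker ≤ m)
    {ι : EuclideanSpace ℝ (Fin m) → Y}
    {ι' : EuclideanSpace ℝ (Fin m) →L[ℝ] Y} {u₀ : EuclideanSpace ℝ (Fin m)}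
    (hι : HasStrictFDerivAt ι ι' u₀) (hinj : Function.Injective ι') (hu₀ : ι u₀ = q)
    (hιK : ∀ᶠ u in 𝓝 u₀, ι u ∈ K) {Pr : Y → Y →L[ℝ] Y} (hPr : ContDiffAt ℝ 1 Pr q)
    (hPrPr : ∀ᶠ y in 𝓝 q, Pr y * Pr y = Pr y)
    (hPrn : ‖Pr q - (F' l₀ q).ker.starProjection‖ < 1 / 4) :
    (∀ᶠ p : Λ × Y in 𝓝 (l₀, q), F p.1 p.2 - Pr p.2 (F p.1 p.2) = 0 →
      IsLocalMaxOn (α p.1) {y | F p.1 y - Pr y (F p.1 y) = 0} p.2 → F p.1 p.2 = 0) ∧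
    (∀ᶠ y in 𝓝 q, F l₀ y - Pr y (F l₀ y) = 0 → y ∈ K) ∧
    ∀ V ∈ 𝓝 q, ∀ᶠ l in 𝓝 l₀, ∃ y ∈ V, F l y - Pr y (F l y) = 0 := by
  set A := F' l₀ q with hA
  set T : Submodule ℝ Y := A.ker with hT
  have hmemT : ∀ v, v ∈ T ↔ A v = 0 := fun v => LinearMap.mem_ker
  set pr : Y →L[ℝ] Tᗮ := Tᗮ.orthogonalProjectionOnto with hpr
  have hpr0 : ∀ u, pr u = 0 ↔ u ∈ T := fun u => by
    rw [hpr, Submodule.orthogonalProjectionOnto_eq_zero_iff, Submodule.orthogonal_orthogonal]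
  have hAmem : ∀ v, A v ∈ Tᗮ := fun v =>
    (Submodule.mem_orthogonal' T _).2 fun τ hτ => hperp v τ ((hmemT τ).1 hτ)
  -- the reduced equation, projected onto a fixed space
  let c : Λ → Y → Tᗮ := fun l y => pr (F l y - Pr y (F l y))
  let C : Λ → Y → Y →L[ℝ] Tᗮ := fun l y =>
    pr.comp (F' l y - ((Pr y).comp (F' l y) + (fderiv ℝ Pr y).flip (F l y)))
  have hgood : ∀ᶠ y in 𝓝 q, ContDiffAt ℝ 1 Pr y ∧ Pr y * Pr y = Pr y ∧
      ‖Pr y - T.starProjection‖ < 1 / 4 :=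
    (hPr.eventually (by simp)).and (hPrPr.and
      ((hPr.continuousAt.sub continuousAt_const).norm.eventually (gt_mem_nhds hPrn)))
  have hc : ∀ l y, ContDiffAt ℝ 1 Pr y → HasStrictFDerivAt (c l) (C l y) y := by
    intro l y hy
    have h1 : HasStrictFDerivAt (F l) (F' l y) y :=
      hasStrictFDerivAt_of_hasFDerivAt_of_continuousAt (Eventually.of_forall (hF l))
        (hF'c.comp (Continuous.prodMk_right l)).continuousAt
    have h2 : HasStrictFDerivAt Pr (fderiv ℝ Pr y) y := hy.hasStrictFDerivAt one_ne_zero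
    exact pr.hasStrictFDerivAt.comp y (h1.sub (h2.clm_apply h1))
  have hCc : ContinuousAt (fun p : Λ × Y => C p.1 p.2) (l₀, q) := by
    have h1 : ContinuousAt (fun p : Λ × Y => fderiv ℝ Pr p.2) (l₀, q) :=
      ContinuousAt.comp (g := fderiv ℝ Pr) (f := Prod.snd)
        (hPr.fderiv_right (m := 0) (by norm_num)).continuousAt continuousAt_snd
    have h2 : ContinuousAt (fun p : Λ × Y => Pr p.2) (l₀, q) :=
      ContinuousAt.comp (g := Pr) (f := Prod.snd) hPr.continuousAt continuousAt_snd
    have h3 : ContinuousAt (fun p : Λ × Y => (fderiv ℝ Pr p.2).flip) (l₀, q) :=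
      ((ContinuousLinearMap.flipₗᵢ ℝ Y Y Y).continuous.continuousAt).comp h1
    exact continuousAt_const.clm_comp (hF'c.continuousAt.sub
      ((h2.clm_comp hF'c.continuousAt).add (h3.clm_apply hFc.continuousAt)))
  have hC0 : ∀ v, C l₀ q v = pr (A v - Pr q (A v)) := by
    intro v
    simp [C, hF0, hA]
  have hzero : ∀ l y, Pr y * Pr y = Pr y → ‖Pr y - T.starProjection‖ < 1 / 4 →
      (c l y = 0 ↔ F l y - Pr y (F l y) = 0) := by
    intro l y h1 h2
    constructor
    · intro h3
      exact sub_apply_eq_zero_of_mem h1 h2 ((hpr0 _).1 h3)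
    · intro h3
      simp only [c, h3, map_zero]
  have hTperp : ∀ w ∈ Tᗮ, w - Pr q w ∈ T → w = 0 := by
    intro w hw h1
    have h2 := sub_apply_eq_zero_of_mem hPrPr.self_of_nhds hPrn h1
    have h3 : T.starProjection w = 0 := (Submodule.starProjection_apply_eq_zero_iff T).2 hw
    have h4 := (Pr q - T.starProjection).le_opNorm w
    rw [sub_apply, h3, sub_zero, ← sub_eq_zero.1 h2] at h4
    have : ‖w‖ = 0 := by nlinarith [norm_nonneg w]
    exact norm_eq_zero.1 this
  have hCker : ∀ v, C l₀ q v = 0 ↔ A v = 0 := by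
    intro v
    rw [hC0, hpr0]
    exact ⟨fun h => hTperp _ (hAmem v) h, fun h => by simp [h]⟩
  have hCsurj : Function.Surjective (C l₀ q) := by
    have h1 : (C l₀ q).ker = T := by
      ext v; exact (hCker v)
    have h2 := LinearMap.finrank_range_add_finrank_ker (C l₀ q).toLinearMap
    have h3 := Submodule.finrank_add_finrank_orthogonal T
    have h4 : Module.finrank ℝ (C l₀ q).range = Module.finrank ℝ Tᗮ := by
      have h5 : Module.finrank ℝ (LinearMap.ker (C l₀ q).toLinearMap) = Module.finrank ℝ T := by
        rw [h1]
      change Module.finrank ℝ (LinearMap.range (C l₀ q).toLinearMap) = _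
      lia
    exact LinearMap.range_eq_top.1 (Submodule.eq_top_of_finrank_eq h4)
  have hcq : c l₀ q = 0 := by simp [c, hF0]
  refine ⟨?_, ?_, ?_⟩
  · obtain ⟨κ, hκ, s, hs, hright⟩ := exists_preimage_norm_le_of_near hCsurj
    set L₀ := L l₀ q with hL₀
    set η : ℝ := (4 * (2 + ‖L₀‖))⁻¹ with hη
    have hη0 : 0 < η := by positivity
    have hη1 : η * (2 + ‖L₀‖) = 1 / 4 := by
      rw [hη]; field_simp
    have hηle : η ≤ 1 := by nlinarith [norm_nonneg L₀]
    have hmin : 0 < min κ (η / s) := by positivity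
    have h1 : ∀ᶠ p : Λ × Y in 𝓝 (l₀, q), ‖C p.1 p.2 - C l₀ q‖ < min κ (η / s) :=
      (hCc.eventually (Metric.ball_mem_nhds (C l₀ q) hmin)).mono fun p hp =>
        (dist_eq_norm (C p.1 p.2) (C l₀ q)).symm.trans_lt hp
    have h2 : ∀ᶠ p : Λ × Y in 𝓝 (l₀, q), ‖L p.1 p.2 - L₀‖ < η :=
      (hLc.continuousAt.sub continuousAt_const).norm.eventually (gt_mem_nhds (by simp [hη0]))
    have h3 := (continuousAt_snd : ContinuousAt Prod.snd ((l₀, q) : Λ × Y)).eventually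
      hgood.eventually_nhds
    filter_upwards [h1, h2, h3] with ⟨l, y⟩ hp1 hp2 hp3 hy hmax
    simp only at hp1 hp2 hp3 hy hmax ⊢
    have hgy := hp3.self_of_nhds
    have hcy : c l y = 0 := (hzero l y hgy.2.1 hgy.2.2).2 hy
    have hext : IsLocalExtrOn (α l) {z | c l z = c l y} y := by
      refine Or.inr ?_
      have hset : {z | c l z = c l y} =ᶠ[𝓝 y] {y | F l y - Pr y (F l y) = 0} := by
        filter_upwards [hp3] with z hz
        refine propext ?_
        change c l z = c l y ↔ _
        rw [hcy]
        exact hzero l z hz.2.1 hz.2.2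
      change IsMaxFilter (α l) (𝓝[{z | c l z = c l y}] y) y
      rw [nhdsWithin_eq_iff_eventuallyEq.2 hset]
      exact hmax
    have hαs : HasStrictFDerivAt (α l) ((innerSL ℝ (F l y)).comp (L l y)) y := by
      refine hasStrictFDerivAt_of_hasFDerivAt_of_continuousAt
        (f' := fun y => (innerSL ℝ (F l y)).comp (L l y)) (Eventually.of_forall (hα l)) ?_
      have e1 : Continuous (F l) := hFc.comp (Continuous.prodMk_right l)
      have e2 : Continuous (L l) := hLc.comp (Continuous.prodMk_right l)
      exact (((innerSL ℝ).continuous.comp e1).clm_comp e2).continuousAt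
    obtain ⟨μ, μ₀, hμ, hμx⟩ :=
      hext.exists_linear_map_of_hasStrictFDerivAt (hc l y hgy.1) hαs
    have hright' := hright (C l y) (hp1.le.trans (min_le_left _ _))
    have hμ₀ : μ₀ ≠ 0 := by
      rintro rfl
      refine hμ (Prod.ext (LinearMap.ext fun z => ?_) rfl)
      obtain ⟨x, rfl, -⟩ := hright' z
      simpa using hμx x
    set w := F l y with hw
    -- By Lagrange multipliers `w` is orthogonal to the image under `L` of the kernel of `C l y`. This
    -- image contains a vector close to the component `τ` of `w` in `T`, so `τ` is small compared
    -- with `w`; but `w = Pr w` is close to `τ`, whence `w = 0`.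
    set τ := T.starProjection w
    have hτT : A τ = 0 := (hmemT _).1 (T.starProjection_apply_mem w)
    obtain ⟨x, hx, hxn⟩ := hright' (C l y τ)
    have hCτ : ‖C l y τ‖ ≤ η / s * ‖τ‖ := by
      have : C l y τ = (C l y - C l₀ q) τ := by rw [sub_apply, (hCker τ).2 hτT, sub_zero]
      rw [this]
      exact ((C l y - C l₀ q).le_opNorm τ).trans
        (by gcongr; exact hp1.le.trans (min_le_right _ _))
    have hxτ : ‖x‖ ≤ η * ‖τ‖ := by
      calc ‖x‖ ≤ s * ‖C l y τ‖ := hxn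
        _ ≤ s * (η / s * ‖τ‖) := by gcongr
        _ = η * ‖τ‖ := by field_simp
    have horth : inner ℝ w (L l y (τ - x)) = 0 := by
      have := hμx (τ - x)
      rw [map_sub, hx, sub_self, map_zero, zero_add, smul_eq_mul] at this
      exact (mul_eq_zero.1 this).resolve_left hμ₀
    have hclose : ‖L l y (τ - x) - τ‖ ≤ 1 / 4 * ‖τ‖ := by
      have e1 : L l y (τ - x) - τ = (L l y - L₀) (τ - x) - L₀ x := by
        rw [sub_apply, map_sub L₀, hL τ hτT]; abel
      have e2 : ‖τ - x‖ ≤ 2 * ‖τ‖ := by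
        refine (norm_sub_le _ _).trans ?_
        nlinarith [norm_nonneg τ]
      rw [e1]
      calc _ ≤ ‖(L l y - L₀) (τ - x)‖ + ‖L₀ x‖ := norm_sub_le _ _
        _ ≤ η * (2 * ‖τ‖) + ‖L₀‖ * (η * ‖τ‖) := by
          gcongr
          · exact ((L l y - L₀).le_opNorm _).trans (by gcongr)
          · exact (L₀.le_opNorm _).trans (by gcongr)
        _ = η * (2 + ‖L₀‖) * ‖τ‖ := by ring
        _ = _ := by rw [hη1]
    have hττ : ‖τ‖ ^ 2 ≤ ‖w‖ * (1 / 4 * ‖τ‖) := by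
      have e1 : inner ℝ w τ = ‖τ‖ ^ 2 := by
        rw [← real_inner_self_eq_norm_sq]
        have := Submodule.inner_right_of_mem_orthogonal (T.starProjection_apply_mem w)
          (T.sub_starProjection_mem_orthogonal w)
        rw [inner_sub_right, real_inner_comm] at this
        linarith
      have e2 := real_inner_le_norm w (τ - L l y (τ - x))
      rw [inner_sub_right, horth, sub_zero, e1, norm_sub_rev] at e2
      exact e2.trans (by gcongr)
    have hτw : ‖τ‖ ≤ 1 / 4 * ‖w‖ := by
      by_contra hcon
      push Not at hcon
      have : 0 < ‖τ‖ := lt_of_le_of_lt (by positivity) hcon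
      nlinarith
    have hwτ : ‖w - τ‖ ≤ 1 / 4 * ‖w‖ := by
      have e1 : w - τ = (Pr y - T.starProjection) w := by
        rw [sub_apply]
        exact congrArg (· - τ) (sub_eq_zero.1 hy)
      rw [e1]
      exact ((Pr y - T.starProjection).le_opNorm w).trans (by gcongr; exact hgy.2.2.le)
    have : ‖w‖ = 0 := by
      have e1 : ‖w‖ ≤ ‖w - τ‖ + ‖τ‖ := by
        have := norm_add_le (w - τ) τ
        rwa [sub_add_cancel] at this
      linarith [norm_nonneg w]
    exact norm_eq_zero.1 this
  · have hdim' : Module.finrank ℝ (C l₀ q).ker ≤ m := by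
      have h1 : (C l₀ q).ker = T := by
        ext v; exact (hCker v)
      rw [h1]; exact hdim
    have key := eventually_zero_mem_image (hc l₀ q hPr) hCsurj hdim' hι hinj hu₀
      (by filter_upwards [hιK] with u hu; simp [c, hFK _ hu]) hιK
    filter_upwards [key, hgood] with y h1 h2 h3
    exact h1 ((hzero l₀ y h2.2.1 h2.2.2).2 h3)
  · intro V hV
    have hev : ∀ᶠ p : Λ × Y in 𝓝 (l₀, q), HasFDerivAt (c p.1) (C p.1 p.2) p.2 := by
      filter_upwards [(continuousAt_snd : ContinuousAt Prod.snd ((l₀, q) : Λ × Y)).eventually hgood]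
        with p hp
      exact (hc p.1 p.2 hp.1).hasFDerivAt
    have hcc : ContinuousAt (fun l => c l q) l₀ := by
      have : Continuous fun l => F l q := hFc.comp (Continuous.prodMk_left q)
      exact (pr.continuous.comp (this.sub ((Pr q).continuous.comp this))).continuousAt
    filter_upwards [eventually_exists_zero hev hCc hcc hcq hCsurj (inter_mem hV hgood)]
      with l ⟨y, hy, hy0⟩
    exact ⟨y, hy.1, (hzero l y hy.2.2.1 hy.2.2.2).1 hy0⟩

/-- Persistence of a non-degenerate compact manifold `K` of zeros of `F l₀`, when `F l` is, up to
the linear change `L l`, the gradient of a function `α l`: for every `l` near `l₀` the map `F l` has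
a zero near `K`. The hypotheses on the derivative say that its kernel is (at most) tangent to `K` and
orthogonal to its range. -/
theorem eventually_exists_zero_near_manifold {l₀ : Λ} {m : ℕ} {K : Set Y} (hK : IsCompact K)
    (hKne : K.Nonempty) {F : Λ → Y → Y} {F' : Λ → Y → Y →L[ℝ] Y}
    (hF : ∀ l y, HasFDerivAt (F l) (F' l y) y)
    (hFc : Continuous fun p : Λ × Y => F p.1 p.2) (hF'c : Continuous fun p : Λ × Y => F' p.1 p.2)
    {α : Λ → Y → ℝ} {L : Λ → Y → Y →L[ℝ] Y}
    (hα : ∀ l y, HasFDerivAt (α l) ((innerSL ℝ (F l y)).comp (L l y)) y)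
    (hLc : Continuous fun p : Λ × Y => L p.1 p.2)
    (hFK : ∀ q ∈ K, F l₀ q = 0)
    (hL : ∀ q ∈ K, ∀ τ, F' l₀ q τ = 0 → L l₀ q τ = τ)
    (hperp : ∀ q ∈ K, ∀ v τ, F' l₀ q τ = 0 → inner ℝ (F' l₀ q v) τ = 0)
    (hdim : ∀ q ∈ K, Module.finrank ℝ (F' l₀ q).ker ≤ m)
    (hpar : ∀ q ∈ K, ∃ (ι : EuclideanSpace ℝ (Fin m) → Y) (ι' : EuclideanSpace ℝ (Fin m) →L[ℝ] Y)
      (u₀ : EuclideanSpace ℝ (Fin m)), HasStrictFDerivAt ι ι' u₀ ∧ Function.Injective ι' ∧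
      ι u₀ = q ∧ ∀ᶠ u in 𝓝 u₀, ι u ∈ K)
    {W : Set Y} (hW : W ∈ 𝓝ˢ K) : ∀ᶠ l in 𝓝 l₀, ∃ y ∈ W, F l y = 0 := by
  -- the tangent space of `K` is contained in, hence equal to, the kernel
  have hdim' : ∀ q ∈ K, Module.finrank ℝ (LinearMap.ker (F' l₀ q).toLinearMap) = m := by
    intro q hq
    refine le_antisymm (hdim q hq) ?_
    obtain ⟨ι, ι', u₀, hι, hinj, rfl, hιK⟩ := hpar q hq
    have h1 : HasFDerivAt (fun u => F l₀ (ι u)) ((F' l₀ (ι u₀)).comp ι') u₀ :=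
      (hF l₀ (ι u₀)).comp u₀ hι.hasFDerivAt
    have h2 : HasFDerivAt (fun u => F l₀ (ι u)) (0 : EuclideanSpace ℝ (Fin m) →L[ℝ] Y) u₀ :=
      (hasFDerivAt_const (0 : Y) u₀).congr_of_eventuallyEq
        (by filter_upwards [hιK] with u hu; exact hFK _ hu)
    have h3 := h1.unique h2
    have h4 : ∀ u, ι' u ∈ LinearMap.ker (F' l₀ (ι u₀)).toLinearMap := fun u =>
      DFunLike.congr_fun h3 u
    have := LinearMap.finrank_le_finrank_of_injective
      (f := ι'.toLinearMap.codRestrict _ h4) fun u v huv => hinj (congrArg Subtype.val huv)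
    simpa using this
  have hPcont := continuousOn_starProjection_ker (A := F' l₀) (K := K)
    (hF'c.comp (Continuous.prodMk_right l₀)).continuousOn hdim'
  obtain ⟨Pr, hPr⟩ := exists_contDiff_idempotent_approx hK hPcont
    (fun q _ => Submodule.isIdempotentElem_starProjection _) (δ := 1 / 4) (by norm_num)
  choose! ι ι' u₀ hι using hpar
  have hloc := fun q hq => local_reduction hF hFc hF'c hα hLc (hFK q hq) hFK (hL q hq)
    (hperp q hq) (hdim q hq) (hι q hq).1 (hι q hq).2.1 (hι q hq).2.2.1 (hι q hq).2.2.2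
    (hPr q hq).2.1 (hPr q hq).2.2 (hPr q hq).1
  -- a compact neighbourhood `D` of `K` on which all the local statements hold
  have hev : ∀ᶠ y in 𝓝ˢ K, y ∈ W ∧ ContinuousAt Pr y ∧
      (F l₀ y - Pr y (F l₀ y) = 0 → y ∈ K) := by
    refine Eventually.and (p := fun y => y ∈ W) hW (eventually_nhdsSet_iff_forall.2 fun q hq => ?_)
    refine Eventually.and ?_ (hloc q hq).2.1
    exact ((hPr q hq).2.1.eventually (by simp)).mono fun y hy => hy.continuousAt
  have hev2 : ∀ᶠ p : Λ × Y in 𝓝 l₀ ×ˢ 𝓝ˢ K, F p.1 p.2 - Pr p.2 (F p.1 p.2) = 0 →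
      IsLocalMaxOn (α p.1) {y | F p.1 y - Pr y (F p.1 y) = 0} p.2 → F p.1 p.2 = 0 := by
    rw [hK.prod_nhdsSet_eq_biSup]
    simp only [eventually_iSup, ← nhds_prod_eq]
    exact fun q hq => (hloc q hq).1
  obtain ⟨p₁, hp₁, p₂, hp₂, hpp⟩ := Filter.eventually_prod_iff.1 hev2
  obtain ⟨O, hO, hKO, hOsub⟩ := mem_nhdsSet_iff_exists.1 (hev.and hp₂)
  obtain ⟨D, hD, hKD, hDO⟩ := exists_compact_between hK hO hKO
  have hfc : ContinuousOn (fun p : Λ × Y => F p.1 p.2 - Pr p.2 (F p.1 p.2)) (univ ×ˢ D) := by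
    rintro ⟨l, y⟩ ⟨-, hy⟩
    have h1 : ContinuousAt (fun p : Λ × Y => Pr p.2) (l, y) :=
      ContinuousAt.comp (g := Pr) (f := Prod.snd) (hOsub (hDO hy)).1.2.1 continuousAt_snd
    exact (hFc.continuousAt.sub (h1.clm_apply hFc.continuousAt)).continuousWithinAt
  have hbdry : ∀ᶠ l in 𝓝 l₀, ∀ y ∈ D \ interior D, F l y - Pr y (F l y) ≠ 0 := by
    refine (hD.diff isOpen_interior).eventually_forall_of_forall_eventually fun y hy => ?_
    have h0 : F l₀ y - Pr y (F l₀ y) ≠ 0 := fun h0 =>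
      hy.2 (hKD ((hOsub (hDO hy.1)).1.2.2 h0))
    have h1 : ContinuousAt (fun p : Λ × Y => Pr p.2) (l₀, y) :=
      ContinuousAt.comp (g := Pr) (f := Prod.snd) (hOsub (hDO hy.1)).1.2.1 continuousAt_snd
    exact (hFc.continuousAt.sub (h1.clm_apply hFc.continuousAt)).eventually_ne h0
  obtain ⟨q₀, hq₀⟩ := hKne
  have hne := (hloc q₀ hq₀).2.2 D (mem_interior_iff_mem_nhds.1 (hKD hq₀))
  filter_upwards [hbdry, hne, hp₁] with l hl1 ⟨y₁, hy₁, hy₁0⟩ hl3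
  set s : Set Y := {y | F l y - Pr y (F l y) = 0} with hs
  have hcl : IsClosed (D ∩ s) := by
    have : ContinuousOn (fun y => F l y - Pr y (F l y)) D :=
      hfc.comp (Continuous.prodMk_right l).continuousOn fun y hy => ⟨mem_univ _, hy⟩
    exact this.preimage_isClosed_of_isClosed hD.isClosed isClosed_singleton
  have hαc : Continuous (α l) := continuous_iff_continuousAt.2 fun y => (hα l y).continuousAt
  obtain ⟨y, hy, hymax⟩ := (hD.of_isClosed_subset hcl inter_subset_left).exists_isMaxOn
    ⟨y₁, hy₁, hy₁0⟩ hαc.continuousOn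
  have hyint : y ∈ interior D := by
    by_contra hcon
    exact hl1 y ⟨hy.1, hcon⟩ hy.2
  have hlocmax : IsLocalMaxOn (α l) s y := by
    have h1 : D ∈ 𝓝 y := mem_interior_iff_mem_nhds.1 hyint
    change ∀ᶠ z in 𝓝[s] y, α l z ≤ α l y
    rw [eventually_nhdsWithin_iff]
    filter_upwards [h1] with z hz hzs
    exact hymax ⟨hz, hzs⟩
  exact ⟨y, (hOsub (hDO hy.1)).1.1, hpp hl3 (hOsub (hDO hy.1)).2 hy.2 hlocmax⟩

end Reduction

/-! ### Existence of Hamiltonian flows and of their action -/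

section HamiltonianFlow

open Set Filter
open scoped NNReal

variable {Λ : Type*} [TopologicalSpace Λ]
  {E : Type*} [NormedAddCommGroup E] [InnerProductSpace ℝ E]

/-- A family of Hamiltonians `H l` with gradients `g l` and Hessians `g' l`, such that everything is
jointly continuous, the gradients and the Hessians are uniformly bounded by `C`, and the Hessians
vanish outside the ball of radius `R`. -/
structure IsHamiltonianFamily (H : Λ → E → ℝ) (g : Λ → E → E) (g' : Λ → E → E →L[ℝ] E) (C R : ℝ) :
    Prop where
  hasFDerivAt : ∀ l z, HasFDerivAt (H l) (innerSL ℝ (g l z)) z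
  hasFDerivAt_grad : ∀ l z, HasFDerivAt (g l) (g' l z) z
  continuous : Continuous fun p : Λ × E => H p.1 p.2
  continuous_grad : Continuous fun p : Λ × E => g p.1 p.2
  continuous_hess : Continuous fun p : Λ × E => g' p.1 p.2
  norm_grad_le : ∀ l z, ‖g l z‖ ≤ C
  norm_hess_le : ∀ l z, ‖g' l z‖ ≤ C
  hess_eq_zero : ∀ l z, R < ‖z‖ → g' l z = 0

/-- `φ l t` is the time-`t` flow of `z' = -J ∇H(z)` (that is, of `J z' = ∇H(z)` when `J² = -1`),
`φ' l t` is its derivative with respect to the initial value, and `act l t z` is the action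
`∫₀ᵗ (⟨z, ∇H(z)⟩ / 2 - H(z)) ds` along the orbit of `z`, whose derivative is given by the first
variation formula. -/
structure IsHamiltonianFlow (J : E →L[ℝ] E) (H : Λ → E → ℝ) (g : Λ → E → E)
    (g' : Λ → E → E →L[ℝ] E) (φ : Λ → ℝ → E → E) (φ' : Λ → ℝ → E → E →L[ℝ] E)
    (act : Λ → ℝ → E → ℝ) : Prop where
  zero : ∀ l z, φ l 0 z = z
  hasDerivAt : ∀ l z t, HasDerivAt (fun t => φ l t z) (-J (g l (φ l t z))) t
  zero' : ∀ l z, φ' l 0 z = ContinuousLinearMap.id ℝ E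
  hasDerivAt' : ∀ l z v t, HasDerivAt (fun t => φ' l t z v) (-J (g' l (φ l t z) (φ' l t z v))) t
  hasFDerivAt : ∀ l t z, HasFDerivAt (φ l t) (φ' l t z) z
  continuous : Continuous fun p : Λ × ℝ × E => φ p.1 p.2.1 p.2.2
  continuous' : Continuous fun p : Λ × ℝ × E => φ' p.1 p.2.1 p.2.2
  hasDerivAt_act : ∀ l z t, HasDerivAt (fun t => act l t z)
    (1 / 2 * inner ℝ (φ l t z) (g l (φ l t z)) - H l (φ l t z)) t
  hasFDerivAt_act : ∀ l t z, HasFDerivAt (act l t)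
    ((1 / 2 : ℝ) • (innerSL ℝ (J z) - (innerSL ℝ (J (φ l t z))).comp (φ' l t z))) z

variable {J : E →L[ℝ] E} {H : Λ → E → ℝ} {g : Λ → E → E} {g' : Λ → E → E →L[ℝ] E} {C R : ℝ}

theorem exists_hamiltonianFlow [CompleteSpace E] (hJ : ∀ x y, inner ℝ (J x) y = -inner ℝ x (J y))
    (hJJ : ∀ x, J (J x) = -x) (hH : IsHamiltonianFamily H g g' C R) (hR : 0 ≤ R) :
    ∃ φ φ' act, IsHamiltonianFlow J H g g' φ φ' act := by
  have hC : ∀ (_ : Λ), 0 ≤ C := fun l => (norm_nonneg _).trans (hH.norm_grad_le l 0)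
  -- the flow on `E × ℝ`, the last coordinate being the action
  let Y : Λ → E × ℝ → E × ℝ := fun l p =>
    (-J (g l p.1), 1 / 2 * inner ℝ p.1 (g l p.1) - H l p.1)
  let D : Λ → E → E →L[ℝ] ℝ := fun l z =>
    (1 / 2 : ℝ) • ((innerSL ℝ z).comp (g' l z) - innerSL ℝ (g l z))
  let Y' : Λ → E × ℝ → E × ℝ →L[ℝ] E × ℝ := fun l p =>
    ((-(J.comp (g' l p.1))).comp (ContinuousLinearMap.fst ℝ E ℝ)).prod
      ((D l p.1).comp (ContinuousLinearMap.fst ℝ E ℝ))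
  have hD : ∀ l z, HasFDerivAt (fun z => 1 / 2 * inner ℝ z (g l z) - H l z) (D l z) z := by
    intro l z
    have h1 := ((hasFDerivAt_id (𝕜 := ℝ) z).inner ℝ (hH.hasFDerivAt_grad l z)).const_mul (1 / 2)
    refine (h1.sub (hH.hasFDerivAt l z)).congr_fderiv ?_
    ext v
    simp only [D, id, sub_apply, smul_apply, ContinuousLinearMap.comp_apply,
      ContinuousLinearMap.prod_apply, fderivInnerCLM_apply, innerSL_apply_apply, smul_eq_mul,
      ContinuousLinearMap.id_apply]
    rw [real_inner_comm v]
    ring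
  have hY : ∀ l p, HasFDerivAt (Y l) (Y' l p) p := by
    intro l p
    have h1 : HasFDerivAt (fun z => -J (g l z)) (-(J.comp (g' l p.1))) p.1 :=
      (J.hasFDerivAt.comp p.1 (hH.hasFDerivAt_grad l p.1)).neg
    exact (h1.comp p hasFDerivAt_fst).prodMk ((hD l p.1).comp p hasFDerivAt_fst)
  have hfst : Continuous fun p : Λ × E × ℝ => (p.1, p.2.1) :=
    continuous_fst.prodMk (continuous_fst.comp continuous_snd)
  have hgc := hH.continuous_grad.comp hfst
  have hg'c := hH.continuous_hess.comp hfst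
  have hHc := hH.continuous.comp hfst
  have hzc : Continuous fun p : Λ × E × ℝ => p.2.1 := continuous_fst.comp continuous_snd
  have hYc : Continuous fun p : Λ × E × ℝ => Y p.1 p.2 :=
    (J.continuous.comp hgc).neg.prodMk (((hzc.inner hgc).const_mul (1 / 2)).sub hHc)
  have hDc : Continuous fun p : Λ × E × ℝ => D p.1 p.2.1 :=
    ((((innerSL ℝ).continuous.comp hzc).clm_comp hg'c).sub
      ((innerSL ℝ).continuous.comp hgc)).const_smul (1 / 2 : ℝ)
  have hY'c : Continuous fun p : Λ × E × ℝ => Y' p.1 p.2 := by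
    have h1 : Continuous fun p : Λ × E × ℝ => -(J.comp (g' p.1 p.2.1)) :=
      (continuous_const.clm_comp hg'c).neg
    exact (ContinuousLinearMap.prodₗᵢ ℝ).continuous.comp
      ((h1.clm_comp continuous_const).prodMk (hDc.clm_comp continuous_const))
  have hYb : ∀ l p, ‖Y' l p‖ ≤ (⟨(‖J‖ + R + 1) * |C|, by positivity⟩ : ℝ≥0) := by
    intro l p
    change ‖Y' l p‖ ≤ (‖J‖ + R + 1) * |C|
    rw [abs_of_nonneg (hC l)]
    have hfs : ‖ContinuousLinearMap.fst ℝ E ℝ‖ ≤ 1 := ContinuousLinearMap.norm_fst_le ℝ E ℝ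
    have h1 : ‖-(J.comp (g' l p.1))‖ ≤ ‖J‖ * C := by
      rw [norm_neg]
      exact (ContinuousLinearMap.opNorm_comp_le _ _).trans (by gcongr; exact hH.norm_hess_le _ _)
    have h2 : ‖D l p.1‖ ≤ R * C + C := by
      have h3 : ‖(innerSL ℝ p.1).comp (g' l p.1)‖ ≤ R * C := by
        rcases le_or_gt ‖p.1‖ R with h | h
        · refine (ContinuousLinearMap.opNorm_comp_le _ _).trans ?_
          rw [innerSL_apply_norm]
          exact mul_le_mul h (hH.norm_hess_le _ _) (norm_nonneg _) hR
        · rw [hH.hess_eq_zero l _ h, ContinuousLinearMap.comp_zero, norm_zero]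
          exact mul_nonneg hR (hC l)
      have h4 : ‖innerSL ℝ (g l p.1)‖ ≤ C := by
        rw [innerSL_apply_norm]; exact hH.norm_grad_le _ _
      have h5 := norm_sub_le ((innerSL ℝ p.1).comp (g' l p.1)) (innerSL ℝ (g l p.1))
      simp only [D]
      rw [norm_smul]
      have h6 : ‖(1 / 2 : ℝ)‖ = 1 / 2 := by norm_num
      rw [h6]
      linarith [norm_nonneg ((innerSL ℝ p.1).comp (g' l p.1) - innerSL ℝ (g l p.1))]
    have hC' := hC l
    refine ContinuousLinearMap.opNorm_le_bound _ (by positivity) fun q => ?_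
    have hq : ‖q.1‖ ≤ ‖q‖ := norm_fst_le q
    rw [Prod.norm_def, sup_le_iff]
    constructor
    · calc _ ≤ ‖-(J.comp (g' l p.1))‖ * ‖q.1‖ := ContinuousLinearMap.le_opNorm _ _
        _ ≤ (‖J‖ * C) * ‖q‖ := by gcongr
        _ ≤ _ := by
          gcongr
          linarith
    · calc _ ≤ ‖D l p.1‖ * ‖q.1‖ := ContinuousLinearMap.le_opNorm _ _
        _ ≤ (R * C + C) * ‖q‖ := by gcongr
        _ ≤ _ := by
          gcongr
          nlinarith [mul_nonneg (norm_nonneg J) hC']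
  obtain ⟨Φ, Φ', h0, h1, h0', h1', h2, h3, h4⟩ := exists_flow hY hYc hY'c hYb
  have hin : ∀ z, HasFDerivAt (fun z : E => (z, (0 : ℝ))) (ContinuousLinearMap.inl ℝ E ℝ) z :=
    fun z => (ContinuousLinearMap.inl ℝ E ℝ).hasFDerivAt
  have hd1 : ∀ l z t, HasDerivAt (fun t => (Φ l t (z, 0)).1) (-J (g l (Φ l t (z, 0)).1)) t :=
    fun l z t => (h1 l (z, 0) t).fst
  have hd' : ∀ l z v t, HasDerivAt (fun t => Φ' l t (z, 0) (v, 0))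
      (Y' l (Φ l t (z, 0)) (Φ' l t (z, 0) (v, 0))) t := fun l z v t =>
    ((h1' l (z, 0) t).clm_apply (hasDerivAt_const t ((v, 0) : E × ℝ))).congr_deriv (by simp)
  have hd1' : ∀ l z v t, HasDerivAt (fun t => (Φ' l t (z, 0) (v, 0)).1)
      (-J (g' l (Φ l t (z, 0)).1 (Φ' l t (z, 0) (v, 0)).1)) t := fun l z v t => (hd' l z v t).fst
  have hcin : Continuous fun p : Λ × ℝ × E => (p.1, p.2.1, ((p.2.2, 0) : E × ℝ)) := by fun_prop
  refine ⟨fun l t z => (Φ l t (z, 0)).1, fun l t z => (ContinuousLinearMap.fst ℝ E ℝ).comp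
    ((Φ' l t (z, 0)).comp (ContinuousLinearMap.inl ℝ E ℝ)), fun l t z => (Φ l t (z, 0)).2, ?_⟩
  refine ⟨fun l z => by simp [h0], hd1, fun l z => ?_, hd1', fun l t z => ?_,
    continuous_fst.comp (h3.comp hcin), ?_, fun l z t => (h1 l (z, 0) t).snd, fun l t z => ?_⟩
  · ext v; simp [h0']
  · exact ((h2 l t (z, 0)).comp z (hin z)).fst
  · exact continuous_const.clm_comp ((h4.comp hcin).clm_comp continuous_const)
  · have key : HasFDerivAt (fun z => (Φ l t (z, 0)).2) ((ContinuousLinearMap.snd ℝ E ℝ).comp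
        ((Φ' l t (z, 0)).comp (ContinuousLinearMap.inl ℝ E ℝ))) z :=
      ((h2 l t (z, 0)).comp z (hin z)).snd
    refine key.congr_fderiv ?_
    ext v
    -- first variation formula: the difference of the two sides is constant along the flow
    have hconst : ∀ s, HasDerivAt (fun s => (Φ' l s (z, 0) (v, 0)).2 +
        1 / 2 * inner ℝ (J (Φ l s (z, 0)).1) (Φ' l s (z, 0) (v, 0)).1) 0 s := by
      intro s
      have e1 : HasDerivAt (fun s => (Φ' l s (z, 0) (v, 0)).2)
        (D l (Φ l s (z, 0)).1 (Φ' l s (z, 0) (v, 0)).1) s := (hd' l z v s).snd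
      have e2 : HasDerivAt (fun s => J (Φ l s (z, 0)).1) (J (-J (g l (Φ l s (z, 0)).1))) s :=
        J.hasFDerivAt.comp_hasDerivAt s (hd1 l z s)
      refine (e1.add ((e2.inner ℝ (hd1' l z v s)).const_mul (1 / 2))).congr_deriv ?_
      set y := (Φ l s (z, 0)).1
      set w := (Φ' l s (z, 0) (v, 0)).1
      simp only [D, sub_apply, smul_apply, ContinuousLinearMap.comp_apply,
        innerSL_apply_apply, smul_eq_mul, map_neg, hJJ, neg_neg, hJ]
      ring
    have hc := is_const_of_deriv_eq_zero (fun s => (hconst s).differentiableAt)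
      (fun s => (hconst s).deriv) t 0
    simp only [h0, h0', ContinuousLinearMap.id_apply] at hc
    simp only [ContinuousLinearMap.comp_apply, ContinuousLinearMap.coe_snd',
      ContinuousLinearMap.inl_apply, smul_apply, sub_apply,
      innerSL_apply_apply, ContinuousLinearMap.coe_fst', smul_eq_mul]
    linarith

end HamiltonianFlow

/-! ### Conservation laws, first variation and the fixed-energy problem -/

section HamiltonianFlowProperties

open Set Filter
open scoped NNReal

variable {Λ : Type*} [TopologicalSpace Λ]
  {E : Type*} [NormedAddCommGroup E] [InnerProductSpace ℝ E]
  {J : E →L[ℝ] E} {H : Λ → E → ℝ} {g : Λ → E → E} {g' : Λ → E → E →L[ℝ] E} {C R : ℝ}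
  {φ : Λ → ℝ → E → E} {φ' : Λ → ℝ → E → E →L[ℝ] E} {act : Λ → ℝ → E → ℝ}

theorem IsHamiltonianFamily.hess_symm (hH : IsHamiltonianFamily H g g' C R) (l : Λ) (z v w : E) :
    inner ℝ (g' l z v) w = inner ℝ v (g' l z w) := by
  have h := second_derivative_symmetric (f := H l) (f' := fun z => innerSL ℝ (g l z))
    (f'' := (innerSL ℝ).comp (g' l z)) (x := z) (hH.hasFDerivAt l)
    ((innerSL ℝ).hasFDerivAt.comp z (hH.hasFDerivAt_grad l z)) v w
  simp only [ContinuousLinearMap.comp_apply, innerSL_apply_apply] at h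
  rw [h, real_inner_comm]

theorem IsHamiltonianFamily.lipschitzWith (hH : IsHamiltonianFamily H g g' C R) (l : Λ) :
    LipschitzWith (‖J‖₊ * Real.toNNReal C) fun z => -J (g l z) := by
  have hd : ∀ z, HasFDerivAt (fun z => -J (g l z)) (-(J.comp (g' l z))) z := fun z =>
    (J.hasFDerivAt.comp z (hH.hasFDerivAt_grad l z)).neg
  refine lipschitzWith_of_nnnorm_fderiv_le (fun z => (hd z).differentiableAt) fun z => ?_
  rw [(hd z).fderiv, nnnorm_neg]
  refine (ContinuousLinearMap.opNNNorm_comp_le _ _).trans ?_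
  gcongr
  rw [← NNReal.coe_le_coe, Real.coe_toNNReal _ ((norm_nonneg _).trans (hH.norm_grad_le l 0))]
  exact hH.norm_hess_le l z

theorem inner_self_apply_eq_zero (hJ : ∀ x y, inner ℝ (J x) y = -inner ℝ x (J y)) (x : E) :
    inner ℝ (J x) x = 0 := by
  have h1 := hJ x x
  rw [real_inner_comm] at h1
  have h2 := real_inner_comm (J x) x
  linarith

namespace IsHamiltonianFlow

theorem eq_of_hasDerivAt (hφ : IsHamiltonianFlow J H g g' φ φ' act)
    (hH : IsHamiltonianFamily H g g' C R) {l : Λ} {x : ℝ → E}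
    (hx : ∀ t, HasDerivAt x (-J (g l (x t))) t) (t : ℝ) : x t = φ l t (x 0) := by
  have := ODE_solution_unique_univ (v := fun _ z => -J (g l z)) (s := fun _ => univ) (t₀ := 0)
    (K := ‖J‖₊ * Real.toNNReal C)
    (fun _ => (hH.lipschitzWith l).lipschitzOnWith) (fun t => ⟨hx t, mem_univ _⟩)
    (fun t => ⟨hφ.hasDerivAt l (x 0) t, mem_univ _⟩) (by rw [hφ.zero])
  exact congrFun this t

theorem add (hφ : IsHamiltonianFlow J H g g' φ φ' act)
    (hH : IsHamiltonianFamily H g g' C R) (l : Λ) (t s : ℝ) (z : E) :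
    φ l (t + s) z = φ l t (φ l s z) := by
  have := hφ.eq_of_hasDerivAt hH (x := fun t => φ l (t + s) z)
    (fun t => (hφ.hasDerivAt l z (t + s)).comp_add_const t s) t
  simpa using this

theorem energy_eq (hφ : IsHamiltonianFlow J H g g' φ φ' act)
    (hH : IsHamiltonianFamily H g g' C R) (hJ : ∀ x y, inner ℝ (J x) y = -inner ℝ x (J y))
    (l : Λ) (t : ℝ) (z : E) : H l (φ l t z) = H l z := by
  have hd : ∀ t, HasDerivAt (fun t => H l (φ l t z)) 0 t := fun t => by
    refine ((hH.hasFDerivAt l _).comp_hasDerivAt t (hφ.hasDerivAt l z t)).congr_deriv ?_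
    rw [innerSL_apply_apply, inner_neg_right, real_inner_comm, inner_self_apply_eq_zero hJ, neg_zero]
  have := is_const_of_deriv_eq_zero (fun s => (hd s).differentiableAt)
    (fun s => (hd s).deriv) t 0
  simpa [hφ.zero] using this

theorem inner_grad_deriv (hφ : IsHamiltonianFlow J H g g' φ φ' act)
    (hH : IsHamiltonianFamily H g g' C R) (hJ : ∀ x y, inner ℝ (J x) y = -inner ℝ x (J y))
    (l : Λ) (t : ℝ) (z v : E) : inner ℝ (g l (φ l t z)) (φ' l t z v) = inner ℝ (g l z) v := by
  have h1 := (hH.hasFDerivAt l (φ l t z)).comp z (hφ.hasFDerivAt l t z)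
  have h2 : HasFDerivAt (H l ∘ φ l t) (innerSL ℝ (g l z)) z :=
    (hH.hasFDerivAt l z).congr_of_eventuallyEq
      (Eventually.of_forall fun z => hφ.energy_eq hH hJ l t z)
  exact DFunLike.congr_fun (h1.unique h2) v

/-- The derivative of a Hamiltonian flow is symplectic. -/
theorem symplectic (hφ : IsHamiltonianFlow J H g g' φ φ' act)
    (hH : IsHamiltonianFamily H g g' C R) (hJ : ∀ x y, inner ℝ (J x) y = -inner ℝ x (J y))
    (hJJ : ∀ x, J (J x) = -x) (l : Λ) (t : ℝ) (z v w : E) :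
    inner ℝ (J (φ' l t z v)) (φ' l t z w) = inner ℝ (J v) w := by
  have hd : ∀ t, HasDerivAt (fun t => inner ℝ (J (φ' l t z v)) (φ' l t z w)) 0 t := fun t => by
    have h1 : HasDerivAt (fun t => J (φ' l t z v)) (J (-J (g' l (φ l t z) (φ' l t z v)))) t :=
      J.hasFDerivAt.comp_hasDerivAt t (hφ.hasDerivAt' l z v t)
    refine (h1.inner ℝ (hφ.hasDerivAt' l z w t)).congr_deriv ?_
    rw [map_neg, hJJ, neg_neg, hH.hess_symm, inner_neg_right, hJ, hJJ, inner_neg_right]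
    ring
  have := is_const_of_deriv_eq_zero (fun s => (hd s).differentiableAt)
    (fun s => (hd s).deriv) t 0
  simpa [hφ.zero'] using this

/-- Derivative of the flow in the initial value and the time together. -/
theorem hasFDerivAt_uncurry (hφ : IsHamiltonianFlow J H g g' φ φ' act)
    (hH : IsHamiltonianFamily H g g' C R) (l : Λ) (p : E × ℝ) :
    HasFDerivAt (fun p : E × ℝ => φ l p.2 p.1)
      ((φ' l p.2 p.1).coprod
        (ContinuousLinearMap.toSpanSingleton ℝ (-J (g l (φ l p.2 p.1))))) p := by
  have hsw : Continuous fun p : E × ℝ => (l, p.2, p.1) := by fun_prop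
  have hc1 : Continuous fun p : E × ℝ => φ l p.2 p.1 := hφ.continuous.comp hsw
  have h2 : Continuous fun p : E × ℝ => ContinuousLinearMap.toSpanSingleton ℝ
      (-J (g l (φ l p.2 p.1))) :=
    (ContinuousLinearMap.toSpanSingletonCLE (𝕜 := ℝ) (E := E)).continuous.comp
      (J.continuous.comp (hH.continuous_grad.comp (continuous_const.prodMk hc1))).neg
  exact (hasStrictFDerivAt_uncurry_coprod (f := fun z t => φ l t z)
    (f₁ := fun z t => φ' l t z)
    (f₂ := fun z t => ContinuousLinearMap.toSpanSingleton ℝ (-J (g l (φ l t z))))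
    (Eventually.of_forall fun q => hφ.hasFDerivAt l q.2 q.1)
    (Eventually.of_forall fun q => (hφ.hasDerivAt l q.1 q.2).hasFDerivAt)
    (hφ.continuous'.comp hsw).continuousAt h2.continuousAt).hasFDerivAt

/-- First variation formula with free period. -/
theorem hasFDerivAt_act_uncurry (hφ : IsHamiltonianFlow J H g g' φ φ' act)
    (hH : IsHamiltonianFamily H g g' C R) (l : Λ) (p : E × ℝ) :
    HasFDerivAt (fun p : E × ℝ => act l p.2 p.1)
      (((1 / 2 : ℝ) •
        (innerSL ℝ (J p.1) - (innerSL ℝ (J (φ l p.2 p.1))).comp (φ' l p.2 p.1))).coprod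
        (ContinuousLinearMap.toSpanSingleton ℝ
          (1 / 2 * inner ℝ (φ l p.2 p.1) (g l (φ l p.2 p.1)) - H l (φ l p.2 p.1)))) p := by
  have hsw : Continuous fun p : E × ℝ => (l, p.2, p.1) := by fun_prop
  have hc1 : Continuous fun p : E × ℝ => φ l p.2 p.1 := hφ.continuous.comp hsw
  have hc2 : Continuous fun p : E × ℝ => φ' l p.2 p.1 := hφ.continuous'.comp hsw
  have hc3 : Continuous fun p : E × ℝ => g l (φ l p.2 p.1) :=
    hH.continuous_grad.comp (continuous_const.prodMk hc1)
  have hc4 : Continuous fun p : E × ℝ => H l (φ l p.2 p.1) :=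
    hH.continuous.comp (continuous_const.prodMk hc1)
  have h1 : Continuous fun p : E × ℝ => (1 / 2 : ℝ) • (innerSL ℝ (J p.1) -
      (innerSL ℝ (J (φ l p.2 p.1))).comp (φ' l p.2 p.1)) := by
    have h3 : Continuous fun p : E × ℝ => innerSL ℝ (J p.1) -
        (innerSL ℝ (J (φ l p.2 p.1))).comp (φ' l p.2 p.1) :=
      ((innerSL ℝ).continuous.comp (J.continuous.comp continuous_fst)).sub
        (((innerSL ℝ).continuous.comp (J.continuous.comp hc1)).clm_comp hc2)
    exact h3.const_smul (1 / 2 : ℝ)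
  have h2 : Continuous fun p : E × ℝ => ContinuousLinearMap.toSpanSingleton ℝ
      (1 / 2 * inner ℝ (φ l p.2 p.1) (g l (φ l p.2 p.1)) - H l (φ l p.2 p.1)) :=
    (ContinuousLinearMap.toSpanSingletonCLE (𝕜 := ℝ) (E := ℝ)).continuous.comp
      ((continuous_const.mul (hc1.inner hc3)).sub hc4)
  exact (hasStrictFDerivAt_uncurry_coprod (f := fun z t => act l t z)
    (f₁ := fun z t => (1 / 2 : ℝ) • (innerSL ℝ (J z) - (innerSL ℝ (J (φ l t z))).comp (φ' l t z)))
    (f₂ := fun z t => ContinuousLinearMap.toSpanSingleton ℝ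
      (1 / 2 * inner ℝ (φ l t z) (g l (φ l t z)) - H l (φ l t z)))
    (Eventually.of_forall fun q => hφ.hasFDerivAt_act l q.2 q.1)
    (Eventually.of_forall fun q => (hφ.hasDerivAt_act l q.1 q.2).hasFDerivAt)
    h1.continuousAt h2.continuousAt).hasFDerivAt

end IsHamiltonianFlow

/-- Linearization of the fixed-energy problem `φ_T z = z`, `H z = h` in the unknowns `(z, T)`. -/
def fixedEnergyLinearization (J : E →L[ℝ] E) (g : Λ → E → E) (φ' : Λ → ℝ → E → E →L[ℝ] E) (l : Λ)
    (p : E × ℝ) : E × ℝ →L[ℝ] E × ℝ :=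
  ((φ' l p.2 p.1 - ContinuousLinearMap.id ℝ E).coprod
    (ContinuousLinearMap.toSpanSingleton ℝ (-J (g l p.1)))).prod
    ((innerSL ℝ (g l p.1)).comp (ContinuousLinearMap.fst ℝ E ℝ))

/-- Persistence of periodic orbits of energy `h`. Let `K` be a compact manifold of pairs (initial
value, period) of `T`-periodic orbits of energy `h` of the Hamiltonian `H l₀`, and suppose that at
each point the linearized fixed-energy problem has no solutions but those tangent to `K`. Then for
`l` near `l₀` the Hamiltonian `H l` has a periodic orbit of energy `h` near `K`. -/
theorem eventually_exists_periodic_near_manifold [FiniteDimensional ℝ E]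
    (hφ : IsHamiltonianFlow J H g g' φ φ' act)
    (hH : IsHamiltonianFamily H g g' C R) (hJ : ∀ x y, inner ℝ (J x) y = -inner ℝ x (J y))
    (hJJ : ∀ x, J (J x) = -x) {l₀ : Λ} {h : ℝ} {m : ℕ} {K : Set (E × ℝ)} (hK : IsCompact K)
    (hKne : K.Nonempty) (hper : ∀ p ∈ K, φ l₀ p.2 p.1 = p.1) (hen : ∀ p ∈ K, H l₀ p.1 = h)
    (hdim : ∀ p ∈ K, Module.finrank ℝ (fixedEnergyLinearization J g φ' l₀ p).ker ≤ m)
    (hpar : ∀ p ∈ K, ∃ (ι : EuclideanSpace ℝ (Fin m) → E × ℝ)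
      (ι' : EuclideanSpace ℝ (Fin m) →L[ℝ] E × ℝ)
      (u₀ : EuclideanSpace ℝ (Fin m)), HasStrictFDerivAt ι ι' u₀ ∧ Function.Injective ι' ∧
      ι u₀ = p ∧ ∀ᶠ u in 𝓝 u₀, ι u ∈ K)
    {W : Set (E × ℝ)} (hW : W ∈ 𝓝ˢ K) :
    ∀ᶠ l in 𝓝 l₀, ∃ p ∈ W, φ l p.2 p.1 = p.1 ∧ H l p.1 = h := by
  let e : WithLp 2 (E × ℝ) ≃L[ℝ] E × ℝ := WithLp.prodContinuousLinearEquiv 2 ℝ E ℝ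
  have hinner : ∀ x y : WithLp 2 (E × ℝ),
      inner ℝ x y = inner ℝ (e x).1 (e y).1 + (e x).2 * (e y).2 := fun x y => by
    rw [WithLp.prod_inner_apply, mul_comm]; rfl
  let f : Λ → E × ℝ → E × ℝ := fun l p => (-J (φ l p.2 p.1 - p.1), h - H l p.1)
  let ψ' : Λ → E × ℝ → E × ℝ →L[ℝ] E := fun l p =>
    (φ' l p.2 p.1).coprod (ContinuousLinearMap.toSpanSingleton ℝ (-J (g l (φ l p.2 p.1))))
  let f' : Λ → E × ℝ → E × ℝ →L[ℝ] E × ℝ := fun l p =>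
    (-(J.comp (ψ' l p - ContinuousLinearMap.fst ℝ E ℝ))).prod
      (-((innerSL ℝ (g l p.1)).comp (ContinuousLinearMap.fst ℝ E ℝ)))
  -- where the orbit closes up, `L` is the identity on the kernel of `f'`
  let L : Λ → E × ℝ → E × ℝ →L[ℝ] E × ℝ := fun l p =>
    ((1 / 2 : ℝ) • (ψ' l p + ContinuousLinearMap.fst ℝ E ℝ)).prod (ContinuousLinearMap.snd ℝ E ℝ)
  let a : Λ → E × ℝ → ℝ := fun l p =>
    act l p.2 p.1 + h * p.2 - 1 / 2 * inner ℝ (J (φ l p.2 p.1)) p.1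
  have hψ : ∀ l p, HasFDerivAt (fun p : E × ℝ => φ l p.2 p.1) (ψ' l p) p := fun l p =>
    hφ.hasFDerivAt_uncurry hH l p
  have hf : ∀ l p, HasFDerivAt (f l) (f' l p) p := by
    intro l p
    have h1 : HasFDerivAt (fun p : E × ℝ => -J (φ l p.2 p.1 - p.1))
        (-(J.comp (ψ' l p - ContinuousLinearMap.fst ℝ E ℝ))) p :=
      (J.hasFDerivAt.comp p ((hψ l p).sub hasFDerivAt_fst)).neg
    have h2 : HasFDerivAt (fun p : E × ℝ => h - H l p.1)
        (-((innerSL ℝ (g l p.1)).comp (ContinuousLinearMap.fst ℝ E ℝ))) p :=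
      ((hH.hasFDerivAt l p.1).comp p hasFDerivAt_fst).const_sub h
    exact h1.prodMk h2
  -- the first variation of the action of the closed-up orbit
  have ha : ∀ l p, HasFDerivAt (a l) (((innerSL ℝ (f l p).1).comp
      ((ContinuousLinearMap.fst ℝ E ℝ).comp (L l p))) + (f l p).2 • (ContinuousLinearMap.snd ℝ E ℝ))
      p := by
    intro l p
    have h1 := hφ.hasFDerivAt_act_uncurry hH l p
    have h2 : HasFDerivAt (fun p : E × ℝ => h * p.2) (h • ContinuousLinearMap.snd ℝ E ℝ) p :=
      hasFDerivAt_snd.const_mul h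
    have h3 : HasFDerivAt (fun p : E × ℝ => J (φ l p.2 p.1)) (J.comp (ψ' l p)) p :=
      J.hasFDerivAt.comp p (hψ l p)
    have h4 := (h3.inner ℝ (hasFDerivAt_fst (p := p))).const_mul (1 / 2)
    refine ((h1.add h2).sub h4).congr_fderiv ?_
    ext1 <;> ext1
    · rename_i v
      simp [f, L, ψ', hJ]
      have h5 : inner ℝ (φ' l p.2 p.1 v) (J p.1) = -inner ℝ p.1 (J (φ' l p.2 p.1 v)) := by
        rw [real_inner_comm, hJ]
      rw [h5]
      ring
    · simp [f, L, ψ', hJ, hJJ, hφ.energy_eq hH hJ]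
      rw [real_inner_comm p.1]
      ring
  have hfst : Continuous fun p : Λ × E × ℝ => (p.1, p.2.1) := by fun_prop
  have hsw : Continuous fun p : Λ × E × ℝ => (p.1, p.2.2, p.2.1) := by fun_prop
  have hφc : Continuous fun p : Λ × E × ℝ => φ p.1 p.2.2 p.2.1 := hφ.continuous.comp hsw
  have hφ'c : Continuous fun p : Λ × E × ℝ => φ' p.1 p.2.2 p.2.1 := hφ.continuous'.comp hsw
  have hgc : Continuous fun p : Λ × E × ℝ => g p.1 p.2.1 := hH.continuous_grad.comp hfst
  have hgφc : Continuous fun p : Λ × E × ℝ => g p.1 (φ p.1 p.2.2 p.2.1) :=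
    hH.continuous_grad.comp (continuous_fst.prodMk hφc)
  have hψc : Continuous fun p : Λ × E × ℝ => ψ' p.1 p.2 := by
    have h1 : Continuous fun p : Λ × E × ℝ => ContinuousLinearMap.toSpanSingleton ℝ
        (-J (g p.1 (φ p.1 p.2.2 p.2.1))) :=
      (ContinuousLinearMap.toSpanSingletonCLE (𝕜 := ℝ) (E := E)).continuous.comp
        (J.continuous.comp hgφc).neg
    have h2 : ∀ p : Λ × E × ℝ, ψ' p.1 p.2 =
        (φ' p.1 p.2.2 p.2.1).comp (ContinuousLinearMap.fst ℝ E ℝ) +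
        (ContinuousLinearMap.toSpanSingleton ℝ (-J (g p.1 (φ p.1 p.2.2 p.2.1)))).comp
          (ContinuousLinearMap.snd ℝ E ℝ) := fun p => by
      ext <;> simp [ψ']
    simp only [h2]
    exact (hφ'c.clm_comp continuous_const).add (h1.clm_comp continuous_const)
  have hprod : Continuous fun q : (E × ℝ →L[ℝ] E) × (E × ℝ →L[ℝ] ℝ) => q.1.prod q.2 :=
    (ContinuousLinearMap.prodₗᵢ (𝕜 := ℝ) ℝ).continuous
  have hf'c : Continuous fun p : Λ × E × ℝ => f' p.1 p.2 :=
    hprod.comp ((continuous_const.clm_comp (hψc.sub continuous_const)).neg.prodMk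
      (((innerSL ℝ).continuous.comp hgc).clm_comp continuous_const).neg)
  have hLc : Continuous fun p : Λ × E × ℝ => L p.1 p.2 := by
    have h1 : Continuous fun p : Λ × E × ℝ => ψ' p.1 p.2 + ContinuousLinearMap.fst ℝ E ℝ :=
      hψc.add continuous_const
    exact hprod.comp ((h1.const_smul (1 / 2 : ℝ)).prodMk continuous_const)
  have hfc : Continuous fun p : Λ × E × ℝ => f p.1 p.2 :=
    (J.continuous.comp (hφc.sub (continuous_fst.comp continuous_snd))).neg.prodMk
      (continuous_const.sub (hH.continuous.comp hfst))
  have he : Continuous fun p : Λ × WithLp 2 (E × ℝ) => (p.1, e p.2) :=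
    continuous_fst.prodMk (e.continuous.comp continuous_snd)
  -- the kernel of the linearization
  have hker : ∀ p ∈ K, ∀ v, f' l₀ p v = 0 ↔ fixedEnergyLinearization J g φ' l₀ p v = 0 := by
    intro p hp v
    have hJinj : ∀ x, J x = 0 ↔ x = 0 := fun x =>
      ⟨fun hx => by have := hJJ x; rw [hx, map_zero] at this; exact neg_eq_zero.1 this.symm,
        fun hx => by rw [hx, map_zero]⟩
    have h1 : (f' l₀ p v).1 = -J (φ' l₀ p.2 p.1 v.1 - v.1 + v.2 • -J (g l₀ p.1)) := by
      simp only [f', ψ', hper p hp, ContinuousLinearMap.prod_apply, neg_apply,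
        ContinuousLinearMap.comp_apply, sub_apply, ContinuousLinearMap.coprod_apply,
        ContinuousLinearMap.toSpanSingleton_apply, ContinuousLinearMap.coe_fst']
      congr 2
      abel
    have h2 : (f' l₀ p v).2 = -inner ℝ (g l₀ p.1) v.1 := by
      simp [f']
    have h3 : fixedEnergyLinearization J g φ' l₀ p v =
        (φ' l₀ p.2 p.1 v.1 - v.1 + v.2 • -J (g l₀ p.1), inner ℝ (g l₀ p.1) v.1) := by
      simp [fixedEnergyLinearization]
    rw [h3, Prod.ext_iff, h1, h2, Prod.ext_iff]
    simp only [Prod.fst_zero, Prod.snd_zero, neg_eq_zero, hJinj]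
  have hkerE : ∀ p ∈ K, ∀ v, f' l₀ p v = 0 →
      φ' l₀ p.2 p.1 v.1 = v.1 + v.2 • J (g l₀ p.1) ∧ inner ℝ (g l₀ p.1) v.1 = 0 := by
    intro p hp v hv
    have h1 := (hker p hp v).1 hv
    simp only [fixedEnergyLinearization, ContinuousLinearMap.prod_apply,
      ContinuousLinearMap.coprod_apply, sub_apply, ContinuousLinearMap.id_apply,
      ContinuousLinearMap.toSpanSingleton_apply, ContinuousLinearMap.comp_apply,
      ContinuousLinearMap.coe_fst', innerSL_apply_apply, Prod.mk_eq_zero, smul_neg] at h1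
    refine ⟨?_, h1.2⟩
    rw [← sub_eq_zero, ← h1.1]
    abel
  have key := eventually_exists_zero_near_manifold (l₀ := l₀) (m := m) (K := e.symm '' K)
    (F := fun l y => e.symm (f l (e y)))
    (F' := fun l y => (e.symm : E × ℝ →L[ℝ] WithLp 2 (E × ℝ)).comp ((f' l (e y)).comp
      (e : WithLp 2 (E × ℝ) →L[ℝ] E × ℝ)))
    (α := fun l y => a l (e y))
    (L := fun l y => (e.symm : E × ℝ →L[ℝ] WithLp 2 (E × ℝ)).comp ((L l (e y)).comp
      (e : WithLp 2 (E × ℝ) →L[ℝ] E × ℝ)))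
    (W := e ⁻¹' W) (hK.image e.symm.continuous) (hKne.image _)
    (fun l y => e.symm.hasFDerivAt.comp y ((hf l (e y)).comp y e.hasFDerivAt))
    (e.symm.continuous.comp (hfc.comp he))
    (continuous_const.clm_comp ((hf'c.comp he).clm_comp continuous_const))
    (fun l y => ?_)
    (continuous_const.clm_comp ((hLc.comp he).clm_comp continuous_const))
    ?_ ?_ ?_ ?_ ?_ ?_
  · filter_upwards [key] with l ⟨y, hy, hy0⟩
    have h1 : f l (e y) = 0 := e.symm.map_eq_zero_iff.1 hy0
    rw [Prod.ext_iff] at h1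
    refine ⟨e y, hy, ?_, (sub_eq_zero.1 h1.2).symm⟩
    have h2 : J (φ l (e y).2 (e y).1 - (e y).1) = 0 := neg_eq_zero.1 h1.1
    have h3 := hJJ (φ l (e y).2 (e y).1 - (e y).1)
    rw [h2, map_zero] at h3
    exact sub_eq_zero.1 (neg_eq_zero.1 h3.symm)
  · refine ((ha l (e y)).comp y e.hasFDerivAt).congr_fderiv ?_
    ext v
    simp [hinner, L, inner_add_right, inner_smul_right]
  · rintro _ ⟨p, hp, rfl⟩
    simp [f, hper p hp, hen p hp]
  · rintro _ ⟨p, hp, rfl⟩ τ hτ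
    have h1 : f' l₀ p (e τ) = 0 := by
      have := e.symm.map_eq_zero_iff.1 hτ
      simpa using this
    obtain ⟨h2, -⟩ := hkerE p hp _ h1
    have h3 : L l₀ p (e τ) = e τ := by
      refine Prod.ext ?_ rfl
      simp only [L, ψ', hper p hp, ContinuousLinearMap.prod_apply, smul_apply, add_apply,
        ContinuousLinearMap.coprod_apply, ContinuousLinearMap.toSpanSingleton_apply, h2,
        ContinuousLinearMap.coe_fst', smul_neg]
      module
    simp [h3]
  · rintro _ ⟨p, hp, rfl⟩ v τ hτ
    have h1 : f' l₀ p (e τ) = 0 := by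
      have := e.symm.map_eq_zero_iff.1 hτ
      simpa using this
    obtain ⟨h2, h3⟩ := hkerE p hp _ h1
    rw [hinner]
    simp only [ContinuousLinearMap.comp_apply, ContinuousLinearEquiv.coe_coe,
      ContinuousLinearEquiv.apply_symm_apply]
    set ζ := (e τ).1
    set η := (e v).1
    set P := φ' l₀ p.2 p.1
    have e1 : (f' l₀ p (e v)).1 = -J (P η - η + (e v).2 • -J (g l₀ p.1)) := by
      simp only [f', ψ', hper p hp, ContinuousLinearMap.prod_apply, neg_apply,
        ContinuousLinearMap.comp_apply, sub_apply, ContinuousLinearMap.coprod_apply,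
        ContinuousLinearMap.toSpanSingleton_apply, ContinuousLinearMap.coe_fst']
      congr 2
      abel
    have e2 : (f' l₀ p (e v)).2 = -inner ℝ (g l₀ p.1) η := by
      simp [f', η]
    have e3 := hφ.symplectic hH hJ hJJ l₀ p.2 p.1 η ζ
    rw [h2] at e3
    have e4 := hφ.inner_grad_deriv hH hJ l₀ p.2 p.1 η
    rw [hper p hp] at e4
    rw [e1, e2]
    simp only [map_add, map_sub, map_smul, map_neg, hJJ, inner_add_left, inner_sub_left,
      inner_neg_left, inner_smul_left, inner_add_right, inner_smul_right, smul_neg] at e3 ⊢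
    have e5 : inner ℝ (J (φ' l₀ p.2 p.1 η)) (J (g l₀ p.1)) = inner ℝ (g l₀ p.1) η := by
      rw [hJ, hJJ, inner_neg_right, neg_neg, real_inner_comm]
      exact e4
    rw [e5] at e3
    simp only [P, h3] at e3 ⊢
    simp
    linarith
  · rintro _ ⟨p, hp, rfl⟩
    refine le_trans ?_ (hdim p hp)
    have h1 : ∀ y : LinearMap.ker ((e.symm : E × ℝ →L[ℝ] WithLp 2 (E × ℝ)).comp ((f' l₀
        (e (e.symm p))).comp (e : WithLp 2 (E × ℝ) →L[ℝ] E × ℝ))).toLinearMap,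
        ((e : WithLp 2 (E × ℝ) →L[ℝ] E × ℝ).toLinearMap.comp (Submodule.subtype _)) y ∈
        (fixedEnergyLinearization J g φ' l₀ p).ker := by
      rintro ⟨y, hy⟩
      have h2 := e.symm.map_eq_zero_iff.1 (LinearMap.mem_ker.1 hy)
      refine (hker p hp (e y)).1 ?_
      simpa using h2
    refine LinearMap.finrank_le_finrank_of_injective (f := LinearMap.codRestrict _ _ h1) ?_
    intro y₁ y₂ hy
    exact Subtype.ext (e.injective (congrArg Subtype.val hy))
  · rintro _ ⟨p, hp, rfl⟩
    obtain ⟨ι, ι', u₀, h1, h2, rfl, h3⟩ := hpar p hp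
    refine ⟨fun u => e.symm (ι u), (e.symm : E × ℝ →L[ℝ] WithLp 2 (E × ℝ)).comp ι', u₀,
      e.symm.hasStrictFDerivAt.comp u₀ h1, e.symm.injective.comp h2, rfl, ?_⟩
    filter_upwards [h3] with u hu
    exact ⟨_, hu, rfl⟩
  · obtain ⟨O, hO, hKO, hOW⟩ := mem_nhdsSet_iff_exists.1 hW
    refine mem_nhdsSet_iff_exists.2 ⟨e ⁻¹' O, hO.preimage e.continuous, ?_, preimage_mono hOW⟩
    rintro _ ⟨p, hp, rfl⟩
    simpa using hKO hp

end HamiltonianFlowProperties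

/-! ### Families of `C²` functions depending on a parameter -/

section Families

open Set Filter Function

variable {Λ : Type*} [TopologicalSpace Λ]
  {E : Type*} [NormedAddCommGroup E] [NormedSpace ℝ E]
  {F : Type*} [NormedAddCommGroup F] [NormedSpace ℝ F]
  {F₁ : Type*} [NormedAddCommGroup F₁] [NormedSpace ℝ F₁]
  {F₂ : Type*} [NormedAddCommGroup F₂] [NormedSpace ℝ F₂]

/-- `u l` is differentiable with derivative `u' l` at the points `z` with `(l, z) ∈ O`, and both
`u` and `u'` are jointly continuous on `O`. -/
structure IsC1FamilyOn (O : Set (Λ × E)) (u : Λ → E → F) (u' : Λ → E → E →L[ℝ] F) : Prop where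
  hasFDerivAt : ∀ p ∈ O, HasFDerivAt (u p.1) (u' p.1 p.2) p.2
  continuousOn : ContinuousOn (fun p : Λ × E => u p.1 p.2) O
  continuousOn' : ContinuousOn (fun p : Λ × E => u' p.1 p.2) O

/-- `u l` is twice differentiable at the points `z` with `(l, z) ∈ O`, and `u` and its first two
derivatives in `z` are jointly continuous on `O`. -/
def IsC2FamilyOn (O : Set (Λ × E)) (u : Λ → E → F) : Prop :=
  ∃ u' u'', IsC1FamilyOn O u u' ∧ IsC1FamilyOn O u' u''

variable {O : Set (Λ × E)}

theorem IsC1FamilyOn.prodMk {u₁ : Λ → E → F₁} {u₁'} {u₂ : Λ → E → F₂} {u₂'}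
    (h₁ : IsC1FamilyOn O u₁ u₁') (h₂ : IsC1FamilyOn O u₂ u₂') :
    IsC1FamilyOn O (fun l z => (u₁ l z, u₂ l z)) (fun l z => (u₁' l z).prod (u₂' l z)) where
  hasFDerivAt p hp := (h₁.hasFDerivAt p hp).prodMk (h₂.hasFDerivAt p hp)
  continuousOn := h₁.continuousOn.prodMk h₂.continuousOn
  continuousOn' := (ContinuousLinearMap.prodₗᵢ (𝕜 := ℝ) ℝ).continuous.comp_continuousOn
    (h₁.continuousOn'.prodMk h₂.continuousOn')

theorem IsC1FamilyOn.contDiffOn_comp {u : Λ → E → F} {u'} (h : IsC1FamilyOn O u u') {c : F → F₁}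
    {S : Set F} (hS : IsOpen S) (hc : ContDiffOn ℝ 1 c S) (hu : ∀ p ∈ O, u p.1 p.2 ∈ S) :
    IsC1FamilyOn O (fun l z => c (u l z)) (fun l z => (fderiv ℝ c (u l z)).comp (u' l z)) where
  hasFDerivAt p hp := by
    have h1 : DifferentiableAt ℝ c (u p.1 p.2) :=
      (hc.contDiffAt (hS.mem_nhds (hu p hp))).differentiableAt one_ne_zero
    exact h1.hasFDerivAt.comp p.2 (h.hasFDerivAt p hp)
  continuousOn := hc.continuousOn.comp h.continuousOn hu
  continuousOn' := ((hc.continuousOn_fderiv_of_isOpen hS le_rfl).comp h.continuousOn hu).clm_comp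
    h.continuousOn'

theorem IsC1FamilyOn.contDiff_comp {u : Λ → E → F} {u'} (h : IsC1FamilyOn O u u') {c : F → F₁}
    (hc : ContDiff ℝ 1 c) :
    IsC1FamilyOn O (fun l z => c (u l z)) (fun l z => (fderiv ℝ c (u l z)).comp (u' l z)) :=
  h.contDiffOn_comp isOpen_univ hc.contDiffOn fun _ _ => mem_univ _

theorem isC1FamilyOn_const (O : Set (Λ × E)) {c : E → F} (hc : ContDiff ℝ 1 c) :
    IsC1FamilyOn O (fun _ => c) (fun _ => fderiv ℝ c) where
  hasFDerivAt p _ := (hc.differentiable one_ne_zero p.2).hasFDerivAt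
  continuousOn := (hc.continuous.comp continuous_snd).continuousOn
  continuousOn' := ((hc.continuous_fderiv one_ne_zero).comp continuous_snd).continuousOn

theorem IsC1FamilyOn.clm_comp {u : Λ → E → F₁ →L[ℝ] F₂} {u'} {v : Λ → E → F →L[ℝ] F₁} {v'}
    (hu : IsC1FamilyOn O u u') (hv : IsC1FamilyOn O v v') :
    ∃ w', IsC1FamilyOn O (fun l z => (u l z).comp (v l z)) w' :=
  ⟨_, (hu.prodMk hv).contDiff_comp isBoundedBilinearMap_comp.contDiff⟩

theorem IsC1FamilyOn.mono {u : Λ → E → F} {u'} (h : IsC1FamilyOn O u u') {O' : Set (Λ × E)}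
    (hO : O' ⊆ O) : IsC1FamilyOn O' u u' :=
  ⟨fun p hp => h.hasFDerivAt p (hO hp), h.continuousOn.mono hO, h.continuousOn'.mono hO⟩

theorem IsC2FamilyOn.mono {u : Λ → E → F} (h : IsC2FamilyOn O u) {O' : Set (Λ × E)}
    (hO : O' ⊆ O) : IsC2FamilyOn O' u := by
  obtain ⟨u', u'', h1, h2⟩ := h
  exact ⟨u', u'', h1.mono hO, h2.mono hO⟩

theorem IsC2FamilyOn.prodMk {u₁ : Λ → E → F₁} {u₂ : Λ → E → F₂}
    (h₁ : IsC2FamilyOn O u₁) (h₂ : IsC2FamilyOn O u₂) :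
    IsC2FamilyOn O (fun l z => (u₁ l z, u₂ l z)) := by
  obtain ⟨u₁', u₁'', h1, h2⟩ := h₁
  obtain ⟨u₂', u₂'', h3, h4⟩ := h₂
  let e : (E →L[ℝ] F₁) × (E →L[ℝ] F₂) ≃ₗᵢ[ℝ] E →L[ℝ] F₁ × F₂ := ContinuousLinearMap.prodₗᵢ ℝ
  exact ⟨_, _, h1.prodMk h3, (h2.prodMk h4).contDiff_comp (c := e) e.contDiff⟩

theorem IsC2FamilyOn.contDiffOn_comp {u : Λ → E → F} (h : IsC2FamilyOn O u) {c : F → F₁}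
    {S : Set F} (hS : IsOpen S) (hc : ContDiffOn ℝ 2 c S) (hu : ∀ p ∈ O, u p.1 p.2 ∈ S) :
    IsC2FamilyOn O (fun l z => c (u l z)) := by
  obtain ⟨u', u'', h1, h2⟩ := h
  have h3 := h1.contDiffOn_comp hS (hc.of_le one_le_two) hu
  have h4 := h1.contDiffOn_comp hS (hc.fderiv_of_isOpen hS (m := 1) (by norm_num)) hu
  obtain ⟨w', hw⟩ := h4.clm_comp h2
  exact ⟨_, w', h3, hw⟩

theorem isC2FamilyOn_const (O : Set (Λ × E)) {c : E → F} (hc : ContDiff ℝ 2 c) :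
    IsC2FamilyOn O (fun _ => c) :=
  ⟨_, _, isC1FamilyOn_const O (hc.of_le one_le_two),
    isC1FamilyOn_const O (hc.fderiv_right (m := 1) (by norm_num))⟩

theorem IsC1FamilyOn.comp_clm {u : Λ → E → F} {u'} (h : IsC1FamilyOn O u u') (L : F₁ →L[ℝ] E) :
    IsC1FamilyOn {p : Λ × F₁ | (p.1, L p.2) ∈ O} (fun l z => u l (L z))
      (fun l z => (u' l (L z)).comp L) where
  hasFDerivAt p hp := (h.hasFDerivAt (p.1, L p.2) hp).comp p.2 L.hasFDerivAt
  continuousOn := h.continuousOn.comp (f := fun p : Λ × F₁ => (p.1, L p.2))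
    (by fun_prop) fun _ hp => hp
  continuousOn' := (h.continuousOn'.comp (f := fun p : Λ × F₁ => (p.1, L p.2))
    (by fun_prop) fun _ hp => hp).clm_comp continuousOn_const

theorem IsC2FamilyOn.comp_clm {u : Λ → E → F} (h : IsC2FamilyOn O u) (L : F₁ →L[ℝ] E) :
    IsC2FamilyOn {p : Λ × F₁ | (p.1, L p.2) ∈ O} (fun l z => u l (L z)) := by
  obtain ⟨u', u'', h1, h2⟩ := h
  obtain ⟨w', hw⟩ := (h2.comp_clm L).clm_comp (isC1FamilyOn_const _ (contDiff_const (c := L)))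
  exact ⟨_, w', h1.comp_clm L, hw⟩

theorem IsC2FamilyOn.comp_param {Λ' : Type*} [TopologicalSpace Λ'] {u : Λ → E → F}
    (h : IsC2FamilyOn O u) {k : Λ' → Λ} (hk : Continuous k) :
    IsC2FamilyOn {p : Λ' × E | (k p.1, p.2) ∈ O} (fun l => u (k l)) := by
  obtain ⟨u', u'', h1, h2⟩ := h
  have hc : ContinuousOn (fun p : Λ' × E => (k p.1, p.2)) {p : Λ' × E | (k p.1, p.2) ∈ O} := by
    fun_prop
  exact ⟨fun l => u' (k l), fun l => u'' (k l),
    ⟨fun p hp => h1.hasFDerivAt (k p.1, p.2) hp, h1.continuousOn.comp hc fun _ hp => hp,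
      h1.continuousOn'.comp hc fun _ hp => hp⟩,
    ⟨fun p hp => h2.hasFDerivAt (k p.1, p.2) hp, h2.continuousOn.comp hc fun _ hp => hp,
      h2.continuousOn'.comp hc fun _ hp => hp⟩⟩

theorem IsC2FamilyOn.contDiffOn_slice {u : Λ → E → F} (h : IsC2FamilyOn O u) (hO : IsOpen O)
    (l : Λ) : ContDiffOn ℝ 2 (u l) {z | (l, z) ∈ O} := by
  obtain ⟨u', u'', h1, h2⟩ := h
  have hOl : IsOpen {z | (l, z) ∈ O} := hO.preimage (by fun_prop)
  have hfd : ∀ z ∈ {z | (l, z) ∈ O}, fderiv ℝ (u l) z = u' l z := fun z hz =>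
    (h1.hasFDerivAt (l, z) hz).fderiv
  have e2 : (2 : WithTop ℕ∞) = 1 + 1 := by norm_num
  rw [e2, contDiffOn_succ_iff_fderiv_of_isOpen hOl]
  refine ⟨fun z hz => (h1.hasFDerivAt (l, z) hz).differentiableAt.differentiableWithinAt,
    by simp, ?_⟩
  refine ContDiffOn.congr ?_ hfd
  have e1 : (1 : WithTop ℕ∞) = 0 + 1 := by norm_num
  rw [e1, contDiffOn_succ_iff_fderiv_of_isOpen hOl]
  refine ⟨fun z hz => (h2.hasFDerivAt (l, z) hz).differentiableAt.differentiableWithinAt,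
    by simp, contDiffOn_zero.2 ?_⟩
  refine ContinuousOn.congr (f := u'' l) ?_ fun z hz => (h2.hasFDerivAt (l, z) hz).fderiv
  exact h2.continuousOn'.comp (f := fun z => (l, z)) (by fun_prop) fun _ hz => hz

end Families

/-! ### Cutoff of Hamiltonians -/

section Cutoff

open Set Filter Function InnerProductSpace

variable {Λ : Type*} [TopologicalSpace Λ]

theorem exists_bound_of_eq_zero_off_compact {E : Type*} [TopologicalSpace E] {F : Type*}
    [NormedAddCommGroup F] [CompactSpace Λ] {S : Set E} (hS : IsCompact S) {g : Λ → E → F} (hg : Continuous fun p : Λ × E => g p.1 p.2)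
    (h0 : ∀ l, ∀ z ∉ S, g l z = 0) : ∃ C, ∀ l z, ‖g l z‖ ≤ C := by
  obtain ⟨C, hC⟩ := (isCompact_univ (X := Λ).prod hS).exists_bound_of_continuousOn hg.continuousOn
  refine ⟨max C 0, fun l z => ?_⟩
  by_cases hz : z ∈ S
  · exact (hC (l, z) ⟨mem_univ _, hz⟩).trans (le_max_left _ _)
  · rw [h0 l z hz, norm_zero]; exact le_max_right _ _

theorem continuous_of_continuousOn_of_eq_zero {E F : Type*} [TopologicalSpace E]
    [NormedAddCommGroup F] {O : Set (Λ × E)} {χ : E → ℝ} (hO : IsOpen O)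
    (hχO : univ ×ˢ tsupport χ ⊆ O) (w w₁ : Λ → E → F)
    (hw₁ : ContinuousOn (fun p : Λ × E => w₁ p.1 p.2) O) (hw : ∀ p ∈ O, w p.1 p.2 = w₁ p.1 p.2)
    (hw0 : ∀ l, ∀ z ∉ tsupport χ, w l z = 0) : Continuous fun p : Λ × E => w p.1 p.2 := by
  refine continuous_iff_continuousAt.2 fun p => ?_
  by_cases hp : p.2 ∈ tsupport χ
  · have hpO : p ∈ O := hχO ⟨mem_univ _, hp⟩
    exact (hw₁.continuousAt (hO.mem_nhds hpO)).congr
      (Filter.mem_of_superset (hO.mem_nhds hpO) fun q hq => (hw q hq).symm)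
  · have : (fun p : Λ × E => w p.1 p.2) =ᶠ[𝓝 p] fun _ => 0 :=
      Filter.mem_of_superset (((isClosed_tsupport χ).isOpen_compl.preimage
        continuous_snd).mem_nhds hp) fun q hq => hw0 _ _ hq
    exact continuousAt_const.congr this.symm

variable {E : Type*} [NormedAddCommGroup E] [InnerProductSpace ℝ E] [FiniteDimensional ℝ E]
  {O : Set (Λ × E)}

/-- Multiplication by a cutoff function turns a family of Hamiltonians of class `C²` into a
globally defined one. -/
theorem IsC2FamilyOn.isHamiltonianFamily_cutoff [CompactSpace Λ] {H : Λ → E → ℝ}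
    (hH : IsC2FamilyOn O H) (hO : IsOpen O) {χ : E → ℝ} (hχ : ContDiff ℝ 2 χ)
    (hχc : HasCompactSupport χ) (hχO : univ ×ˢ tsupport χ ⊆ O) :
    ∃ C R, 0 ≤ R ∧ IsHamiltonianFamily (fun l z => χ z * H l z)
      (fun l => gradient fun z => χ z * H l z)
      (fun l => fderiv ℝ (gradient fun z => χ z * H l z)) C R := by
  set K : Λ → E → ℝ := fun l z => χ z * H l z
  have hK : IsC2FamilyOn O K :=
    ((isC2FamilyOn_const O hχ).prodMk hH).contDiffOn_comp (c := fun p : ℝ × ℝ => p.1 * p.2)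
      isOpen_univ (contDiff_fst.mul contDiff_snd).contDiffOn fun _ _ => mem_univ _
  obtain ⟨K', K'', h1, h2⟩ := hK
  let e := (toDual ℝ E).symm.toContinuousLinearEquiv.toContinuousLinearMap
  obtain ⟨G', h3⟩ : ∃ G', IsC1FamilyOn O (fun l z => (toDual ℝ E).symm (K' l z)) G' :=
    ⟨_, h2.contDiff_comp (c := e) e.contDiff⟩
  -- on `O` the derivatives are those of the family
  have hgr : ∀ p ∈ O, gradient (K p.1) p.2 = (toDual ℝ E).symm (K' p.1 p.2) := fun p hp => by
    rw [gradient, (h1.hasFDerivAt p hp).fderiv]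
  have hOl : ∀ p ∈ O, ∀ᶠ z in 𝓝 p.2, (p.1, z) ∈ O := fun p hp =>
    (Continuous.continuousAt (by fun_prop : Continuous fun z : E => (p.1, z))).eventually
      (hO.mem_nhds hp)
  have hgrd : ∀ p ∈ O, HasFDerivAt (gradient (K p.1)) (G' p.1 p.2) p.2 := fun p hp =>
    (h3.hasFDerivAt p hp).congr_of_eventuallyEq ((hOl p hp).mono fun z hz => hgr (p.1, z) hz)
  have hgrf : ∀ p ∈ O, fderiv ℝ (gradient (K p.1)) p.2 = G' p.1 p.2 := fun p hp =>
    (hgrd p hp).fderiv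
  -- off the support of the cutoff everything vanishes
  have hopen : IsOpen (tsupport χ)ᶜ := (isClosed_tsupport χ).isOpen_compl
  have hK0 : ∀ l, ∀ z ∉ tsupport χ, K l z = 0 := fun l z hz => by
    simp only [K, image_eq_zero_of_notMem_tsupport hz, zero_mul]
  have hK0' : ∀ l, ∀ z ∉ tsupport χ, K l =ᶠ[𝓝 z] fun _ => 0 := fun l z hz =>
    Filter.mem_of_superset (hopen.mem_nhds hz) fun y hy => hK0 l y hy
  have hg0 : ∀ l, ∀ z ∉ tsupport χ, gradient (K l) z = 0 := fun l z hz => by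
    rw [gradient, (hK0' l z hz).fderiv_eq, fderiv_fun_const, Pi.zero_apply, map_zero]
  have hg0' : ∀ l, ∀ z ∉ tsupport χ, gradient (K l) =ᶠ[𝓝 z] fun _ => 0 := fun l z hz =>
    Filter.mem_of_superset (hopen.mem_nhds hz) fun y hy => hg0 l y hy
  have hh0 : ∀ l, ∀ z ∉ tsupport χ, fderiv ℝ (gradient (K l)) z = 0 := fun l z hz => by
    rw [(hg0' l z hz).fderiv_eq, fderiv_fun_const, Pi.zero_apply]
  have hc0 := continuous_of_continuousOn_of_eq_zero hO hχO K K h1.continuousOn (fun _ _ => rfl) hK0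
  have hc1 := continuous_of_continuousOn_of_eq_zero hO hχO (fun l => gradient (K l))
    (fun l z => (toDual ℝ E).symm (K' l z)) h3.continuousOn hgr hg0
  have hc2 := continuous_of_continuousOn_of_eq_zero hO hχO (fun l => fderiv ℝ (gradient (K l))) _
    h3.continuousOn' hgrf hh0
  obtain ⟨C₁, hC₁⟩ := exists_bound_of_eq_zero_off_compact hχc hc1 hg0
  obtain ⟨C₂, hC₂⟩ := exists_bound_of_eq_zero_off_compact hχc hc2 hh0
  obtain ⟨R, hR⟩ := hχc.isBounded.exists_norm_le
  refine ⟨max C₁ C₂, max R 0, le_max_right _ _, ⟨fun l z => ?_, fun l z => ?_, hc0, hc1, hc2,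
    fun l z => (hC₁ l z).trans (le_max_left _ _), fun l z => (hC₂ l z).trans (le_max_right _ _),
    fun l z hz => hh0 l z fun hz' => ?_⟩⟩
  · have hd : DifferentiableAt ℝ (K l) z := by
      by_cases hz : z ∈ tsupport χ
      · exact (h1.hasFDerivAt (l, z) (hχO ⟨mem_univ _, hz⟩)).differentiableAt
      · exact (hK0' l z hz).symm.differentiableAt_iff.1 (differentiableAt_const _)
    exact hd.hasGradientAt.hasFDerivAt
  · by_cases hz : z ∈ tsupport χ
    · exact (hgrd (l, z) (hχO ⟨mem_univ _, hz⟩)).differentiableAt.hasFDerivAt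
    · exact ((hg0' l z hz).symm.differentiableAt_iff.1 (differentiableAt_const _)).hasFDerivAt
  · exact absurd (hR z hz') (not_le.2 ((le_max_left R 0).trans_lt hz))

/-- A smooth cutoff equal to one on a neighbourhood of a compact set. -/
theorem exists_cutoff {K S : Set E} (hK : IsCompact K) (hS : IsOpen S) (hKS : K ⊆ S) :
    ∃ (χ : E → ℝ) (S' : Set E), ContDiff ℝ 2 χ ∧ HasCompactSupport χ ∧ tsupport χ ⊆ S ∧
      IsOpen S' ∧ K ⊆ S' ∧ ∀ z ∈ S', χ z = 1 := by
  obtain ⟨K₁, hK₁, hKK₁, hK₁S⟩ := exists_compact_between hK hS hKS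
  obtain ⟨K₂, hK₂, hKK₂, hK₂K₁⟩ := exists_compact_between hK isOpen_interior hKK₁
  obtain ⟨χ, h1, -, h3, h2⟩ := exists_contMDiff_support_eq_eq_one_iff
    𝓘(ℝ, E) isOpen_interior hK₂.isClosed hK₂K₁ (n := 2)
  have h4 : tsupport χ ⊆ K₁ :=
    closure_minimal (h3.trans_subset interior_subset) hK₁.isClosed
  exact ⟨χ, interior K₂, h1.contDiff, hK₁.of_isClosed_subset (isClosed_tsupport χ) h4,
    h4.trans hK₁S, isOpen_interior, hKK₂, fun z hz => (h2 z).1 (interior_subset hz)⟩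

end Cutoff

/-! ### Compact sets of orbits -/

section Orbits

open Set Filter InnerProductSpace
open scoped NNReal

/-- A curve that solves `z' = v z` coincides with a solution of `z' = v₁ z`, with `v₁` Lipschitz, as
long as the common values lie in an open set where `v = v₁`. -/
theorem eqOn_Icc_of_hasDerivAt {E : Type*} [NormedAddCommGroup E] [NormedSpace ℝ E]
    {v v₁ : E → E} {K : ℝ≥0} (hv₁ : LipschitzWith K v₁) {S : Set E} (hS : IsOpen S)
    (hv : ∀ z ∈ S, v z = v₁ z) {α y : ℝ → E} {N : ℝ} (hα : ∀ t, HasDerivAt α (v (α t)) t)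
    (hy : ∀ t, HasDerivAt y (v₁ (y t)) t) (hαS : ∀ t ∈ Icc 0 N, α t = y t → α t ∈ S)
    (h0 : α 0 = y 0) : EqOn α y (Icc 0 N) := by
  have hαc : Continuous α := continuous_iff_continuousAt.2 fun t => (hα t).continuousAt
  have hyc : Continuous y := continuous_iff_continuousAt.2 fun t => (hy t).continuousAt
  refine IsClosed.Icc_subset_of_forall_mem_nhdsWithin (s := {t | α t = y t})
    ((isClosed_eq hαc hyc).inter isClosed_Icc) h0 ?_
  rintro t ⟨ht, ht1⟩
  have h1 : ∀ᶠ s in 𝓝 t, α s ∈ S :=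
    hαc.continuousAt.eventually (hS.mem_nhds (hαS t ⟨ht1.1, ht1.2.le⟩ ht))
  refine mem_nhdsWithin_of_mem_nhds ?_
  exact ODE_solution_unique_of_eventually (v := fun _ => v₁) (s := fun _ => univ) (K := K)
    (Eventually.of_forall fun s => hv₁.lipschitzOnWith)
    (h1.mono fun s hs => ⟨hv _ hs ▸ hα s, mem_univ _⟩)
    (Eventually.of_forall fun s => ⟨hy s, mem_univ _⟩) ht

variable {E : Type*} [NormedAddCommGroup E] [InnerProductSpace ℝ E] [FiniteDimensional ℝ E]
  {J : E →L[ℝ] E}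

theorem gradient_congr {f g : E → ℝ} {z : E} (h : f =ᶠ[𝓝 z] g) : gradient f z = gradient g z := by
  rw [gradient, gradient, h.fderiv_eq]

/-- The orbits, on a fixed time interval, that issue from a compact set of initial values sweep out
a relatively compact subset of the domain of the Hamiltonian. -/
theorem exists_isCompact_orbits (hJ : ∀ x y, inner ℝ (J x) y = -inner ℝ x (J y))
    (hJJ : ∀ x, J (J x) = -x) {O : Set E} (hO : IsOpen O) {H₀ : E → ℝ}
    (hH₀ : ContDiffOn ℝ 2 H₀ O) {M : Type*} [TopologicalSpace M] [CompactSpace M] {Z : M → ℝ → E}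
    (hZ0 : Continuous fun q => Z q 0)
    (hZ : ∀ q t, HasDerivAt (Z q) (-J (gradient H₀ (Z q t))) t) (hZO : ∀ q t, Z q t ∈ O) (N : ℝ) :
    ∃ K, IsCompact K ∧ K ⊆ O ∧ ∀ q, ∀ t ∈ Icc 0 N, Z q t ∈ K := by
  have key := isCompact_univ (X := M).induction_on
    (p := fun Q => ∃ K, IsCompact K ∧ K ⊆ O ∧ ∀ q ∈ Q, ∀ t ∈ Icc 0 N, Z q t ∈ K)
    ⟨∅, isCompact_empty, empty_subset _, fun q hq => hq.elim⟩
    (fun s t hst ⟨K, h1, h2, h3⟩ => ⟨K, h1, h2, fun q hq => h3 q (hst hq)⟩)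
    (fun s t ⟨K, h1, h2, h3⟩ ⟨K', h1', h2', h3'⟩ => ⟨K ∪ K', h1.union h1', union_subset h2 h2',
      fun q hq t ht => hq.elim (fun hq => Or.inl (h3 q hq t ht)) fun hq => Or.inr (h3' q hq t ht)⟩)
    fun q₀ _ => ?_
  · simpa using key
  have hZc : Continuous (Z q₀) := continuous_iff_continuousAt.2 fun t => (hZ q₀ t).continuousAt
  obtain ⟨χ, S, hχ, hχc, hχO, hS, hCS, hχ1⟩ := exists_cutoff
    (isCompact_Icc.image hZc : IsCompact (Z q₀ '' Icc 0 N)) hO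
    (image_subset_iff.2 fun t _ => hZO _ _)
  obtain ⟨K, hK, hCK, hKS⟩ := exists_compact_between (isCompact_Icc.image hZc) hS hCS
  have hSO : S ⊆ O := fun z hz => hχO (subset_tsupport _ (by simp [hχ1 z hz]))
  have hfam : IsC2FamilyOn (univ ×ˢ O) fun _ : Unit => H₀ :=
    (isC2FamilyOn_const (univ ×ˢ O) contDiff_id).contDiffOn_comp hO hH₀ fun p hp => hp.2
  obtain ⟨C, R, hR, hH⟩ := hfam.isHamiltonianFamily_cutoff (isOpen_univ.prod hO) hχ hχc
    (prod_mono_right hχO)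
  obtain ⟨φ, φ', act, hφ⟩ := exists_hamiltonianFlow hJ hJJ hH hR
  have heq : ∀ z ∈ S, -J (gradient H₀ z) = -J (gradient (fun z => χ z * H₀ z) z) := fun z hz => by
    rw [gradient_congr (g := fun z => χ z * H₀ z)]
    filter_upwards [hS.mem_nhds hz] with y hy
    rw [hχ1 y hy, one_mul]
  have hlip := hH.lipschitzWith (J := J) ()
  have h1 : EqOn (Z q₀) (fun t => φ () t (Z q₀ 0)) (Icc 0 N) :=
    eqOn_Icc_of_hasDerivAt hlip hS heq (hZ q₀) (hφ.hasDerivAt () _)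
      (fun t ht _ => hCS ⟨t, ht, rfl⟩) (hφ.zero _ _).symm
  have h2 : ∀ᶠ q in 𝓝 q₀, ∀ t ∈ Icc 0 N, φ () t (Z q 0) ∈ interior K := by
    refine isCompact_Icc.eventually_forall_of_forall_eventually fun t ht => ?_
    have hc : Continuous fun p : M × ℝ => φ () p.2 (Z p.1 0) :=
      hφ.continuous.comp (f := fun p : M × ℝ => ((), p.2, Z p.1 0)) (by fun_prop)
    refine hc.continuousAt.eventually (isOpen_interior.mem_nhds ?_)
    exact hCK ⟨t, ht, h1 ht⟩
  refine ⟨_, mem_nhdsWithin_of_mem_nhds h2, K, hK, hKS.trans hSO, fun q hq t ht => ?_⟩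
  have h3 : EqOn (Z q) (fun t => φ () t (Z q 0)) (Icc 0 N) :=
    eqOn_Icc_of_hasDerivAt hlip hS heq (hZ q) (hφ.hasDerivAt () _)
      (fun t ht hqt => hqt ▸ hKS (interior_subset (hq t ht))) (hφ.zero _ _).symm
  rw [h3 ht]
  exact interior_subset (hq t ht)

end Orbits

/-! ### The linearized fixed-energy problem -/

section Kernel

open Set Filter InnerProductSpace
open scoped NNReal

/-- The standard symplectic matrix as a continuous linear map. -/
def symplCLM : Phase →L[ℝ] Phase :=
  let e := WithLp.prodContinuousLinearEquiv 2 ℝ R3 R3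
  (e.symm : R3 × R3 →L[ℝ] Phase).comp
    (((-ContinuousLinearMap.snd ℝ R3 R3).prod (ContinuousLinearMap.fst ℝ R3 R3)).comp
      (e : Phase →L[ℝ] R3 × R3))

theorem symplCLM_apply (z : Phase) : symplCLM z = symplJ z := rfl

theorem inner_symplCLM (x y : Phase) : inner ℝ (symplCLM x) y = -inner ℝ x (symplCLM y) := by
  rw [WithLp.prod_inner_apply, WithLp.prod_inner_apply]
  change inner ℝ (-x.snd) y.fst + inner ℝ x.fst y.snd =
    -(inner ℝ x.fst (-y.snd) + inner ℝ x.snd y.fst)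
  rw [inner_neg_left, inner_neg_right]
  ring

theorem symplCLM_symplCLM (x : Phase) : symplCLM (symplCLM x) = -x := by
  simp only [symplCLM_apply, symplJ]
  rfl

/-- Solutions of an affine linear equation with bounded coefficients are determined by their
initial value. -/
theorem eq_of_hasDerivAt_affine {E : Type*} [NormedAddCommGroup E] [NormedSpace ℝ E]
    {B : ℝ → E →L[ℝ] E} {b : ℝ → E} {K : ℝ} (hB : ∀ t, ‖B t‖ ≤ K) {w₁ w₂ : ℝ → E}
    (h₁ : ∀ t, HasDerivAt w₁ (B t (w₁ t) + b t) t) (h₂ : ∀ t, HasDerivAt w₂ (B t (w₂ t) + b t) t)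
    (h0 : w₁ 0 = w₂ 0) : w₁ = w₂ := by
  refine ODE_solution_unique_univ (v := fun t w => B t w + b t) (K := K.toNNReal)
    (s := fun _ => univ) (fun t => ?_) (fun t => ⟨h₁ t, mem_univ _⟩) (fun t => ⟨h₂ t, mem_univ _⟩) h0
  refine (LipschitzWith.of_dist_le_mul fun x y => ?_).lipschitzOnWith
  rw [dist_add_right, dist_eq_norm, dist_eq_norm, ← map_sub]
  exact ((B t).le_opNorm _).trans (mul_le_mul_of_nonneg_right
    ((hB t).trans (Real.le_coe_toNNReal K)) (norm_nonneg _))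

variable {Λ : Type*} [TopologicalSpace Λ]
  {E : Type*} [NormedAddCommGroup E] [InnerProductSpace ℝ E] {J : E →L[ℝ] E}
  {H : Λ → E → ℝ} {g : Λ → E → E} {g' : Λ → E → E →L[ℝ] E} {C R : ℝ} {φ : Λ → ℝ → E → E}
  {φ' : Λ → ℝ → E → E →L[ℝ] E} {act : Λ → ℝ → E → ℝ}

/-- The solutions of the linearized fixed-energy problem embed into the space `N` of periodic
solutions of the linearized equation with a multiplier: `(ζ, s)` goes to
`φ'_t ζ + (s / T) t z'(t)`. -/
theorem finrank_ker_fixedEnergyLinearization_le [FiniteDimensional ℝ E]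
    (hφ : IsHamiltonianFlow J H g g' φ φ' act)
    (hH : IsHamiltonianFamily H g g' C R) (hJ : ∀ x y, inner ℝ (J x) y = -inner ℝ x (J y))
    (hJJ : ∀ x, J (J x) = -x) {l : Λ} {z : ℝ → E} {z₀ : E} {T : ℝ} (hT : T ≠ 0)
    (hz : ∀ t, z t = φ l t z₀) (hper : φ l T z₀ = z₀) (hcrit : g l z₀ ≠ 0)
    {N : Submodule ℝ (ℝ → E)}
    (hN : ∀ w, w ∈ N ↔ Function.Periodic w T ∧ Differentiable ℝ w ∧
      (∃ γ : ℝ, ∀ t, J (deriv w t) = g' l (z t) (w t) + γ • g l (z t)) ∧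
      ∀ t, inner ℝ (g l (z t)) (w t) = 0) :
    Module.finrank ℝ (fixedEnergyLinearization J g φ' l (z₀, T)).ker ≤ Module.finrank ℝ N := by
  obtain rfl : z = fun t => φ l t z₀ := funext hz
  set z : ℝ → E := fun t => φ l t z₀ with hz
  set B : ℝ → E →L[ℝ] E := fun t => -(J.comp (g' l (z t))) with hBdef
  have hB : ∀ t, ‖B t‖ ≤ ‖J‖ * C := fun t => by
    rw [norm_neg]
    exact (ContinuousLinearMap.opNorm_comp_le _ _).trans
      (mul_le_mul_of_nonneg_left (hH.norm_hess_le _ _) (norm_nonneg _))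
  have hJinj : ∀ x, J x = 0 → x = 0 := fun x hx => by
    have := hJJ x
    rw [hx, map_zero] at this
    exact neg_eq_zero.1 this.symm
  -- the equation with a multiplier, solved for the derivative
  have heq : ∀ w : ℝ → E, Differentiable ℝ w → ∀ γ : ℝ,
      (∀ t, J (deriv w t) = g' l (z t) (w t) + γ • g l (z t)) →
      ∀ t, HasDerivAt w (B t (w t) + γ • -J (g l (z t))) t := by
    intro w hw γ h t
    have h2 := congrArg J (h t)
    rw [hJJ, map_add, map_smul] at h2
    have h3 : deriv w t = B t (w t) + γ • -J (g l (z t)) := by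
      rw [← neg_neg (deriv w t), h2]
      simp only [hBdef, neg_apply, ContinuousLinearMap.comp_apply]
      module
    exact h3 ▸ (hw t).hasDerivAt
  -- a solution is determined by its initial position and velocity
  let ev : N →ₗ[ℝ] E × E :=
    { toFun := fun w => (w.1 0, deriv w.1 0)
      map_add' := fun v w => by
        simp only [Submodule.coe_add, Pi.add_apply, Prod.mk_add_mk]
        rw [deriv_add (((hN _).1 v.2).2.1 0) (((hN _).1 w.2).2.1 0)]
      map_smul' := fun c w => by
        simp only [Submodule.coe_smul, Pi.smul_apply, Prod.smul_mk, RingHom.id_apply]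
        rw [deriv_const_smul c (((hN _).1 w.2).2.1 0)] }
  have hev : Function.Injective ev := by
    refine (injective_iff_map_eq_zero ev).2 fun w hw => ?_
    obtain ⟨w, hwN⟩ := w
    obtain ⟨-, hw1, ⟨γ, hw2⟩, -⟩ := (hN w).1 hwN
    have hw3 : w 0 = 0 := congrArg Prod.fst hw
    have hw4 : deriv w 0 = 0 := congrArg Prod.snd hw
    have h1 := heq w hw1 γ hw2
    have h2 := (h1 0).deriv
    rw [hw4, hw3, map_zero, zero_add] at h2
    have hz0 : z 0 = z₀ := hφ.zero l z₀
    have h3 : γ = 0 := by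
      by_contra hγ
      refine hcrit (hJinj _ ?_)
      have := (smul_eq_zero.1 h2.symm).resolve_left hγ
      rwa [neg_eq_zero, hz0] at this
    subst h3
    refine Subtype.ext (eq_of_hasDerivAt_affine hB h1 (fun t => ?_) hw3)
    simp
  -- finiteness of the dimension of `N` is needed because `finrank` vanishes in infinite dimension
  have hfin : Module.Finite ℝ N := Module.Finite.of_injective ev hev
  -- the velocity solves the linearized equation
  have hvel : ∀ t, HasDerivAt (fun t => -J (g l (z t))) (B t (-J (g l (z t)))) t := by
    intro t
    exact (J.hasFDerivAt.comp_hasDerivAt t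
      ((hH.hasFDerivAt_grad l (z t)).comp_hasDerivAt t (hφ.hasDerivAt l z₀ t))).neg
  -- the multiplier `s / T` compensates the change `s` of the period
  let sol : E × ℝ → ℝ → E := fun p t =>
    φ' l t z₀ p.1 + (p.2 / T * t) • -J (g l (z t))
  have hsol : ∀ p t, HasDerivAt (sol p) (B t (sol p t) + (p.2 / T) • -J (g l (z t))) t := by
    intro p t
    have h1 : HasDerivAt (fun t => p.2 / T * t) (p.2 / T) t := by
      simpa using (hasDerivAt_id t).const_mul (p.2 / T)
    refine ((hφ.hasDerivAt' l z₀ p.1 t).add (h1.smul (hvel t))).congr_deriv ?_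
    simp only [sol, map_add, map_smul]
    have : B t (φ' l t z₀ p.1) = -J (g' l (φ l t z₀) (φ' l t z₀ p.1)) := rfl
    rw [this]
    abel
  have hmem : ∀ p ∈ (fixedEnergyLinearization J g φ' l (z₀, T)).ker,
      sol p ∈ N := by
    intro p hp
    have hp0 := LinearMap.mem_ker.1 hp
    simp only [fixedEnergyLinearization, ContinuousLinearMap.coe_coe,
      ContinuousLinearMap.prod_apply,
      ContinuousLinearMap.coprod_apply, sub_apply, ContinuousLinearMap.id_apply,
      ContinuousLinearMap.toSpanSingleton_apply, ContinuousLinearMap.comp_apply,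
      ContinuousLinearMap.coe_fst', innerSL_apply_apply, Prod.mk_eq_zero] at hp0
    have hzper : ∀ t, z (t + T) = z t := fun t => by
      simp only [hz]
      rw [hφ.add hH, hper]
    refine (hN _).2 ⟨?_, fun t => (hsol p t).differentiableAt, ⟨p.2 / T, fun t => ?_⟩, fun t => ?_⟩
    · have h1 : (fun t => sol p (t + T)) = sol p := by
        refine eq_of_hasDerivAt_affine hB (fun t => ?_) (hsol p) ?_
        · have h2 := (hsol p (t + T)).comp_add_const t T
          simpa only [hBdef, hzper] using h2
        · have hT1 : p.2 / T * T = p.2 := div_mul_cancel₀ _ hT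
          simp only [sol, zero_add, hT1, mul_zero, zero_smul, add_zero, hφ.zero',
            ContinuousLinearMap.id_apply]
          have hzT : z T = z₀ := hper
          rw [hzT, ← sub_eq_zero, ← hp0.1]
          abel
      exact fun t => congrFun h1 t
    · rw [(hsol p t).deriv]
      simp only [hBdef, neg_apply, ContinuousLinearMap.comp_apply, map_add, map_neg, map_smul,
        hJJ, neg_neg]
    · simp only [sol, inner_add_right, inner_smul_right, inner_neg_right]
      have h1 := hφ.inner_grad_deriv hH hJ l t z₀ p.1
      have h2 : inner ℝ (g l (z t)) (J (g l (z t))) = 0 := by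
        rw [real_inner_comm]
        exact inner_self_apply_eq_zero hJ _
      rw [h2]
      simp only [hz, h1, hp0.2]
      ring
  let incl : (fixedEnergyLinearization J g φ' l (z₀, T)).ker →ₗ[ℝ]
      N :=
    { toFun := fun p => ⟨sol p.1, hmem p.1 p.2⟩
      map_add' := fun p q => by
        refine Subtype.ext (funext fun t => ?_)
        simp only [sol, Submodule.coe_add, Prod.fst_add, Prod.snd_add, map_add, Pi.add_apply]
        module
      map_smul' := fun c p => by
        refine Subtype.ext (funext fun t => ?_)
        simp only [sol, Submodule.coe_smul, Prod.smul_fst, Prod.smul_snd, map_smul, Pi.smul_apply,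
          RingHom.id_apply, smul_eq_mul]
        module }
  refine LinearMap.finrank_le_finrank_of_injective (f := incl) ?_
  refine (injective_iff_map_eq_zero incl).2 fun p hp => ?_
  have h1 : ∀ t, sol p.1 t = 0 := fun t => congrFun (congrArg Subtype.val hp) t
  have h2 : p.1.1 = 0 := by
    have := h1 0
    simpa [sol, hφ.zero'] using this
  have h3 : p.1.2 = 0 := by
    have h4 := h1 T
    simp only [sol, h2, map_zero, zero_add, div_mul_cancel₀ _ hT] at h4
    refine (smul_eq_zero.1 h4).resolve_right fun h5 => hcrit (hJinj _ ?_)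
    have hzT : z T = z₀ := hper
    rwa [neg_eq_zero, hzT] at h5
  exact Subtype.ext (Prod.ext h2 h3)

end Kernel

/-! ### Persistence of non-degenerate manifolds of periodic orbits -/

section Persistence

open Set Filter InnerProductSpace
open scoped NNReal

variable {Λ : Type*} [TopologicalSpace Λ] [LocallyCompactSpace Λ]
  {E : Type*} [NormedAddCommGroup E] [InnerProductSpace ℝ E] [FiniteDimensional ℝ E]
  {J : E →L[ℝ] E}

/-- Persistence of a compact non-degenerate manifold of periodic orbits at fixed energy, for
Hamiltonians defined on open subsets of the phase space. The manifold is given by local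
parametrizations `ι` of the set of the pairs (initial value, period), and `N q` is the space of
periodic solutions of the linearized equation with a multiplier that are tangent to the energy
level. -/
theorem eventually_exists_periodic_orbit (hJ : ∀ x y, inner ℝ (J x) y = -inner ℝ x (J y))
    (hJJ : ∀ x, J (J x) = -x) {O : Set (Λ × E)} (hO : IsOpen O) {H : Λ → E → ℝ}
    (hH : IsC2FamilyOn O H) {l₀ : Λ} {H₀ : E → ℝ} (hH₀ : ∀ z, (l₀, z) ∈ O → H l₀ z = H₀ z)
    {M : Type*} [TopologicalSpace M] [CompactSpace M] [Nonempty M] {Z : M → ℝ → E} {τ : M → ℝ}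
    (hτ : Continuous τ) (hτ0 : ∀ q, 0 < τ q) (hZ0 : Continuous fun q => Z q 0)
    (hZ : ∀ q t, HasDerivAt (Z q) (-J (gradient H₀ (Z q t))) t) (hZO : ∀ q t, (l₀, Z q t) ∈ O)
    (hper : ∀ q, Function.Periodic (Z q) (τ q)) {h : ℝ} (hen : ∀ q, H₀ (Z q 0) = h)
    (hcrit : ∀ q, gradient H₀ (Z q 0) ≠ 0) {m : ℕ}
    (hpar : ∀ q, ∃ (ι : EuclideanSpace ℝ (Fin m) → E × ℝ)
      (ι' : EuclideanSpace ℝ (Fin m) →L[ℝ] E × ℝ)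
      (u₀ : EuclideanSpace ℝ (Fin m)), HasStrictFDerivAt ι ι' u₀ ∧ Function.Injective ι' ∧
      ι u₀ = (Z q 0, τ q) ∧ ∀ᶠ u in 𝓝 u₀, ι u ∈ range fun q => (Z q 0, τ q))
    {N : M → Submodule ℝ (ℝ → E)}
    (hN : ∀ q w, w ∈ N q ↔ Function.Periodic w (τ q) ∧ Differentiable ℝ w ∧
      (∃ γ : ℝ, ∀ t, J (deriv w t) = fderiv ℝ (gradient H₀) (Z q t) (w t) +
        γ • gradient H₀ (Z q t)) ∧ ∀ t, inner ℝ (gradient H₀ (Z q t)) (w t) = 0)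
    (hdim : ∀ q, Module.finrank ℝ (N q) ≤ m) {σ : ℝ} (hσ : 0 < σ) :
    ∀ᶠ l in 𝓝 l₀, ∃ (z : ℝ → E) (T : ℝ) (q : M), 0 < T ∧
      (∀ t, HasDerivAt z (-J (gradient (H l) (z t))) t) ∧ (∀ t, (l, z t) ∈ O) ∧
      Function.Periodic z T ∧ (∀ t, H l (z t) = h) ∧ |T - τ q| < σ ∧
      ∀ t ∈ Icc 0 T, ‖z t - Z q t‖ < σ := by
  -- a compact set that contains all the unperturbed orbits
  obtain ⟨Tm, hTm⟩ : ∃ Tm, ∀ q, τ q ≤ Tm := by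
    obtain ⟨Tm, hTm⟩ := (isCompact_range hτ).bddAbove
    exact ⟨Tm, fun q => hTm ⟨q, rfl⟩⟩
  have hOl : IsOpen {z | (l₀, z) ∈ O} := hO.preimage (by fun_prop)
  have hH₀2 : ContDiffOn ℝ 2 H₀ {z | (l₀, z) ∈ O} :=
    (hH.contDiffOn_slice hO l₀).congr fun z hz => (hH₀ z hz).symm
  obtain ⟨K, hK, hKO, hZK'⟩ := exists_isCompact_orbits hJ hJJ hOl hH₀2 hZ0 hZ hZO Tm
  have hZK : ∀ q t, Z q t ∈ K := fun q t => by
    obtain ⟨s, hs, hst⟩ := (hper q).exists_mem_Ico₀ (hτ0 q) t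
    rw [hst]
    exact hZK' q s ⟨hs.1, hs.2.le.trans (hTm q)⟩
  -- restriction of the parameters to a compact neighbourhood, and cutoff
  obtain ⟨V₀, S₁, hV₀, hS₁, hl₀V₀, hKS₁, hVS⟩ := generalized_tube_lemma
    (isCompact_singleton (x := l₀)) hK hO (by
      rintro ⟨l, z⟩ ⟨rfl, hz⟩
      exact hKO hz)
  obtain ⟨V, hV, hVV₀, hVc⟩ := local_compact_nhds (hV₀.mem_nhds (hl₀V₀ rfl))
  obtain ⟨χ, S, hχ, hχc, hχS, hS, hKS, hχ1⟩ := exists_cutoff hK hS₁ hKS₁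
  have hSS₁ : S ⊆ S₁ := fun z hz => hχS (subset_tsupport _ (by simp [hχ1 z hz]))
  have hSO : ∀ l ∈ V, ∀ z ∈ S, (l, z) ∈ O := fun l hl z hz => hVS ⟨hVV₀ hl, hSS₁ hz⟩
  have : CompactSpace V := isCompact_iff_compactSpace.1 hVc
  have hOV : IsOpen {p : V × E | ((p.1 : Λ), p.2) ∈ O} := hO.preimage (by fun_prop)
  obtain ⟨C, R, hR, hHam⟩ := (hH.comp_param
    (continuous_subtype_val (p := (· ∈ V)))).isHamiltonianFamily_cutoff hOV hχ hχc (by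
      rintro ⟨l, z⟩ ⟨-, hz⟩
      exact hVS ⟨hVV₀ l.2, hχS hz⟩)
  set Hc : V → E → ℝ := fun l z => χ z * H l z with hHc
  obtain ⟨φ, φ', act, hφ⟩ := exists_hamiltonianFlow hJ hJJ hHam hR
  have hloc : ∀ l : V, ∀ z ∈ S, Hc l =ᶠ[𝓝 z] H l := fun l z hz => by
    filter_upwards [hS.mem_nhds hz] with y hy
    simp only [hHc, hχ1 y hy, one_mul]
  have hgrad : ∀ l : V, ∀ z ∈ S, gradient (Hc l) z = gradient (H l) z := fun l z hz =>
    gradient_congr (hloc l z hz)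
  let l₁ : V := ⟨l₀, mem_of_mem_nhds hV⟩
  have hSO₀ : ∀ z ∈ S, H l₀ =ᶠ[𝓝 z] H₀ := fun z hz => by
    filter_upwards [hS.mem_nhds hz] with y hy
    exact hH₀ y (hSO l₀ l₁.2 y hy)
  have hgrad₀ : ∀ z ∈ S, gradient (Hc l₁) z = gradient H₀ z := fun z hz =>
    (hgrad l₁ z hz).trans (gradient_congr (hSO₀ z hz))
  have hhess₀ : ∀ z ∈ S, fderiv ℝ (gradient (Hc l₁)) z = fderiv ℝ (gradient H₀) z := fun z hz =>
    Filter.EventuallyEq.fderiv_eq (Filter.mem_of_superset (hS.mem_nhds hz) hgrad₀)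
  have hZS : ∀ q t, Z q t ∈ S := fun q t => hKS (hZK q t)
  have hZφ : ∀ q t, Z q t = φ l₁ t (Z q 0) := fun q t =>
    hφ.eq_of_hasDerivAt hHam (fun t => by rw [hgrad₀ _ (hZS q t)]; exact hZ q t) t
  have hZφτ : ∀ q, φ l₁ (τ q) (Z q 0) = Z q 0 := fun q => by
    rw [← hZφ, ← zero_add (τ q), hper q 0]
  -- the initial values and periods
  set K' : Set (E × ℝ) := range fun q => (Z q 0, τ q) with hK'
  have hK'c : IsCompact K' := isCompact_range (hZ0.prodMk hτ)
  -- near the unperturbed initial values and periods, orbits stay close to the unperturbed ones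
  have hgood : {p : V × E × ℝ | 0 < p.2.2 ∧ (∀ t ∈ Icc 0 p.2.2, φ p.1 t p.2.1 ∈ S) ∧ ∃ q,
      |p.2.2 - τ q| < σ ∧ ∀ t ∈ Icc 0 p.2.2, ‖φ p.1 t p.2.1 - Z q t‖ < σ} ∈ 𝓝ˢ ({l₁} ×ˢ K') := by
    rw [mem_nhdsSet_iff_forall]
    rintro ⟨l, p⟩ ⟨rfl, q, rfl⟩
    have h1 : ∀ᶠ p : V × E × ℝ in 𝓝 (l₁, Z q 0, τ q), ∀ t ∈ Icc 0 (τ q + 1),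
        φ p.1 t p.2.1 ∈ S ∧ ‖φ p.1 t p.2.1 - Z q t‖ < σ := by
      refine isCompact_Icc.eventually_forall_of_forall_eventually fun t ht => ?_
      have hc : Continuous fun p : (V × E × ℝ) × ℝ => φ p.1.1 p.2 p.1.2.1 :=
        hφ.continuous.comp (f := fun p : (V × E × ℝ) × ℝ => (p.1.1, p.2, p.1.2.1)) (by fun_prop)
      have hZc : Continuous (Z q) := continuous_iff_continuousAt.2 fun t => (hZ q t).continuousAt
      refine (hc.continuousAt.eventually (hS.mem_nhds ?_)).and ?_
      · simp only [← hZφ]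
        exact hZS q t
      · have hc2 : Continuous fun p : (V × E × ℝ) × ℝ => ‖φ p.1.1 p.2 p.1.2.1 - Z q p.2‖ :=
          (hc.sub (hZc.comp continuous_snd)).norm
        refine hc2.continuousAt.eventually (gt_mem_nhds ?_)
        simp only [← hZφ, sub_self, norm_zero]
        exact hσ
    have hTc : Continuous fun p : V × E × ℝ => p.2.2 := by fun_prop
    have h2 : ∀ᶠ p : V × E × ℝ in 𝓝 (l₁, Z q 0, τ q), 0 < p.2.2 :=
      hTc.continuousAt.eventually (lt_mem_nhds (hτ0 q))
    have h3 : ∀ᶠ p : V × E × ℝ in 𝓝 (l₁, Z q 0, τ q), p.2.2 < τ q + 1 :=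
      hTc.continuousAt.eventually (gt_mem_nhds (lt_add_one _))
    have h4 : ∀ᶠ p : V × E × ℝ in 𝓝 (l₁, Z q 0, τ q), |p.2.2 - τ q| < σ := by
      have hc : Continuous fun p : V × E × ℝ => |p.2.2 - τ q| := by fun_prop
      refine hc.continuousAt.eventually (gt_mem_nhds ?_)
      simpa using hσ
    filter_upwards [h1, h2, h3, h4] with p hp1 hp2 hp3 hp4
    have hsub : ∀ t ∈ Icc 0 p.2.2, t ∈ Icc 0 (τ q + 1) := fun t ht => ⟨ht.1, ht.2.trans hp3.le⟩
    exact ⟨hp2, fun t ht => (hp1 t (hsub t ht)).1, q, hp4, fun t ht => (hp1 t (hsub t ht)).2⟩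
  rw [isCompact_singleton.nhdsSet_prod_eq hK'c, nhdsSet_singleton] at hgood
  obtain ⟨Y, hY, W, hW, hYW⟩ := mem_prod_iff.1 hgood
  have key := eventually_exists_periodic_near_manifold hφ hHam hJ hJJ (l₀ := l₁) (h := h) (m := m)
    hK'c (range_nonempty _) (by rintro _ ⟨q, rfl⟩; exact hZφτ q)
    (by
      rintro _ ⟨q, rfl⟩
      have := (hloc l₁ _ (hZS q 0)).self_of_nhds
      exact this.trans ((hSO₀ _ (hZS q 0)).self_of_nhds.trans (hen q)))
    (by
      rintro _ ⟨q, rfl⟩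
      refine le_trans ?_ (hdim q)
      refine finrank_ker_fixedEnergyLinearization_le hφ hHam hJ hJJ (hτ0 q).ne' (hZφ q) (hZφτ q)
        ?_ fun w => ?_
      · rw [hgrad₀ _ (hZS q 0)]
        exact hcrit q
      · rw [hN q w]
        simp only [← hgrad₀ _ (hZS q _), ← hhess₀ _ (hZS q _)]
        exact Iff.rfl)
    (by rintro _ ⟨q, rfl⟩; exact hpar q) hW
  have key2 : ∀ᶠ l in 𝓝 l₀, ∃ hl : l ∈ V, (⟨l, hl⟩ : V) ∈ Y ∧
      ∃ p ∈ W, φ ⟨l, hl⟩ p.2 p.1 = p.1 ∧ Hc ⟨l, hl⟩ p.1 = h := by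
    rw [← map_nhds_subtype_coe_eq_nhds (mem_of_mem_nhds hV) hV, eventually_map]
    filter_upwards [key, hY] with l hl hlY
    exact ⟨l.2, hlY, hl⟩
  filter_upwards [key2] with l ⟨hl, hlY, p, hpW, hp1, hp2⟩
  obtain ⟨hT, hpS, q, hq1, hq2⟩ := hYW (mk_mem_prod hlY hpW)
  have hzper : Function.Periodic (fun t => φ ⟨l, hl⟩ t p.1) p.2 := fun t => by
    simp only [hφ.add hHam, hp1]
  have hzS : ∀ t, φ ⟨l, hl⟩ t p.1 ∈ S := fun t => by
    obtain ⟨s, hs, hst⟩ := hzper.exists_mem_Ico₀ hT t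
    simp only [hst]
    exact hpS s ⟨hs.1, hs.2.le⟩
  refine ⟨fun t => φ ⟨l, hl⟩ t p.1, p.2, q, hT, fun t => ?_, fun t => hSO l hl _ (hzS t), hzper,
    fun t => ?_, hq1, hq2⟩
  · have h1 := hφ.hasDerivAt ⟨l, hl⟩ p.1 t
    rwa [hgrad _ _ (hzS t)] at h1
  · rw [← hp2, ← hφ.energy_eq hHam hJ ⟨l, hl⟩ t p.1]
    exact (hloc ⟨l, hl⟩ _ (hzS t)).self_of_nhds.symm

end Persistence

/-! ### Local parametrizations of immersed manifolds -/

section Immersion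

open Set Filter

/-- A local parametrization of an immersed manifold in a vector space, together with a function on
the manifold, is an immersed graph in the classical sense. -/
theorem exists_hasStrictFDerivAt_of_isImmersionAt {m : ℕ} {M : Type*} [TopologicalSpace M]
    [ChartedSpace (EuclideanSpace ℝ (Fin m)) M] {Y : Type*} [NormedAddCommGroup Y]
    [NormedSpace ℝ Y] {F : M → Y} {τ : M → ℝ} {q : M}
    (hF : Manifold.IsImmersionAt (𝓡 m) 𝓘(ℝ, Y) 1 F q) (hτ : ContMDiff (𝓡 m) 𝓘(ℝ, ℝ) 1 τ) :
    ∃ (ι : EuclideanSpace ℝ (Fin m) → Y × ℝ) (ι' : EuclideanSpace ℝ (Fin m) →L[ℝ] Y × ℝ)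
      (u₀ : EuclideanSpace ℝ (Fin m)), HasStrictFDerivAt ι ι' u₀ ∧ Function.Injective ι' ∧
      ι u₀ = (F q, τ q) ∧ ∀ᶠ u in 𝓝 u₀, ι u ∈ range fun q => (F q, τ q) := by
  set D := hF.domChart
  set Cc := hF.codChart
  have hq : q ∈ D.source := hF.mem_domChart_source
  have hq' : D q ∈ D.target := D.map_source hq
  have hDs : ContMDiffAt (𝓡 m) (𝓡 m) 1 D.symm (D q) :=
    (contMDiffOn_symm_of_mem_maximalAtlas hF.domChart_mem_maximalAtlas).contMDiffAt
      (D.open_target.mem_nhds hq')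
  have hqq : D.symm (D q) = q := D.left_inv hq
  have hF1 : ContDiffAt ℝ 1 (fun u => F (D.symm u)) (D q) := by
    have h1 : ContMDiffAt (𝓡 m) 𝓘(ℝ, Y) 1 F (D.symm (D q)) := hqq.symm ▸ hF.contMDiffAt
    exact (h1.comp (D q) hDs).contDiffAt
  have hτ1 : ContDiffAt ℝ 1 (fun u => τ (D.symm u)) (D q) :=
    ((hτ.contMDiffAt (x := D.symm (D q))).comp (D q) hDs).contDiffAt
  have hC : ContDiffAt ℝ 1 Cc (F (D.symm (D q))) := by
    rw [hqq]
    exact ((contMDiffOn_of_mem_maximalAtlas hF.codChart_mem_maximalAtlas).contMDiffAt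
      (Cc.open_source.mem_nhds hF.mem_codChart_source)).contDiffAt
  have hF2 := hF1.hasStrictFDerivAt one_ne_zero
  have hτ2 := hτ1.hasStrictFDerivAt one_ne_zero
  refine ⟨fun u => (F (D.symm u), τ (D.symm u)), _, D q, hF2.prodMk hτ2, ?_, by simp only [hqq],
    Eventually.of_forall fun u => ⟨_, rfl⟩⟩
  -- in the charts of the immersion the parametrization is a linear injection
  have h1 : HasFDerivAt (fun u => Cc (F (D.symm u))) _ (D q) :=
    (hC.differentiableAt one_ne_zero).hasFDerivAt.comp (D q) hF2.hasFDerivAt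
  have h2 : (fun u => Cc (F (D.symm u))) =ᶠ[𝓝 (D q)] fun u => hF.equiv (u, 0) := by
    filter_upwards [D.open_target.mem_nhds hq'] with u hu
    have hu' : u ∈ (D.extend (𝓡 m)).target := by simpa using hu
    exact hF.writtenInCharts hu'
  let L : EuclideanSpace ℝ (Fin m) →L[ℝ] Y :=
    (hF.equiv : EuclideanSpace ℝ (Fin m) × hF.complement →L[ℝ] Y).comp
      (ContinuousLinearMap.inl ℝ (EuclideanSpace ℝ (Fin m)) hF.complement)
  have h3 : HasFDerivAt (fun u => hF.equiv (u, 0)) L (D q) := L.hasFDerivAt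
  have h4 := h1.unique (h3.congr_of_eventuallyEq h2)
  intro v w hvw
  have h5 : fderiv ℝ (fun u => F (D.symm u)) (D q) v = fderiv ℝ (fun u => F (D.symm u)) (D q) w :=
    congrArg Prod.fst hvw
  have h6 := DFunLike.congr_fun h4 v
  have h7 := DFunLike.congr_fun h4 w
  simp only [ContinuousLinearMap.comp_apply] at h6 h7
  rw [h5, h7] at h6
  have h8 := hF.equiv.injective h6
  exact (congrArg Prod.fst h8).symm

end Immersion

/-! ### The inverse of the profile and its primitive -/

section Profile

open Set Filter InnerProductSpace

theorem hasFDerivAt_comp_norm {E : Type*} [NormedAddCommGroup E] [InnerProductSpace ℝ E]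
    {F : ℝ → ℝ} {F' : ℝ} {x : E} (hx : x ≠ 0) (hF : HasDerivAt F F' ‖x‖) :
    HasFDerivAt (fun x => F ‖x‖) (innerSL ℝ ((F' / ‖x‖) • x)) x := by
  have h1 : HasFDerivAt (fun x : E => ‖x‖) ((1 / (2 * ‖x‖)) • ((2 : ℕ) • innerSL ℝ x)) x := by
    have h2 := (hasStrictFDerivAt_norm_sq x).hasFDerivAt.sqrt (by simpa using hx)
    simp only [Real.sqrt_sq (norm_nonneg _)] at h2
    exact h2
  refine (hF.comp_hasFDerivAt x h1).congr_fderiv ?_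
  have : ‖x‖ ≠ 0 := norm_ne_zero_iff.2 hx
  ext v
  simp only [smul_apply, innerSL_apply_apply, inner_smul_left, smul_eq_mul, map_div₀,
    RCLike.conj_to_real, two_nsmul, add_apply]
  field_simp
  ring

variable {a b : EReal} {f : ℝ → ℝ}

theorem mem_speeds_of_le {s t : ℝ} (ht : t ∈ speeds a) (hs : 0 ≤ s) (hst : s ≤ t) :
    s ∈ speeds a :=
  ⟨hs, (EReal.coe_le_coe_iff.2 hst).trans_lt ht.2⟩

theorem ordConnected_speeds : (speeds a).OrdConnected :=
  ⟨fun _ hs _ ht _ hu => mem_speeds_of_le ht (hs.1.trans hu.1) hu.2⟩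

theorem isOpen_pos_speeds : IsOpen {s : ℝ | 0 < s ∧ (s : EReal) < a} :=
  isOpen_Ioi.inter (isOpen_Iio.preimage continuous_coe_real_ereal)

namespace IsProfile

theorem strictMonoOn (hf : IsProfile a b f) : StrictMonoOn f (speeds a) := by
  refine strictMonoOn_of_deriv_pos ordConnected_speeds.convex hf.continuousOn fun s hs => ?_
  have h1 := interior_subset hs
  refine hf.deriv_pos s (h1.1.lt_of_ne fun h0 => ?_) h1.2
  subst h0
  obtain ⟨δ, hδ, hδs⟩ := Metric.mem_nhds_iff.1 (mem_interior_iff_mem_nhds.1 hs)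
  have h2 : -(δ / 2) ∈ speeds a := hδs (by
    rw [Metric.mem_ball, Real.dist_eq, sub_zero, abs_neg, abs_of_pos (by positivity)]
    linarith)
  linarith [h2.1]

theorem surjOn (hf : IsProfile a b f) : SurjOn f (speeds a) (speeds b) := by
  intro y hy
  have hne : (comap (fun s : ℝ => (s : EReal)) (𝓝[<] a)).NeBot := by
    refine comap_neBot fun t ht => ?_
    obtain ⟨u, hu, hut⟩ := (mem_nhdsLT_iff_exists_Ioo_subset' hf.a_pos).1 ht
    obtain ⟨s, hs1, hs2⟩ := EReal.lt_iff_exists_real_btwn.1 hu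
    exact ⟨s, hut ⟨hs1, hs2⟩⟩
  have h1 := hf.tendsto.eventually (lt_mem_nhds hy.2)
  have h2 : ∀ᶠ s : ℝ in comap (fun s : ℝ => (s : EReal)) (𝓝[<] a), 0 < s ∧ (s : EReal) < a := by
    refine eventually_comap.2 ?_
    filter_upwards [self_mem_nhdsWithin, mem_nhdsWithin_of_mem_nhds (lt_mem_nhds hf.a_pos)]
      with u hu hu0 s hs
    subst hs
    exact ⟨EReal.coe_pos.1 hu0, hu⟩
  obtain ⟨s, hs1, hs2, hs3⟩ := (h1.and h2).exists
  have hs : s ∈ speeds a := ⟨hs2.le, hs3⟩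
  have hsub : Icc 0 s ⊆ speeds a := fun t ht => mem_speeds_of_le hs ht.1 ht.2
  obtain ⟨t, ht, hty⟩ := intermediate_value_Icc hs2.le (hf.continuousOn.mono hsub)
    (show y ∈ Icc (f 0) (f s) from ⟨hf.map_zero.symm ▸ hy.1, (EReal.coe_lt_coe_iff.1 hs1).le⟩)
  exact ⟨t, hsub ht, hty⟩

theorem profileInv_mem (hf : IsProfile a b f) {y : ℝ} (hy : y ∈ speeds b) :
    profileInv a f y ∈ speeds a :=
  Function.invFunOn_mem (hf.surjOn hy)

theorem apply_profileInv (hf : IsProfile a b f) {y : ℝ} (hy : y ∈ speeds b) :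
    f (profileInv a f y) = y :=
  Function.invFunOn_eq (hf.surjOn hy)

theorem profileInv_apply (hf : IsProfile a b f) {s : ℝ} (hs : s ∈ speeds a) :
    profileInv a f (f s) = s :=
  hf.strictMonoOn.injOn.leftInvOn_invFunOn hs

theorem apply_pos (hf : IsProfile a b f) {s : ℝ} (hs : s ∈ speeds a) (h0 : 0 < s) : 0 < f s := by
  have := hf.strictMonoOn (mem_speeds_of_le hs le_rfl hs.1) hs h0
  rwa [hf.map_zero] at this

theorem strictMonoOn_profileInv (hf : IsProfile a b f) :
    StrictMonoOn (profileInv a f) (speeds b) := by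
  intro x hx y hy hxy
  by_contra h
  have := hf.strictMonoOn.monotoneOn (hf.profileInv_mem hy) (hf.profileInv_mem hx) (not_lt.1 h)
  rw [hf.apply_profileInv hx, hf.apply_profileInv hy] at this
  linarith

theorem profileInv_pos (hf : IsProfile a b f) {y : ℝ} (hy : y ∈ speeds b) (h0 : 0 < y) :
    0 < profileInv a f y := by
  refine (hf.profileInv_mem hy).1.lt_of_ne fun h => ?_
  have := hf.apply_profileInv hy
  rw [← h, hf.map_zero] at this
  linarith

/-- By the inverse function theorem; at `0` differentiability may fail, as the derivative of `f` may
tend to `0` there. -/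
theorem contDiffOn_profileInv (hf : IsProfile a b f) :
    ContDiffOn ℝ 1 (profileInv a f) {y : ℝ | 0 < y ∧ (y : EReal) < b} := by
  rintro y ⟨hy0, hyb⟩
  refine ContDiffAt.contDiffWithinAt ?_
  have hy : y ∈ speeds b := ⟨hy0.le, hyb⟩
  set s := profileInv a f y with hs
  have hsm : s ∈ speeds a := hf.profileInv_mem hy
  have hs0 : 0 < s := hf.profileInv_pos hy hy0
  have hnhds : {s : ℝ | 0 < s ∧ (s : EReal) < a} ∈ 𝓝 s := isOpen_pos_speeds.mem_nhds ⟨hs0, hsm.2⟩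
  have hfs : ContDiffAt ℝ 1 f s := hf.contDiffOn.contDiffAt hnhds
  have hd : HasStrictDerivAt f (deriv f s) s := hfs.hasStrictDerivAt one_ne_zero
  have hd' := hd.hasStrictFDerivAt_equiv (hf.deriv_pos s hs0 hsm.2).ne'
  have hfs' : f s = y := hf.apply_profileInv hy
  have h1 := hfs.to_localInverse hd'.hasFDerivAt one_ne_zero
  rw [hfs'] at h1
  refine h1.congr_of_eventuallyEq ?_
  have h2 := (hfs.hasStrictFDerivAt' hd'.hasFDerivAt one_ne_zero).localInverse_unique
    (g := profileInv a f) (by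
      filter_upwards [hnhds] with t ht
      exact hf.profileInv_apply ⟨ht.1.le, ht.2⟩)
  rwa [hfs'] at h2

theorem hasDerivAt_bigG (hf : IsProfile a b f) {y : ℝ} (hy0 : 0 < y) (hyb : (y : EReal) < b) :
    HasDerivAt (bigG a f) (profileInv a f y) y := by
  have hnhds : {y : ℝ | 0 < y ∧ (y : EReal) < b} ∈ 𝓝 y := isOpen_pos_speeds.mem_nhds ⟨hy0, hyb⟩
  refine intervalIntegral.integral_hasDerivAt_right ?_ ?_ ?_
  · refine MonotoneOn.intervalIntegrable (hf.strictMonoOn_profileInv.monotoneOn.mono ?_)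
    rw [uIcc_of_le hy0.le]
    exact fun t ht => mem_speeds_of_le (t := y) ⟨hy0.le, hyb⟩ ht.1 ht.2
  · exact hf.contDiffOn_profileInv.continuousOn.stronglyMeasurableAtFilter isOpen_pos_speeds _
      ⟨hy0, hyb⟩
  · exact hf.contDiffOn_profileInv.continuousOn.continuousAt hnhds

/-- One more derivative than `f` has, because `G' = f⁻¹`. -/
theorem contDiffOn_bigG (hf : IsProfile a b f) :
    ContDiffOn ℝ 2 (bigG a f) {y : ℝ | 0 < y ∧ (y : EReal) < b} := by
  have e2 : (2 : WithTop ℕ∞) = 1 + 1 := by norm_num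
  rw [e2, contDiffOn_succ_iff_deriv_of_isOpen isOpen_pos_speeds]
  refine ⟨fun y hy => (hf.hasDerivAt_bigG hy.1 hy.2).differentiableAt.differentiableWithinAt,
    by simp, hf.contDiffOn_profileInv.congr fun y hy => (hf.hasDerivAt_bigG hy.1 hy.2).deriv⟩

end IsProfile

/-- The inverse `k ↦ f⁻¹(|k|) k / |k|` of `φ`. -/
def velocity (a : EReal) (f : ℝ → ℝ) (k : R3) : R3 := (profileInv a f ‖k‖ / ‖k‖) • k

namespace IsProfile

theorem norm_mem_speeds {v : R3} (hv : (‖v‖ : EReal) < a) : ‖v‖ ∈ speeds a := ⟨norm_nonneg _, hv⟩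

theorem norm_phi (hf : IsProfile a b f) {v : R3} (hv : (‖v‖ : EReal) < a) :
    ‖phi f v‖ = f ‖v‖ := by
  rcases eq_or_ne v 0 with rfl | h0
  · simp [phi, hf.map_zero]
  · have h1 := (hf.mapsTo (norm_mem_speeds hv)).1
    rw [phi, norm_smul, norm_div, norm_norm, Real.norm_of_nonneg h1,
      div_mul_cancel₀ _ (norm_ne_zero_iff.2 h0)]

theorem norm_phi_lt (hf : IsProfile a b f) {v : R3} (hv : (‖v‖ : EReal) < a) :
    (‖phi f v‖ : EReal) < b := by
  rw [hf.norm_phi hv]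
  exact (hf.mapsTo (norm_mem_speeds hv)).2

theorem velocity_phi (hf : IsProfile a b f) {v : R3} (hv : (‖v‖ : EReal) < a) :
    velocity a f (phi f v) = v := by
  rcases eq_or_ne v 0 with rfl | h0
  · simp [velocity, phi]
  · have h1 := norm_pos_iff.2 h0
    have h2 := hf.apply_pos (norm_mem_speeds hv) h1
    rw [velocity, hf.norm_phi hv, hf.profileInv_apply (norm_mem_speeds hv), phi, smul_smul]
    rw [div_mul_div_cancel₀ h2.ne', div_self h1.ne', one_smul]

theorem norm_velocity (hf : IsProfile a b f) {k : R3} (hk : k ≠ 0) (hkb : (‖k‖ : EReal) < b) :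
    ‖velocity a f k‖ = profileInv a f ‖k‖ := by
  have h1 := (hf.profileInv_mem (norm_mem_speeds hkb)).1
  rw [velocity, norm_smul, norm_div, norm_norm, Real.norm_of_nonneg h1,
    div_mul_cancel₀ _ (norm_ne_zero_iff.2 hk)]

theorem norm_velocity_lt (hf : IsProfile a b f) {k : R3} (hk : k ≠ 0)
    (hkb : (‖k‖ : EReal) < b) : (‖velocity a f k‖ : EReal) < a := by
  rw [hf.norm_velocity hk hkb]
  exact (hf.profileInv_mem (norm_mem_speeds hkb)).2

theorem phi_velocity (hf : IsProfile a b f) {k : R3} (hk : k ≠ 0) (hkb : (‖k‖ : EReal) < b) :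
    phi f (velocity a f k) = k := by
  have h1 := norm_pos_iff.2 hk
  have h2 := hf.profileInv_pos (norm_mem_speeds hkb) h1
  rw [phi, hf.norm_velocity hk hkb, hf.apply_profileInv (norm_mem_speeds hkb), velocity, smul_smul,
    div_mul_div_cancel₀ h2.ne', div_self h1.ne', one_smul]

end IsProfile

end Profile

/-! ### The Hamiltonian of a particle in an electromagnetic field -/

section ConcreteHamiltonian

open Set Filter InnerProductSpace

theorem gradient_eq_of_hasFDerivAt {E : Type*} [NormedAddCommGroup E] [InnerProductSpace ℝ E]
    [CompleteSpace E] {H : E → ℝ} {z v : E} (h : HasFDerivAt H (innerSL ℝ v) z) :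
    gradient H z = v := by
  rw [gradient, h.fderiv]
  exact (toDual ℝ E).symm_apply_apply v

theorem continuousSMul_withLp {E F : Type*} [NormedAddCommGroup E] [NormedSpace ℝ E]
    [NormedAddCommGroup F] [NormedSpace ℝ F] : ContinuousSMul ℝ (WithLp 2 (E × F)) :=
  inferInstance

/-- A shortcut instance: the direct search for it unfolds the coordinates of `R3`. -/
instance : ContinuousSMul ℝ Phase := continuousSMul_withLp

theorem hasDerivAt_withLp {E F : Type*} [NormedAddCommGroup E] [NormedSpace ℝ E]
    [NormedAddCommGroup F] [NormedSpace ℝ F] {z : ℝ → WithLp 2 (E × F)} {z' : WithLp 2 (E × F)}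
    {t : ℝ} : HasDerivAt z z' t ↔
      HasDerivAt (fun t => (z t).fst) z'.fst t ∧ HasDerivAt (fun t => (z t).snd) z'.snd t := by
  refine ⟨fun h => ⟨(WithLp.fstL 2 ℝ E F).hasFDerivAt.comp_hasDerivAt t h,
    (WithLp.sndL 2 ℝ E F).hasFDerivAt.comp_hasDerivAt t h⟩, fun h => ?_⟩
  exact (WithLp.prodContinuousLinearEquiv 2 ℝ E F).symm.hasFDerivAt.comp_hasDerivAt t
    (h.1.prodMk h.2)

variable {a b : EReal} {f V : ℝ → ℝ}

/-- The Hamiltonian `G(|P - A(x)|) - V(|x|) - U(x)` of a particle in an electromagnetic field, where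
`P` is the canonical momentum. -/
def fieldHamiltonian (a : EReal) (f V : ℝ → ℝ) (U : R3 → ℝ) (A : R3 → R3) (z : Phase) : ℝ :=
  bigG a f ‖z.snd - A z.fst‖ - V ‖z.fst‖ - U z.fst

theorem fieldHamiltonian_zero (a : EReal) (f V : ℝ → ℝ) :
    fieldHamiltonian a f V (fun _ => 0) (fun _ => 0) = hamiltonian a f V := by
  funext z
  simp [fieldHamiltonian, hamiltonian]

theorem hasFDerivAt_fieldHamiltonian (hf : IsProfile a b f) (hV : ContDiffOn ℝ 2 V (Ioi 0))
    {U : R3 → ℝ} {A : R3 → R3} {z : Phase} (hx : z.fst ≠ 0) (hk : z.snd - A z.fst ≠ 0)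
    (hkb : (‖z.snd - A z.fst‖ : EReal) < b) (hU : DifferentiableAt ℝ U z.fst)
    (hA : DifferentiableAt ℝ A z.fst) :
    HasFDerivAt (fieldHamiltonian a f V U A) (innerSL ℝ (WithLp.toLp 2
      (-((deriv V ‖z.fst‖ / ‖z.fst‖) • z.fst + gradient U z.fst +
        ContinuousLinearMap.adjoint (fderiv ℝ A z.fst) (velocity a f (z.snd - A z.fst))),
        velocity a f (z.snd - A z.fst)) : Phase)) z := by
  have hfst : HasFDerivAt (fun z : Phase => z.fst) (WithLp.fstL 2 ℝ R3 R3) z :=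
    (WithLp.fstL 2 ℝ R3 R3).hasFDerivAt
  have hsnd : HasFDerivAt (fun z : Phase => z.snd) (WithLp.sndL 2 ℝ R3 R3) z :=
    (WithLp.sndL 2 ℝ R3 R3).hasFDerivAt
  have hVd : HasDerivAt V (deriv V ‖z.fst‖) ‖z.fst‖ :=
    ((hV.contDiffAt (Ioi_mem_nhds (norm_pos_iff.2 hx))).differentiableAt two_ne_zero).hasDerivAt
  have h1 := (hasFDerivAt_comp_norm hk (hf.hasDerivAt_bigG (norm_pos_iff.2 hk) hkb)).comp z
    (hsnd.sub (hA.hasFDerivAt.comp z hfst))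
  have h2 := (hasFDerivAt_comp_norm hx hVd).comp z hfst
  have h3 := hU.hasGradientAt.hasFDerivAt.comp z hfst
  refine ((h1.sub h2).sub h3).congr_fderiv ?_
  ext w
  simp only [sub_apply, ContinuousLinearMap.comp_apply, innerSL_apply_apply, toDual_apply_apply,
    WithLp.prod_inner_apply, inner_neg_left, inner_add_left, inner_sub_right,
    ContinuousLinearMap.adjoint_inner_left]
  change inner ℝ (velocity a f (z.snd - A z.fst)) w.snd -
    inner ℝ (velocity a f (z.snd - A z.fst)) (fderiv ℝ A z.fst w.fst) - _ - _ = _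
  change _ - inner ℝ ((deriv V ‖z.fst‖ / ‖z.fst‖) • z.fst) w.fst -
    inner ℝ (gradient U z.fst) w.fst = _
  have e1 : w.ofLp.1 = w.fst := rfl
  have e2 : w.ofLp.2 = w.snd := rfl
  rw [e1, e2]
  ring

theorem gradient_fieldHamiltonian (hf : IsProfile a b f) (hV : ContDiffOn ℝ 2 V (Ioi 0))
    {U : R3 → ℝ} {A : R3 → R3} {z : Phase} (hx : z.fst ≠ 0) (hk : z.snd - A z.fst ≠ 0)
    (hkb : (‖z.snd - A z.fst‖ : EReal) < b) (hU : DifferentiableAt ℝ U z.fst)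
    (hA : DifferentiableAt ℝ A z.fst) :
    gradient (fieldHamiltonian a f V U A) z = WithLp.toLp 2
      (-((deriv V ‖z.fst‖ / ‖z.fst‖) • z.fst + gradient U z.fst +
        ContinuousLinearMap.adjoint (fderiv ℝ A z.fst) (velocity a f (z.snd - A z.fst))),
        velocity a f (z.snd - A z.fst)) :=
  gradient_eq_of_hasFDerivAt (hasFDerivAt_fieldHamiltonian hf hV hx hk hkb hU hA)

/-- `v ∧ curl A = (DA)ᵀ v - (DA) v`. -/
theorem wedge_curl (A : R3 → R3) (x v : R3) :
    wedge v (curl A x) = ContinuousLinearMap.adjoint (fderiv ℝ A x) v - fderiv ℝ A x v := by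
  have h1 : ∀ i, ContinuousLinearMap.adjoint (fderiv ℝ A x) v i =
      ∑ j, v j * partialDeriv A i j x := fun i => by
    have h2 : ContinuousLinearMap.adjoint (fderiv ℝ A x) v i =
        inner ℝ (EuclideanSpace.single i (1 : ℝ))
          (ContinuousLinearMap.adjoint (fderiv ℝ A x) v) := by
      rw [EuclideanSpace.inner_single_left, map_one, one_mul]
    rw [h2, ContinuousLinearMap.adjoint_inner_right, PiLp.inner_apply]
    rfl
  have h2 : ∀ i, fderiv ℝ A x v i = ∑ j, v j * partialDeriv A j i x := fun i => by
    have h3 : v = ∑ j, v j • EuclideanSpace.single j (1 : ℝ) := by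
      ext k
      simp [Pi.single_apply]
    conv_lhs => rw [h3]
    simp [map_sum, partialDeriv]
  ext i
  rw [PiLp.sub_apply, h1, h2]
  simp only [Fin.sum_univ_three, wedge, curl, crossProduct]
  fin_cases i <;> simp <;> ring

/-- Solutions of Hamilton's equations for the field Hamiltonian are, up to the shift of the momentum
by the vector potential, solutions of the equation of motion. -/
theorem isSolution_of_hasDerivAt (hf : IsProfile a b f) (hV : ContDiffOn ℝ 2 V (Ioi 0))
    {U : R3 → ℝ} {A : R3 → R3} (hU : ∀ x, x ≠ 0 → DifferentiableAt ℝ U x)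
    (hA : ∀ x, x ≠ 0 → DifferentiableAt ℝ A x) {z : ℝ → Phase} (hx : ∀ t, (z t).fst ≠ 0)
    (hk : ∀ t, (z t).snd - A (z t).fst ≠ 0)
    (hkb : ∀ t, (‖(z t).snd - A (z t).fst‖ : EReal) < b)
    (hz : ∀ t, HasDerivAt z (-symplCLM (gradient (fieldHamiltonian a f V U A) (z t))) t) :
    IsSolution a f V U A (fun t => (z t).fst) ∧
      ∀ t, energy a f V U (z t).fst (deriv (fun t => (z t).fst) t) =
        fieldHamiltonian a f V U A (z t) := by
  have hg := fun t => gradient_fieldHamiltonian hf hV (hx t) (hk t) (hkb t) (hU _ (hx t))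
    (hA _ (hx t))
  have h1 : ∀ t, HasDerivAt (fun t => (z t).fst) (velocity a f ((z t).snd - A (z t).fst)) t := by
    intro t
    have h1 := (hasDerivAt_withLp.1 (hz t)).1
    rw [hg t, symplCLM_apply] at h1
    exact h1.congr_deriv (neg_neg _)
  have h2 : ∀ t, HasDerivAt (fun t => (z t).snd)
      ((deriv V ‖(z t).fst‖ / ‖(z t).fst‖) • (z t).fst + gradient U (z t).fst +
        ContinuousLinearMap.adjoint (fderiv ℝ A (z t).fst)
          (velocity a f ((z t).snd - A (z t).fst))) t := by
    intro t
    have h1 := (hasDerivAt_withLp.1 (hz t)).2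
    rw [hg t, symplCLM_apply] at h1
    exact h1.congr_deriv (neg_neg _)
  have h3 : ∀ t, deriv (fun t => (z t).fst) t = velocity a f ((z t).snd - A (z t).fst) :=
    fun t => (h1 t).deriv
  have h4 : ∀ t, phi f (deriv (fun t => (z t).fst) t) = (z t).snd - A (z t).fst := fun t => by
    rw [h3, hf.phi_velocity (hk t) (hkb t)]
  refine ⟨fun t => ⟨hx t, (h1 t).differentiableAt, ?_, ?_⟩, fun t => ?_⟩
  · rw [h3]
    exact hf.norm_velocity_lt (hk t) (hkb t)
  · simp only [h4]
    refine ((h2 t).sub ((hA _ (hx t)).hasFDerivAt.comp_hasDerivAt t (h1 t))).congr_deriv ?_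
    rw [h3, wedge_curl]
    abel
  · rw [energy, h4]
    rfl

/-- Solutions of the unperturbed equation with non-vanishing momentum solve Hamilton's equations. -/
theorem hasDerivAt_phaseCurve (hf : IsProfile a b f) (hV : ContDiffOn ℝ 2 V (Ioi 0))
    {X : ℝ → R3} (hX : IsSolution a f V (fun _ => 0) (fun _ => 0) X)
    (hp : ∀ t, phi f (deriv X t) ≠ 0) (t : ℝ) :
    HasDerivAt (phaseCurve f X) (-symplCLM (gradient (hamiltonian a f V) (phaseCurve f X t))) t ∧
      gradient (hamiltonian a f V) (phaseCurve f X t) ≠ 0 := by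
  obtain ⟨hx, hd, hva, hphi⟩ := hX t
  have hg := gradient_fieldHamiltonian hf hV (U := fun _ => 0) (A := fun _ => 0)
    (z := phaseCurve f X t) hx (by rw [sub_zero]; exact hp t)
    (by rw [sub_zero]; exact hf.norm_phi_lt hva) (differentiableAt_const _)
    (differentiableAt_const _)
  rw [fieldHamiltonian_zero, sub_zero] at hg
  have hv : velocity a f (phaseCurve f X t).snd = deriv X t := hf.velocity_phi hva
  have hv0 : deriv X t ≠ 0 := fun h0 => hp t (by rw [h0]; simp [phi])
  have hgr : gradient (fun _ : R3 => (0 : ℝ)) (X t) = 0 := by simp [gradient]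
  have hc : wedge (deriv X t) (curl (fun _ => 0) (X t)) = 0 := by
    rw [wedge_curl]
    simp
  rw [hgr, hc, add_zero, add_zero] at hphi
  rw [hg, hv]
  constructor
  · have e1 : (phaseCurve f X t).fst = X t := rfl
    rw [e1, hgr, symplCLM_apply]
    refine hasDerivAt_withLp.2 ⟨hd.hasDerivAt.congr_deriv (neg_neg _).symm,
      hphi.congr_deriv ?_⟩
    change _ = -(-_)
    simp
  · intro h0
    exact hv0 (congrArg WithLp.snd h0)

/-- The momentum of a non-rectilinear motion in a central field never vanishes: the angular momentum
is conserved, and if it is zero then the direction of the position does not change. -/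
theorem phi_deriv_ne_zero (hf : IsProfile a b f) {X : ℝ → R3}
    (hX : IsSolution a f V (fun _ => 0) (fun _ => 0) X) (hrect : ¬ IsRectilinear X) (t₀ : ℝ) :
    phi f (deriv X t₀) ≠ 0 := by
  intro h0
  refine hrect ?_
  have hcoord : ∀ {u : ℝ → R3} {u' : R3} {t : ℝ}, HasDerivAt u u' t → ∀ i,
      HasDerivAt (fun t => u t i) (u' i) t := fun {u u' t} h i =>
    (EuclideanSpace.proj (𝕜 := ℝ) i : R3 →L[ℝ] ℝ).hasFDerivAt.comp_hasDerivAt t h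
  have hphi : ∀ t, HasDerivAt (fun s => phi f (deriv X s)) ((deriv V ‖X t‖ / ‖X t‖) • X t) t := by
    intro t
    have h1 := (hX t).2.2.2
    have hgr : gradient (fun _ : R3 => (0 : ℝ)) (X t) = 0 := by simp [gradient]
    have hc : wedge (deriv X t) (curl (fun _ => 0) (X t)) = 0 := by
      rw [wedge_curl]
      simp
    rwa [hgr, hc, add_zero, add_zero] at h1
  have hang : ∀ i j t, X t i * phi f (deriv X t) j - X t j * phi f (deriv X t) i = 0 := by
    intro i j t
    have hd : ∀ t, HasDerivAt
        (fun t => X t i * phi f (deriv X t) j - X t j * phi f (deriv X t) i) 0 t := fun t => by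
      have hXd := (hX t).2.1.hasDerivAt
      refine (((hcoord hXd i).mul (hcoord (hphi t) j)).sub
        ((hcoord hXd j).mul (hcoord (hphi t) i))).congr_deriv ?_
      simp only [phi, PiLp.smul_apply, smul_eq_mul]
      ring
    have h1 := is_const_of_deriv_eq_zero (fun s => (hd s).differentiableAt)
      (fun s => (hd s).deriv) t t₀
    simpa [h0] using h1
  have hpar : ∀ i j t, X t i * deriv X t j = X t j * deriv X t i := by
    intro i j t
    have hva := (hX t).2.2.1
    have h1 := hang i j t
    have h2 := hf.velocity_phi hva
    have h3 : ∀ i, deriv X t i = profileInv a f ‖phi f (deriv X t)‖ / ‖phi f (deriv X t)‖ *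
        phi f (deriv X t) i := fun i => by
      conv_lhs => rw [← h2]
      rfl
    rw [h3 i, h3 j]
    linear_combination (profileInv a f ‖phi f (deriv X t)‖ / ‖phi f (deriv X t)‖) * h1
  have hd : ∀ t, HasDerivAt (fun t => (‖X t‖)⁻¹ • X t) 0 t := by
    intro t
    have hXd := (hX t).2.1.hasDerivAt
    have hx := (hX t).1
    have hn : ‖X t‖ ≠ 0 := norm_ne_zero_iff.2 hx
    have h1 : HasDerivAt (fun t => ‖X t‖) (inner ℝ ((1 / ‖X t‖) • X t) (deriv X t)) t :=
      (hasFDerivAt_comp_norm hx (hasDerivAt_id ‖X t‖)).comp_hasDerivAt t hXd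
    refine ((h1.inv hn).smul hXd).congr_deriv ?_
    ext i
    have h2 : inner ℝ (X t) (deriv X t) * X t i = ‖X t‖ ^ 2 * deriv X t i := by
      rw [← real_inner_self_eq_norm_sq, PiLp.inner_apply, PiLp.inner_apply, Finset.sum_mul,
        Finset.sum_mul]
      refine Finset.sum_congr rfl fun j _ => ?_
      simp only [RCLike.inner_apply, conj_trivial]
      linear_combination X t j * hpar i j t
    simp only [PiLp.add_apply, PiLp.smul_apply, smul_eq_mul, inner_smul_left, PiLp.zero_apply,
      RCLike.conj_to_real]
    change (‖X t‖)⁻¹ * _ + _ = _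
    field_simp
    linear_combination -h2
  refine ⟨(‖X 0‖)⁻¹ • X 0, fun t => ?_⟩
  exact is_const_of_deriv_eq_zero (fun s => (hd s).differentiableAt) (fun s => (hd s).deriv) t 0

end ConcreteHamiltonian

/-! ### Dependence of the field Hamiltonian on the parameter -/

section FieldFamily

open Set Filter

theorem continuousOn_iteratedFDeriv_fderiv {E F : Type*} [NormedAddCommGroup E] [NormedSpace ℝ E]
    [NormedAddCommGroup F] [NormedSpace ℝ F] {g : ℝ → E → F} {S : Set (ℝ × E)} {n : ℕ}
    (h : ContinuousOn (fun q : ℝ × E => iteratedFDeriv ℝ (n + 1) (g q.1) q.2) S) :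
    ContinuousOn (fun q : ℝ × E => iteratedFDeriv ℝ n (fderiv ℝ (g q.1)) q.2) S := by
  refine ((continuousMultilinearCurryRightEquiv' ℝ n E F).continuous.comp_continuousOn h).congr
    fun q _ => ?_
  rw [Function.comp_apply, iteratedFDeriv_succ_eq_comp_right, Function.comp_apply,
    LinearIsometryEquiv.apply_symm_apply]

theorem continuousOn_of_iteratedFDeriv_zero {E F : Type*} [NormedAddCommGroup E] [NormedSpace ℝ E]
    [NormedAddCommGroup F] [NormedSpace ℝ F] {g : ℝ → E → F} {S : Set (ℝ × E)}
    (h : ContinuousOn (fun q : ℝ × E => iteratedFDeriv ℝ 0 (g q.1) q.2) S) :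
    ContinuousOn (fun q : ℝ × E => g q.1 q.2) S := by
  refine ((continuousMultilinearCurryFin0 ℝ E F).continuous.comp_continuousOn h).congr
    fun q _ => ?_
  rw [Function.comp_apply, iteratedFDeriv_zero_eq_comp, Function.comp_apply,
    LinearIsometryEquiv.apply_symm_apply]

theorem isC2FamilyOn_of_continuousOn_iteratedFDeriv {E F : Type*} [NormedAddCommGroup E]
    [NormedSpace ℝ E] [NormedAddCommGroup F] [NormedSpace ℝ F] {g : ℝ → E → F} {I : Set ℝ}
    {S : Set E} (hS : IsOpen S) (hg : ∀ ε ∈ I, ContDiffOn ℝ 2 (g ε) S)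
    (hc : ∀ k : ℕ, k ≤ 2 →
      ContinuousOn (fun q : ℝ × E => iteratedFDeriv ℝ k (g q.1) q.2) (I ×ˢ S)) :
    IsC2FamilyOn (I ×ˢ S) g := by
  have h1 : ContinuousOn (fun q : ℝ × E => fderiv ℝ (g q.1) q.2) (I ×ˢ S) :=
    continuousOn_of_iteratedFDeriv_zero (g := fun ε => fderiv ℝ (g ε))
      (continuousOn_iteratedFDeriv_fderiv (hc 1 one_le_two))
  have h2 : ContinuousOn (fun q : ℝ × E => fderiv ℝ (fderiv ℝ (g q.1)) q.2) (I ×ˢ S) :=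
    continuousOn_of_iteratedFDeriv_zero (g := fun ε => fderiv ℝ (fderiv ℝ (g ε)))
      (continuousOn_iteratedFDeriv_fderiv (g := fun ε => fderiv ℝ (g ε))
        (continuousOn_iteratedFDeriv_fderiv (hc 2 le_rfl)))
  refine ⟨fun ε => fderiv ℝ (g ε), fun ε => fderiv ℝ (fderiv ℝ (g ε)),
    ⟨fun p hp => ?_, continuousOn_of_iteratedFDeriv_zero (hc 0 zero_le_two), h1⟩,
    ⟨fun p hp => ?_, h1, h2⟩⟩
  · exact (((hg p.1 hp.1).contDiffAt (hS.mem_nhds hp.2)).differentiableAt two_ne_zero).hasFDerivAt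
  · exact ((((hg p.1 hp.1).fderiv_of_isOpen hS (m := 1) (by norm_num)).contDiffAt
      (hS.mem_nhds hp.2)).differentiableAt one_ne_zero).hasFDerivAt

theorem IsC2Family.isC2FamilyOn {F : Type*} [NormedAddCommGroup F] [NormedSpace ℝ F] {ε₀ : ℝ}
    {g : ℝ → R3 → F} (hg : IsC2Family ε₀ g) :
    IsC2FamilyOn (Ioo (-ε₀) ε₀ ×ˢ {x : R3 | x ≠ 0}) g :=
  isC2FamilyOn_of_continuousOn_iteratedFDeriv isOpen_ne hg.contDiffOn hg.continuousOn

variable {a b : EReal} {f V : ℝ → ℝ}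

theorem isOpen_ne_zero_norm_lt (b : EReal) : IsOpen {k : R3 | k ≠ 0 ∧ (‖k‖ : EReal) < b} :=
  isOpen_ne.inter (isOpen_Iio.preimage (continuous_coe_real_ereal.comp continuous_norm))

/-- The set of the parameters and canonical coordinates for which the position does not vanish and
the kinetic momentum `P - A(x)` is `φ(v)` for some non-zero velocity `v`. -/
def fieldDomain (b : EReal) (ε₀ : ℝ) (A : ℝ → R3 → R3) : Set (ℝ × Phase) :=
  {p | (p.1 ∈ Ioo (-ε₀) ε₀ ∧ p.2.fst ≠ 0) ∧ p.2.snd - A p.1 p.2.fst ≠ 0 ∧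
    (‖p.2.snd - A p.1 p.2.fst‖ : EReal) < b}

theorem isOpen_fieldDomain (b : EReal) {ε₀ : ℝ} {A : ℝ → R3 → R3} (hA : IsC2Family ε₀ A) :
    IsOpen (fieldDomain b ε₀ A) := by
  have hfst : Continuous fun p : ℝ × Phase => p.2.fst :=
    (WithLp.fstL 2 ℝ R3 R3).continuous.comp continuous_snd
  have hsnd : Continuous fun p : ℝ × Phase => p.2.snd :=
    (WithLp.sndL 2 ℝ R3 R3).continuous.comp continuous_snd
  have h1 : IsOpen {p : ℝ × Phase | p.1 ∈ Ioo (-ε₀) ε₀ ∧ p.2.fst ≠ 0} :=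
    (isOpen_Ioo.preimage continuous_fst).inter (isOpen_ne.preimage hfst)
  have h2 : ContinuousOn (fun p : ℝ × Phase => p.2.snd - A p.1 p.2.fst)
      {p : ℝ × Phase | p.1 ∈ Ioo (-ε₀) ε₀ ∧ p.2.fst ≠ 0} :=
    hsnd.continuousOn.sub ((continuousOn_of_iteratedFDeriv_zero
      (hA.continuousOn 0 zero_le_two)).comp (f := fun p : ℝ × Phase => (p.1, p.2.fst))
      (continuous_fst.prodMk hfst).continuousOn fun p hp => ⟨hp.1, hp.2⟩)
  exact h2.isOpen_inter_preimage h1 (isOpen_ne_zero_norm_lt b)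

theorem isC2FamilyOn_fieldHamiltonian (hf : IsProfile a b f) (hV : ContDiffOn ℝ 2 V (Ioi 0))
    {ε₀ : ℝ} {U : ℝ → R3 → ℝ} {A : ℝ → R3 → R3} (hU : IsC2Family ε₀ U) (hA : IsC2Family ε₀ A) :
    IsC2FamilyOn (fieldDomain b ε₀ A) fun ε => fieldHamiltonian a f V (U ε) (A ε) := by
  have hU1 := (hU.isC2FamilyOn.comp_clm (WithLp.fstL 2 ℝ R3 R3)).mono
    (O' := fieldDomain b ε₀ A) fun p hp => ⟨hp.1.1, hp.1.2⟩
  have hA1 := (hA.isC2FamilyOn.comp_clm (WithLp.fstL 2 ℝ R3 R3)).mono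
    (O' := fieldDomain b ε₀ A) fun p hp => ⟨hp.1.1, hp.1.2⟩
  have h1 := isC2FamilyOn_const (fieldDomain b ε₀ A) (WithLp.fstL 2 ℝ R3 R3).contDiff
  have h2 := isC2FamilyOn_const (fieldDomain b ε₀ A) (WithLp.sndL 2 ℝ R3 R3).contDiff
  have h3 := (h2.prodMk hA1).contDiffOn_comp (c := fun p : R3 × R3 => p.1 - p.2) isOpen_univ
    (contDiff_fst.sub contDiff_snd).contDiffOn fun _ _ => mem_univ _
  -- `G(|k|) - V(|x|) - u` as a function of `(x, k, u)`
  have hS : IsOpen {p : R3 × R3 × ℝ | p.1 ≠ 0 ∧ p.2.1 ≠ 0 ∧ (‖p.2.1‖ : EReal) < b} :=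
    (isOpen_ne.preimage continuous_fst).inter
      ((isOpen_ne_zero_norm_lt b).preimage (continuous_fst.comp continuous_snd))
  have hc : ContDiffOn ℝ 2 (fun p : R3 × R3 × ℝ => bigG a f ‖p.2.1‖ - V ‖p.1‖ - p.2.2)
      {p : R3 × R3 × ℝ | p.1 ≠ 0 ∧ p.2.1 ≠ 0 ∧ (‖p.2.1‖ : EReal) < b} := by
    rintro p ⟨hp1, hp2, hp3⟩
    refine ContDiffAt.contDiffWithinAt ?_
    have e1 : ContDiffAt ℝ 2 (fun p : R3 × R3 × ℝ => ‖p.2.1‖) p :=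
      (contDiffAt_fst.comp p contDiffAt_snd).norm ℝ hp2
    have e2 : ContDiffAt ℝ 2 (fun p : R3 × R3 × ℝ => ‖p.1‖) p := contDiffAt_fst.norm ℝ hp1
    have e3 : ContDiffAt ℝ 2 (bigG a f) ‖p.2.1‖ := hf.contDiffOn_bigG.contDiffAt
      (isOpen_pos_speeds.mem_nhds ⟨norm_pos_iff.2 hp2, hp3⟩)
    have e4 : ContDiffAt ℝ 2 V ‖p.1‖ := hV.contDiffAt (Ioi_mem_nhds (norm_pos_iff.2 hp1))
    exact ((e3.comp p e1).sub (e4.comp p e2)).sub (contDiffAt_snd.comp p contDiffAt_snd)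
  exact (h1.prodMk (h3.prodMk hU1)).contDiffOn_comp hS hc fun p hp => ⟨hp.1.2, hp.2⟩

end FieldFamily

end CentralForce

end

/-! ### Periodic solutions of the perturbed equation -/

open CentralForce in
theorem theorem5p2
    (a b : EReal) (f V : ℝ → ℝ)
    (hf : CentralForce.IsProfile a b f)
    (hV : ContDiffOn ℝ 2 V (Set.Ioi 0))
    (ε₀ : ℝ) (hε₀ : 0 < ε₀)
    (U : ℝ → CentralForce.R3 → ℝ) (A : ℝ → CentralForce.R3 → CentralForce.R3)
    (hU : CentralForce.IsC2Family ε₀ U) (hA : CentralForce.IsC2Family ε₀ A)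
    (hU0 : ∀ x : CentralForce.R3, x ≠ 0 → U 0 x = 0)
    (hA0 : ∀ x : CentralForce.R3, x ≠ 0 → A 0 x = 0)
    (h : ℝ) (m : ℕ)
    (M : Type*) [TopologicalSpace M] [ChartedSpace (EuclideanSpace ℝ (Fin m)) M] [Nonempty M]
    (X : M → ℝ → CentralForce.R3) (τ : M → ℝ)
    (hM : CentralForce.IsPeriodicManifold a f V h m M X τ)
    (hnd : CentralForce.IsNondegenerate a f V m X τ)
    (σ : ℝ) (hσ : 0 < σ) :
    ∃ εs : ℝ, 0 < εs ∧ εs ≤ ε₀ ∧ ∀ ε ∈ Set.Ioo (-εs) εs,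
      ∃ (x : ℝ → CentralForce.R3) (T : ℝ) (q : M),
        0 < T ∧
        CentralForce.IsSolution a f V (U ε) (A ε) x ∧
        Function.Periodic x T ∧
        (∀ t : ℝ, CentralForce.energy a f V (U ε) (x t) (deriv x t) = h) ∧
        |T - τ q| < σ ∧
        ∀ t ∈ Set.Icc (0 : ℝ) T, ‖x t - X q t‖ < σ := by
  have := hM.compactSpace
  have hp : ∀ q t, phi f (deriv (X q) t) ≠ 0 := fun q =>
    phi_deriv_ne_zero hf (hM.isSolution q) (hM.not_rectilinear q)
  have hemb := hM.isEmbedding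
  have hZ := fun q => hasDerivAt_phaseCurve hf hV (hM.isSolution q) (hp q)
  have key := eventually_exists_periodic_orbit (l₀ := (0 : ℝ)) (H₀ := hamiltonian a f V)
    (Z := fun q => phaseCurve f (X q)) (τ := τ) (h := h) (m := m)
    (N := fun q => fixedEnergyKernel (hamiltonian a f V) (phaseCurve f (X q)) (τ q))
    inner_symplCLM symplCLM_symplCLM (isOpen_fieldDomain b hA)
    (isC2FamilyOn_fieldHamiltonian hf hV hU hA) ?_ hM.contMDiff_period.continuous hM.period_pos
    hemb.isEmbedding.continuous (fun q t => (hZ q t).1) ?_ ?_ ?_ (fun q => (hZ q 0).2)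
    (fun q => exists_hasStrictFDerivAt_of_isImmersionAt (hemb.isImmersion.isImmersionAt q)
      hM.contMDiff_period) (fun q w => Iff.rfl) (fun q => (hnd q).le) hσ
  · -- the field Hamiltonian is only controlled for parameters less than `ε₀` in absolute value
    obtain ⟨δ, hδ, hδk⟩ := Metric.eventually_nhds_iff.1 key
    refine ⟨min δ ε₀, lt_min hδ hε₀, min_le_right _ _, fun ε hε => ?_⟩
    have hεδ : dist ε 0 < δ := by
      rw [Real.dist_eq, sub_zero, abs_lt]
      exact ⟨(neg_le_neg (min_le_left _ _)).trans_lt hε.1, hε.2.trans_le (min_le_left _ _)⟩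
    obtain ⟨z, T, q, hT, hz, hzO, hper, hen, hTq, hzq⟩ := hδk hεδ
    have hεI := (hzO 0).1.1
    have hsol := isSolution_of_hasDerivAt hf hV
      (fun x hx => ((hU.contDiffOn ε hεI).contDiffAt (isOpen_ne.mem_nhds hx)).differentiableAt
        two_ne_zero)
      (fun x hx => ((hA.contDiffOn ε hεI).contDiffAt (isOpen_ne.mem_nhds hx)).differentiableAt
        two_ne_zero)
      (fun t => (hzO t).1.2) (fun t => (hzO t).2.1) (fun t => (hzO t).2.2) hz
    refine ⟨fun t => (z t).fst, T, q, hT, hsol.1, fun t => congrArg WithLp.fst (hper t),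
      fun t => (hsol.2 t).trans (hen t), hTq, fun t ht => ?_⟩
    exact (WithLp.norm_fst_le _ (z t - phaseCurve f (X q) t)).trans_lt (hzq t ht)
  · rintro z ⟨⟨-, hz⟩, -⟩
    change bigG a f ‖z.snd - A 0 z.fst‖ - V ‖z.fst‖ - U 0 z.fst = _
    rw [hU0 _ hz, hA0 _ hz, sub_zero, sub_zero]
    rfl
  · intro q t
    have hx := (hM.isSolution q t).1
    -- without vector potential the canonical momentum is `φ(ẋ)`
    have e1 : (phaseCurve f (X q) t).snd - A 0 (phaseCurve f (X q) t).fst =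
        phi f (deriv (X q) t) := by
      change _ - A 0 (X q t) = _
      rw [hA0 _ hx, sub_zero]
      rfl
    refine ⟨⟨⟨neg_lt_zero.2 hε₀, hε₀⟩, hx⟩, ?_⟩
    rw [e1]
    exact ⟨hp q t, hf.norm_phi_lt (hM.isSolution q t).2.2.1⟩
  · intro q t
    have h1 : (fun s => X q (s + τ q)) = X q := funext (hM.periodic q)
    have h2 : deriv (X q) (t + τ q) = deriv (X q) t := by
      rw [← deriv_comp_add_const, h1]
    simp only [phaseCurve, h2, hM.periodic q t]
  · intro q
    have h1 := hM.energy_eq q 0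
    rw [energy, sub_zero] at h1
    exact h1
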